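/- Let $G$ be a finite subgroup of $\mathrm{PSU}_2(\mathbb C)\simeq \mathrm{SO}_3(\mathbb R)$, acting on $\mathbb P^1=\mathbb P^1(\mathbb C)$ by homographies. Let $\mathbb P^1_*\subset\mathbb P^1$ be the set of points with trivial stabilizer, let $n\ge 1$, and let $$\mathrm{Cf}_G(n,\mathbb P^1_*)=\{(p_1,\dots,p_n)\in(\mathbb P^1_*)^n : p_i\ne g\cdot p_j \text{ for all } i\neq j,\ g\in G\}.$$ Fix a point $\underline q=(q_1,\dots,q_n)\in \mathrm{Cf}_G(n,\mathbb P^1_*)$ and put $\Gamma_n=\pi_1(\mathrm{Cf}_G(n,\mathbb P^1_*),\underline q)$. *Loops.* For $i\in[1,n]$ put $E_i=(\mathbb P^1\setminus\mathbb P^1_*)\cup\bigcup_{j\ne i}G\cdot q_j$. For $p\in E_i$ choose a closed disc $\bar D\subset\mathbb P^1$ with $q_i$ on its boundary, $p$ in its interior and $\bar D\cap E_i=\{p\}$, and let $\gamma_i(p)$ be the loop at $q_i$ that runs once along the boundary of $\bar D$ in the negative (clockwise) sense. For $i<j$ and $g\in G$ let $x_{ij}(g)\in\Gamma_n$ be the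 class of the loop $t\mapsto(q_1,\dots,q_{i-1},\gamma_i(g\cdot q_j)(t),q_{i+1},\dots,q_n)$. For $k\in[1,n]$ and $q\in\mathbb P^1\setminus\mathbb P^1_*$ let $x_k(q)\in\Gamma_n$ be the class of $t\mapsto(q_1,\dots,q_{k-1},\gamma_k(q)(t),q_{k+1},\dots,q_n)$. The choices of discs are arbitrary and fixed. *The Lie algebra $\mathfrak p_n(G)$.* Let $\mathbb K$ be a field of characteristic $0$. Let $\mathfrak p_n(G)(\mathbb K)$ be the $\mathbb K$-Lie algebra generated by elements $X_{ij}(g)$ ($i\ne j$ in $[1,n]$, $g\in G$) and $X_i(q)$ ($i\in[1,n]$, $q\in\mathbb P^1\setminus\mathbb P^1_*$), with the following relations, for all distinct indices $i,j,k,l\in[1,n]$, all $g,g'\in G$ and all $p,q\in\mathbb P^1\setminus\mathbb P^1_*$: 1. $X_{ij}(g)=X_{ji}(g^{-1})$; 2. $\sum_{q\in\mathbb P^1\setminus\mathbb P^1_*}X_i(q)+\sum_{m\neq i}\sum_{g\in G}X_{im}(g)=0$; 3. $[X_{ij}(g),X_{kl}(g')]=0$; 4. $[X_{ij}(g),X_{kj}(g'g)+X_{ki}(g')]=0$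 and $[X_i(p),X_{jk}(g')]=0$; 5. $[X_i(p),X_j(q)]=0$ if $q\notin G\cdot p$; 6. $[X_{ij}(g),\,X_j(p)+X_i(g\cdot p)+\sum_{h\in\mathrm{stab}(p)}X_{ij}(gh)]=0$; 7. $[X_j(p),\,X_i(g\cdot p)+\sum_{h\in\mathrm{stab}(p)}X_{ij}(gh)]=0$. It is graded, with all generators in degree $1$: $\mathfrak p_n(G)(\mathbb K)=\bigoplus_{k\ge1}\mathfrak p_n^k$. Its completion for the degree is $\widehat{\mathfrak p}_n(G)(\mathbb K)=\prod_{k\ge1}\mathfrak p_n^k$, filtered by the ideals $\prod_{k\ge m}\mathfrak p_n^k$. *The Malcev Lie algebra.* Let $I$ be the augmentation ideal of $\mathbb K[\Gamma_n]$, and let $\mathrm{Lie}(\Gamma_n(\mathbb K))$ be the Lie algebra of primitive elements of the complete Hopf algebra $\varprojlim_k\mathbb K[\Gamma_n]/I^k$. It is filtered by the subspaces $F_k$ of those elements that vanish in $\mathbb K[\Gamma_n]/I^k$. Let $\widehat{\mathrm{gr}}\,\mathrm{Lie}(\Gamma_n(\mathbb K))=\prod_{k\ge1}F_k/F_{k+1}$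 be the completion for the degree of the associated graded Lie algebra, filtered by the ideals $\prod_{k\ge m}F_k/F_{k+1}$. For $\gamma\in\Gamma_n$, the element $\log\gamma=\sum_{m\ge1}\frac{(-1)^{m+1}}{m}(\gamma-1)^m$ belongs to $\mathrm{Lie}(\Gamma_n(\mathbb K))=F_1$; let $[\log\gamma]_1$ be its class in $F_1/F_2$. **Proposition.** There is a unique morphism of filtered Lie algebras $$\phi_{\mathbb K}:\widehat{\mathfrak p}_n(G)(\mathbb K)\longrightarrow\widehat{\mathrm{gr}}\,\mathrm{Lie}(\Gamma_n(\mathbb K))$$ such that $\phi_{\mathbb K}(X_{ij}(g))=[\log x_{ij}(g)]_1$ for $1\le i<j\le n$ and $g\in G$, and $\phi_{\mathbb K}(X_k(q))=[\log x_k(q)]_1$ for $k\in[1,n]$ and $q\in\mathbb P^1\setminus\mathbb P^1_*$. -/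

import Mathlib

open scoped TensorProduct

namespace OrbitConf

noncomputable section

/-! ### Sequences -/

section Seq

variable (K : Type*) (L : Type*) [CommRing K] [LieRing L] [LieAlgebra K L]

/-- Sequences `(x_k)_{k ≥ 0}` in a Lie algebra `L`, thought of as formal series `∑ x_k t^k`. -/
def LieSeq (L : Type*) : Type _ := ℕ → L

instance : AddCommGroup (LieSeq L) := inferInstanceAs (AddCommGroup (ℕ → L))

instance : Module K (LieSeq L) := inferInstanceAs (Module K (ℕ → L))

/-- The bracket of formal series: `⁅x, y⁆_n = ∑_{i+j=n} ⁅x_i, y_j⁆`. -/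
instance : Bracket (LieSeq L) (LieSeq L) where
  bracket x y := fun n => ∑ p ∈ Finset.HasAntidiagonal.antidiagonal n, ⁅x p.1, y p.2⁆

variable {L}

theorem LieSeq.ext {L : Type*} {x y : LieSeq L} (h : ∀ n, x n = y n) : x = y := funext h

theorem LieSeq.lie_apply (x y : LieSeq L) (n : ℕ) :
    ⁅x, y⁆ n = ∑ p ∈ Finset.HasAntidiagonal.antidiagonal n, ⁅x p.1, y p.2⁆ := rfl

theorem LieSeq.add_apply (x y : LieSeq L) (n : ℕ) : (x + y) n = x n + y n := rfl

theorem LieSeq.smul_apply (c : K) (x : LieSeq L) (n : ℕ) : (c • x) n = c • x n := rfl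

theorem LieSeq.zero_apply (n : ℕ) : (0 : LieSeq L) n = 0 := rfl

theorem LieSeq.lie_self' (x : LieSeq L) : ⁅x, x⁆ = 0 := by
  apply LieSeq.ext
  intro n
  rw [LieSeq.lie_apply, LieSeq.zero_apply]
  refine Finset.sum_involution (fun p _ => p.swap) ?_ ?_ ?_ ?_
  · intro p _
    change ⁅x p.1, x p.2⁆ + ⁅x p.2, x p.1⁆ = 0
    rw [← lie_skew, neg_add_cancel]
  · intro p _ h heq
    apply h
    have : p.2 = p.1 := congrArg Prod.fst heq
    rw [this, lie_self]
  · intro p hp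
    simpa [add_comm] using hp
  · intro p _
    simp

theorem LieSeq.leibniz' (x y z : LieSeq L) : ⁅x, ⁅y, z⁆⁆ = ⁅⁅x, y⁆, z⁆ + ⁅y, ⁅x, z⁆⁆ := by
  apply LieSeq.ext
  intro n
  simp only [LieSeq.lie_apply, LieSeq.add_apply, lie_sum, sum_lie]
  have e1 : ∑ p ∈ Finset.HasAntidiagonal.antidiagonal n, ∑ r ∈ Finset.HasAntidiagonal.antidiagonal p.1, ⁅⁅x r.1, y r.2⁆, z p.2⁆
      = ∑ p ∈ Finset.HasAntidiagonal.antidiagonal n, ∑ r ∈ Finset.HasAntidiagonal.antidiagonal p.2,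
          ⁅⁅x p.1, y r.1⁆, z r.2⁆ := by
    simp only [Finset.sum_sigma']
    refine Finset.sum_nbij' (fun a => ⟨(a.2.1, a.2.2 + a.1.2), (a.2.2, a.1.2)⟩)
      (fun a => ⟨(a.1.1 + a.2.1, a.2.2), (a.1.1, a.2.1)⟩) ?_ ?_ ?_ ?_ ?_ <;>
    · rintro ⟨⟨a, b⟩, ⟨c, d⟩⟩ h
      simp only [Finset.mem_sigma, Finset.HasAntidiagonal.mem_antidiagonal] at h
      obtain ⟨h1, h2⟩ := h
      subst h2
      subst h1
      simp [add_assoc]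
  have e2 : ∑ p ∈ Finset.HasAntidiagonal.antidiagonal n, ∑ r ∈ Finset.HasAntidiagonal.antidiagonal p.2, ⁅y p.1, ⁅x r.1, z r.2⁆⁆
      = ∑ p ∈ Finset.HasAntidiagonal.antidiagonal n, ∑ r ∈ Finset.HasAntidiagonal.antidiagonal p.2,
          ⁅y r.1, ⁅x p.1, z r.2⁆⁆ := by
    simp only [Finset.sum_sigma']
    refine Finset.sum_nbij' (fun a => ⟨(a.2.1, a.1.1 + a.2.2), (a.1.1, a.2.2)⟩)
      (fun a => ⟨(a.2.1, a.1.1 + a.2.2), (a.1.1, a.2.2)⟩) ?_ ?_ ?_ ?_ ?_ <;>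
    · rintro ⟨⟨a, b⟩, ⟨c, d⟩⟩ h
      simp only [Finset.mem_sigma, Finset.HasAntidiagonal.mem_antidiagonal] at h
      obtain ⟨h1, h2⟩ := h
      subst h2
      subst h1
      simp [add_left_comm]
  rw [e1, e2, ← Finset.sum_add_distrib]
  refine Finset.sum_congr rfl fun p _ => ?_
  rw [← Finset.sum_add_distrib]
  exact Finset.sum_congr rfl fun r _ => leibniz_lie _ _ _

instance : LieRing (LieSeq L) where
  add_lie x y z := LieSeq.ext fun n => by
    simp [LieSeq.lie_apply, LieSeq.add_apply, Finset.sum_add_distrib]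
  lie_add x y z := LieSeq.ext fun n => by
    simp [LieSeq.lie_apply, LieSeq.add_apply, Finset.sum_add_distrib]
  lie_self := LieSeq.lie_self'
  leibniz_lie := LieSeq.leibniz'

instance : LieAlgebra K (LieSeq L) where
  lie_smul c x y := LieSeq.ext fun n => by
    simp [LieSeq.lie_apply, LieSeq.smul_apply, Finset.smul_sum]

end Seq

/-! ### Gradings generated in degree one -/

section Graded

variable (K : Type*) {L : Type*} [CommRing K] [LieRing L] [LieAlgebra K L] {ι : Type*}

/-- `IsLieMonomial a k x`: the element `x` is an iterated bracket of exactly `k` members of the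
family `a`. -/
inductive IsLieMonomial (a : ι → L) : ℕ → L → Prop
  | of (i : ι) : IsLieMonomial a 1 (a i)
  | lie {k l : ℕ} {x y : L} :
      IsLieMonomial a k x → IsLieMonomial a l y → IsLieMonomial a (k + l) ⁅x, y⁆

/-- The component of degree `k` of a Lie algebra generated by the family `a`,
each `a i` having degree `1`. -/
def degreePart (a : ι → L) (k : ℕ) : Submodule K L := Submodule.span K {x | IsLieMonomial a k x}

theorem degreePart_lie (a : ι → L) {k l : ℕ} {x y : L} (hx : x ∈ degreePart K a k)
    (hy : y ∈ degreePart K a l) : ⁅x, y⁆ ∈ degreePart K a (k + l) := by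
  induction hx using Submodule.span_induction with
  | mem x hx =>
    induction hy using Submodule.span_induction with
    | mem y hy => exact Submodule.subset_span (IsLieMonomial.lie hx hy)
    | zero => simp
    | add u v _ _ hu hv => rw [lie_add]; exact add_mem hu hv
    | smul c u _ hu => rw [lie_smul]; exact Submodule.smul_mem _ c hu
  | zero => simp
  | add u v _ _ hu hv => rw [add_lie]; exact add_mem hu hv
  | smul c u _ hu => rw [smul_lie]; exact Submodule.smul_mem _ c hu

/-- The completion for the degree, `∏_k L_k`, with `L_k` the component of degree `k`
(and `L_0 = 0`): sequences whose `k`-th term is homogeneous of degree `k`. -/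
def degreeCompletion (a : ι → L) : LieSubalgebra K (LieSeq L) where
  carrier := {x | ∀ k, x k ∈ degreePart K a k}
  add_mem' hx hy k := add_mem (hx k) (hy k)
  zero_mem' _ := zero_mem _
  smul_mem' c _ hx k := Submodule.smul_mem _ c (hx k)
  lie_mem' {x y} hx hy n := by
    change ∑ p ∈ Finset.HasAntidiagonal.antidiagonal n, ⁅x p.1, y p.2⁆ ∈ _
    refine Submodule.sum_mem _ fun p hp => ?_
    rw [← Finset.HasAntidiagonal.mem_antidiagonal.mp hp]
    exact degreePart_lie K a (hx p.1) (hy p.2)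

/-- The filtration by the degree: `∏_{k ≥ m} L_k`. -/
def degreeFiltration (a : ι → L) (m : ℕ) : Submodule K (degreeCompletion K a) where
  carrier := {x | ∀ k < m, (x : LieSeq L) k = 0}
  add_mem' {x y} hx hy k hk := by
    change (x : LieSeq L) k + (y : LieSeq L) k = 0
    rw [hx k hk, hy k hk, add_zero]
  zero_mem' _ _ := rfl
  smul_mem' c x hx k hk := by
    change c • (x : LieSeq L) k = 0
    rw [hx k hk, smul_zero]

/-- The generator `a i` seen in the completion, in degree `1`. -/
def degreeCompletionGen (a : ι → L) (i : ι) : degreeCompletion K a :=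
  ⟨fun k => if k = 1 then a i else 0, fun k => by
    by_cases h : k = 1
    · subst h
      change (if (1 : ℕ) = 1 then a i else 0) ∈ _
      rw [if_pos rfl]
      exact Submodule.subset_span (IsLieMonomial.of i)
    · simp [h]⟩

end Graded

/-! ### Filtered Lie algebras and their completed associated graded -/

section Filtered

/-- A decreasing filtration of a Lie algebra, compatible with the bracket. -/
structure LieFiltration (K L : Type*) [CommRing K] [LieRing L] [LieAlgebra K L] where
  F : ℕ → Submodule K L
  succ_le : ∀ k, F (k + 1) ≤ F k
  lie_mem : ∀ {k l : ℕ} {x y : L}, x ∈ F k → y ∈ F l → ⁅x, y⁆ ∈ F (k + l)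

variable {K L : Type*} [CommRing K] [LieRing L] [LieAlgebra K L] (𝓕 : LieFiltration K L)

namespace LieFiltration

/-- `gr_k = F_k / F_{k+1}`. -/
abbrev Gr (k : ℕ) : Type _ := 𝓕.F k ⧸ (𝓕.F (k + 1)).submoduleOf (𝓕.F k)

/-- The class `[x]_k` in `gr_k` of an element `x` of `F_k`. -/
def cls (k : ℕ) : 𝓕.F k →ₗ[K] 𝓕.Gr k := Submodule.mkQ _

theorem cls_surjective (k : ℕ) : Function.Surjective (𝓕.cls k) := Submodule.mkQ_surjective _

theorem cls_eq_zero {k : ℕ} (x : 𝓕.F k) : 𝓕.cls k x = 0 ↔ (x : L) ∈ 𝓕.F (k + 1) := by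
  rw [cls, Submodule.mkQ_apply, Submodule.Quotient.mk_eq_zero]; rfl

/-- The bracket `F_i × F_j → gr_n` for `i + j = n`. -/
def preBracket {i j n : ℕ} (h : i + j = n) : 𝓕.F i →ₗ[K] 𝓕.F j →ₗ[K] 𝓕.Gr n :=
  LinearMap.mk₂ K (fun x y => 𝓕.cls n ⟨⁅(x : L), (y : L)⁆, h ▸ 𝓕.lie_mem x.2 y.2⟩)
    (fun x y z => by rw [← map_add]; congr 1; ext; simp)
    (fun c x y => by rw [← map_smul]; congr 1; ext; simp)
    (fun x y z => by rw [← map_add]; congr 1; ext; simp)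
    (fun c x y => by rw [← map_smul]; congr 1; ext; simp)

/-- The bracket `gr_i × gr_j → gr_n` for `i + j = n`, induced by the bracket of `L`. -/
def grBracket {i j n : ℕ} (h : i + j = n) : 𝓕.Gr i →ₗ[K] 𝓕.Gr j →ₗ[K] 𝓕.Gr n :=
  Submodule.liftQ _
    { toFun := fun x => Submodule.liftQ _ (𝓕.preBracket h x) (fun y hy => by
        rw [LinearMap.mem_ker]
        refine (𝓕.cls_eq_zero _).mpr ?_
        have := 𝓕.lie_mem x.2 hy
        rwa [← add_assoc, h] at this)
      map_add' := fun x y => by ext z; simp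
      map_smul' := fun c x => by ext z; simp }
    (fun x hx => by
      rw [LinearMap.mem_ker]
      ext y
      refine (𝓕.cls_eq_zero _).mpr ?_
      have := 𝓕.lie_mem hx y.2
      rwa [add_right_comm, h] at this)

theorem grBracket_cls {i j n : ℕ} (h : i + j = n) (x : 𝓕.F i) (y : 𝓕.F j) :
    𝓕.grBracket h (𝓕.cls i x) (𝓕.cls j y) =
      𝓕.cls n ⟨⁅(x : L), (y : L)⁆, h ▸ 𝓕.lie_mem x.2 y.2⟩ := rfl

/-- The completion for the degree of the associated graded Lie algebra: `∏_k gr_k`. -/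
def GrHat : Type _ := ∀ k, 𝓕.Gr k

instance : AddCommGroup 𝓕.GrHat := inferInstanceAs (AddCommGroup (∀ k, 𝓕.Gr k))

instance : Module K 𝓕.GrHat := inferInstanceAs (Module K (∀ k, 𝓕.Gr k))

/-- The bracket of `∏_k gr_k`: `⁅x, y⁆_n = ∑_{i+j=n} ⁅x_i, y_j⁆`. -/
instance : Bracket 𝓕.GrHat 𝓕.GrHat where
  bracket x y := fun n => ∑ p : Finset.HasAntidiagonal.antidiagonal n,
    𝓕.grBracket (Finset.HasAntidiagonal.mem_antidiagonal.mp p.2) (x p.1.1) (y p.1.2)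

theorem GrHat.ext {x y : 𝓕.GrHat} (h : ∀ n, x n = y n) : x = y := funext h

/-- The series `∑ x_k` with `x_k ∈ F_k`. -/
def series : LieSubalgebra K (LieSeq L) where
  carrier := {x | ∀ k, x k ∈ 𝓕.F k}
  add_mem' hx hy k := add_mem (hx k) (hy k)
  zero_mem' _ := zero_mem _
  smul_mem' c _ hx k := Submodule.smul_mem _ c (hx k)
  lie_mem' {x y} hx hy n := by
    change ∑ p ∈ Finset.HasAntidiagonal.antidiagonal n, ⁅x p.1, y p.2⁆ ∈ _
    refine Submodule.sum_mem _ fun p hp => ?_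
    rw [← Finset.HasAntidiagonal.mem_antidiagonal.mp hp]
    exact 𝓕.lie_mem (hx p.1) (hy p.2)

/-- Termwise passage to the classes. -/
def seriesCls : 𝓕.series →ₗ[K] 𝓕.GrHat where
  toFun x := fun k => 𝓕.cls k ⟨(x : LieSeq L) k, x.2 k⟩
  map_add' _ _ := rfl
  map_smul' _ _ := rfl

theorem seriesCls_surjective : Function.Surjective 𝓕.seriesCls := fun x => by
  choose y hy using fun k => 𝓕.cls_surjective k (x k)
  exact ⟨⟨fun k => y k, fun k => (y k).2⟩, GrHat.ext _ hy⟩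

theorem seriesCls_lie (x y : 𝓕.series) : ⁅𝓕.seriesCls x, 𝓕.seriesCls y⁆ = 𝓕.seriesCls ⁅x, y⁆ := by
  apply GrHat.ext
  intro n
  change ∑ p : Finset.HasAntidiagonal.antidiagonal n, 𝓕.grBracket (Finset.HasAntidiagonal.mem_antidiagonal.mp p.2)
    (𝓕.cls _ _) (𝓕.cls _ _) = 𝓕.cls n _
  simp only [grBracket_cls]
  rw [← map_sum]
  congr 1
  ext
  simp only [AddSubmonoidClass.coe_finsetSum]
  exact Finset.sum_coe_sort (Finset.HasAntidiagonal.antidiagonal n)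
    (fun p => ⁅(x : LieSeq L) p.1, (y : LieSeq L) p.2⁆)

instance : LieRing 𝓕.GrHat where
  add_lie x y z := by
    obtain ⟨x, rfl⟩ := 𝓕.seriesCls_surjective x
    obtain ⟨y, rfl⟩ := 𝓕.seriesCls_surjective y
    obtain ⟨z, rfl⟩ := 𝓕.seriesCls_surjective z
    simp only [seriesCls_lie, ← map_add, add_lie]
  lie_add x y z := by
    obtain ⟨x, rfl⟩ := 𝓕.seriesCls_surjective x
    obtain ⟨y, rfl⟩ := 𝓕.seriesCls_surjective y
    obtain ⟨z, rfl⟩ := 𝓕.seriesCls_surjective z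
    simp only [seriesCls_lie, ← map_add, lie_add]
  lie_self x := by
    obtain ⟨x, rfl⟩ := 𝓕.seriesCls_surjective x
    simp only [seriesCls_lie, lie_self, map_zero]
  leibniz_lie x y z := by
    obtain ⟨x, rfl⟩ := 𝓕.seriesCls_surjective x
    obtain ⟨y, rfl⟩ := 𝓕.seriesCls_surjective y
    obtain ⟨z, rfl⟩ := 𝓕.seriesCls_surjective z
    simp only [seriesCls_lie, ← map_add, ← leibniz_lie]

instance : LieAlgebra K 𝓕.GrHat where
  lie_smul c x y := by
    obtain ⟨x, rfl⟩ := 𝓕.seriesCls_surjective x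
    obtain ⟨y, rfl⟩ := 𝓕.seriesCls_surjective y
    simp only [seriesCls_lie, ← map_smul, lie_smul]

/-- The filtration by the degree: `∏_{k ≥ m} gr_k`. -/
def grHatFiltration (m : ℕ) : Submodule K 𝓕.GrHat where
  carrier := {x | ∀ k < m, x k = 0}
  add_mem' {x y} hx hy k hk := by
    change x k + y k = 0
    rw [hx k hk, hy k hk, add_zero]
  zero_mem' _ _ := rfl
  smul_mem' c x hx k hk := by
    change c • x k = 0
    rw [hx k hk, smul_zero]

/-- The inclusion of `gr_k` as the component of degree `k`. -/
def grHatSingle (k : ℕ) (x : 𝓕.Gr k) : 𝓕.GrHat := Pi.single k x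

end LieFiltration

end Filtered

/-! ### Completion of a bialgebra for the powers of its augmentation ideal -/

section Completion

variable (K : Type*) [CommRing K]

/-- The augmentation ideal of a bialgebra. -/
def augIdeal (A : Type*) [Ring A] [Bialgebra K A] : Ideal A :=
  RingHom.ker (Bialgebra.counitAlgHom K A)

instance (A : Type*) [Ring A] [Bialgebra K A] : (augIdeal K A).IsTwoSided :=
  inferInstanceAs (RingHom.ker (Bialgebra.counitAlgHom K A)).IsTwoSided

variable {K} in
theorem mem_augIdeal {A : Type*} [Ring A] [Bialgebra K A] {a : A} :
    a ∈ augIdeal K A ↔ Bialgebra.counitAlgHom K A a = 0 := Iff.rfl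

/-- The quotient `A / I^k` by a power of the augmentation ideal. -/
abbrev AugQuot (A : Type*) [Ring A] [Bialgebra K A] (k : ℕ) : Type _ := A ⧸ augIdeal K A ^ k

/-- The projection `A / I^(k+1) → A / I^k`. -/
def augTrans (A : Type*) [Ring A] [Bialgebra K A] (k : ℕ) :
    AugQuot K A (k + 1) →ₐ[K] AugQuot K A k :=
  Ideal.Quotient.factorₐ K (Ideal.pow_le_pow_right k.le_succ)

/-- The completion `lim_k A / I^k` for the powers of the augmentation ideal. -/
def Completed (A : Type*) [Ring A] [Bialgebra K A] : Subalgebra K (∀ k, AugQuot K A k) where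
  carrier := {x | ∀ k, augTrans K A k (x (k + 1)) = x k}
  mul_mem' {x y} hx hy k := by
    rw [Pi.mul_apply, Pi.mul_apply, map_mul, hx k, hy k]
  add_mem' {x y} hx hy k := by
    rw [Pi.add_apply, Pi.add_apply, map_add, hx k, hy k]
  algebraMap_mem' c k := by
    rw [Pi.algebraMap_apply, Pi.algebraMap_apply, AlgHom.commutes]

variable {K}

/-- A morphism of augmented algebras maps `I^k` into `I^k`. -/
theorem map_augIdeal_pow {A B : Type*} [Ring A] [Bialgebra K A] [Ring B] [Bialgebra K B]
    (f : A →ₐ[K] B)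
    (hf : (Bialgebra.counitAlgHom K B).comp f = Bialgebra.counitAlgHom K A) (k : ℕ) :
    augIdeal K A ^ k ≤ (augIdeal K B ^ k).comap f := by
  have h1 : augIdeal K A ≤ (augIdeal K B).comap f := fun a ha => by
    rw [Ideal.mem_comap, mem_augIdeal, ← AlgHom.comp_apply, hf]
    exact ha
  induction k with
  | zero => simp [Submodule.pow_zero, Ideal.one_eq_top]
  | succ k ih =>
    rw [Submodule.pow_succ, Submodule.pow_succ]
    refine Ideal.mul_le.mpr fun a ha b hb => ?_
    rw [Ideal.mem_comap, map_mul]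
    exact Ideal.mul_mem_mul (ih ha) (h1 hb)

theorem Completed.eq_mk {A : Type*} [Ring A] [Bialgebra K A] (x : Completed K A) {k m : ℕ}
    (h : k ≤ m) (a : A) (ha : Ideal.Quotient.mk (augIdeal K A ^ m) a = x.1 m) :
    Ideal.Quotient.mk (augIdeal K A ^ k) a = x.1 k := by
  induction m, h using Nat.le_induction with
  | base => exact ha
  | succ m h ih =>
    refine ih ?_
    rw [← x.2 m, ← ha]
    rfl

/-- The map `A / I^k → B / I^k` induced by a morphism of augmented algebras. -/
def augQuotMap {A B : Type*} [Ring A] [Bialgebra K A] [Ring B] [Bialgebra K B] (f : A →ₐ[K] B)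
    (hf : (Bialgebra.counitAlgHom K B).comp f = Bialgebra.counitAlgHom K A) (k : ℕ) :
    AugQuot K A k →ₐ[K] AugQuot K B k :=
  Ideal.quotientMapₐ _ f (map_augIdeal_pow f hf k)

/-- The map induced on completions by a morphism of augmented algebras. -/
def Completed.map {A B : Type*} [Ring A] [Bialgebra K A] [Ring B] [Bialgebra K B] (f : A →ₐ[K] B)
    (hf : (Bialgebra.counitAlgHom K B).comp f = Bialgebra.counitAlgHom K A) :
    Completed K A →ₐ[K] Completed K B :=
  AlgHom.codRestrict
    (AlgHom.pi fun k => (augQuotMap f hf k).comp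
      ((Pi.evalAlgHom K (AugQuot K A) k).comp (Completed K A).val))
    (Completed K B) (fun x k => by
      have hx := x.2 k
      obtain ⟨a, ha⟩ := Ideal.Quotient.mk_surjective ((x : ∀ k, AugQuot K A k) (k + 1))
      change augTrans K B k (augQuotMap f hf (k + 1) ((x : ∀ k, AugQuot K A k) (k + 1))) =
        augQuotMap f hf k ((x : ∀ k, AugQuot K A k) k)
      rw [← hx, ← ha]
      rfl)

variable (K)

section Coproduct

variable (A : Type*) [Ring A] [Bialgebra K A]

theorem counit_comp_comul : (Bialgebra.counitAlgHom K (A ⊗[K] A)).comp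
    (Bialgebra.comulAlgHom K A) = Bialgebra.counitAlgHom K A := by
  ext a
  have h1 := congrArg (Bialgebra.counitAlgHom K A)
    (Coalgebra.sum_counit_smul (Coalgebra.Repr.arbitrary K a))
  have h2 := congrArg (Bialgebra.counitAlgHom K (A ⊗[K] A)) (Coalgebra.Repr.arbitrary K a).eq
  simp only [map_sum, map_smul, Bialgebra.counitAlgHom_apply, TensorProduct.counit_tmul] at h1 h2
  rw [AlgHom.comp_apply, Bialgebra.comulAlgHom_apply, Bialgebra.counitAlgHom_apply,
    Bialgebra.counitAlgHom_apply, ← h2, ← h1]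
  exact Finset.sum_congr rfl fun i _ => by simp [mul_comm]

theorem counit_comp_left : (Bialgebra.counitAlgHom K (A ⊗[K] A)).comp
    Algebra.TensorProduct.includeLeft = Bialgebra.counitAlgHom K A := by
  ext a
  simp

theorem counit_comp_right : (Bialgebra.counitAlgHom K (A ⊗[K] A)).comp
    Algebra.TensorProduct.includeRight = Bialgebra.counitAlgHom K A := by
  ext a
  simp

/-- The coproduct of the completion of `A`, with values in the completed tensor square:
the latter is the completion of `A ⊗ A` for the powers of the ideal `I ⊗ A + A ⊗ I`. -/
def completedComul : Completed K A →ₐ[K] Completed K (A ⊗[K] A) :=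
  Completed.map (Bialgebra.comulAlgHom K A) (counit_comp_comul K A)

/-- `x ↦ x ⊗ 1` -/
def completedLeft : Completed K A →ₐ[K] Completed K (A ⊗[K] A) :=
  Completed.map Algebra.TensorProduct.includeLeft (counit_comp_left K A)

/-- `x ↦ 1 ⊗ x` -/
def completedRight : Completed K A →ₐ[K] Completed K (A ⊗[K] A) :=
  Completed.map Algebra.TensorProduct.includeRight (counit_comp_right K A)

end Coproduct

end Completion

/-! ### Logarithms -/

section Log

open Polynomial in
/-- `∑_{m<k} log^m / m!` agrees with `1 + X` up to order `k`, with `log` truncated at order `k`. -/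
theorem exp_log_poly (n : ℕ) (L : ℚ[X])
    (hL : L = ∑ i ∈ Finset.range n, C ((-1) ^ i / (i + 1) : ℚ) * X ^ (i + 1)) :
    X ^ (n + 1) ∣ (∑ i ∈ Finset.range (n + 1), C ((i.factorial : ℚ)⁻¹) * L ^ i) - (1 + X) := by
  have hL' : (1 + X) * derivative L = 1 - (-X) ^ n := by
    have : derivative L = ∑ i ∈ Finset.range n, (-X : ℚ[X]) ^ i := by
      rw [hL, derivative_sum]
      refine Finset.sum_congr rfl fun i _ => ?_
      rw [derivative_C_mul_X_pow]
      have h0 : ((i : ℚ) + 1) ≠ 0 := by positivity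
      simp only [Nat.cast_add, Nat.cast_one, Nat.add_sub_cancel]
      rw [div_mul_cancel₀ _ h0, neg_pow (X : ℚ[X]) i]
      simp
    rw [this, ← mul_neg_geom_sum, sub_neg_eq_add]
  have hXL : X ∣ L := by
    rw [hL]
    exact Finset.dvd_sum fun i _ => ⟨C ((-1) ^ i / (i + 1) : ℚ) * X ^ i, by ring⟩
  set S : ℚ[X] := ∑ i ∈ Finset.range n, C ((i.factorial : ℚ)⁻¹) * L ^ i with hS
  set E : ℚ[X] := ∑ i ∈ Finset.range (n + 1), C ((i.factorial : ℚ)⁻¹) * L ^ i with hE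
  have hES : E = S + C ((n.factorial : ℚ)⁻¹) * L ^ n := Finset.sum_range_succ _ _
  have hE' : derivative E = S * derivative L := by
    rw [hE, Finset.sum_range_succ', derivative_add, derivative_sum]
    simp only [pow_zero, mul_one, derivative_C, add_zero]
    rw [hS, Finset.sum_mul]
    refine Finset.sum_congr rfl fun i _ => ?_
    rw [derivative_C_mul, derivative_pow_succ]
    have h0 : (((i + 1).factorial : ℚ))⁻¹ * ((i : ℚ) + 1) = ((i.factorial : ℚ))⁻¹ := by
      rw [Nat.factorial_succ]
      have h1 : ((i : ℚ) + 1) ≠ 0 := by positivity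
      have h2 : (i.factorial : ℚ) ≠ 0 := by positivity
      push_cast
      field_simp
    rw [← h0, C_mul]
    simp only [map_add, map_natCast, map_one]
    ring
  have key : X ^ n ∣ (1 + X) * derivative (E - (1 + X)) - (E - (1 + X)) := by
    have : (1 + X) * derivative (E - (1 + X)) - (E - (1 + X)) =
        -((-X) ^ n * S) - C ((n.factorial : ℚ)⁻¹) * L ^ n := by
      have h : (1 + X) * derivative E = (1 - (-X) ^ n) * S := by
        rw [hE', ← hL']; ring
      rw [derivative_sub, mul_sub, h, hES]
      simp only [derivative_add, derivative_one, derivative_X]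
      ring
    rw [this]
    refine dvd_sub ?_ ?_
    · rw [dvd_neg]
      refine Dvd.dvd.mul_right ?_ _
      rw [neg_pow]
      exact Dvd.intro_left _ rfl
    · exact Dvd.dvd.mul_left (pow_dvd_pow_of_dvd hXL n) _
  set F : ℚ[X] := E - (1 + X) with hF
  rw [X_pow_dvd_iff] at key ⊢
  have hF0 : F.coeff 0 = 0 := by
    have hL0 : L.coeff 0 = 0 := by
      obtain ⟨q, rfl⟩ := hXL
      simp
    rw [hF, hE, Finset.sum_range_succ']
    simp [finsetSum_coeff, pow_succ, mul_coeff_zero, hL0]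
  intro d
  induction d with
  | zero => intro _; exact hF0
  | succ j ih =>
    intro hj
    have hk := key j (by omega)
    have hFj := ih (by omega)
    have e : ((1 + X) * derivative F - F).coeff j = F.coeff (j + 1) * (j + 1) := by
      rw [add_mul, one_mul, coeff_sub, coeff_add, coeff_derivative, hFj]
      cases j with
      | zero => simp
      | succ j =>
        rw [coeff_X_mul, coeff_derivative, hFj]
        simp
    rw [e] at hk
    have h1 : ((j : ℚ) + 1) ≠ 0 := by positivity
    exact (mul_eq_zero.mp hk).resolve_right h1

/-- The logarithmic series `∑_{1 ≤ m < k} (-1)^(m+1) u^m / m`, truncated at order `k`. -/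
def logTrunc (K : Type*) [Field K] {R : Type*} [Ring R] [Algebra K R] (k : ℕ) (u : R) : R :=
  ∑ m ∈ Finset.Ico 1 k, ((-1) ^ (m + 1) / m : K) • u ^ m

section Rat

variable {R : Type*} [Ring R] [Algebra ℚ R]

theorem logTrunc_eq_mul (k : ℕ) (u : R) : ∃ v, Commute u v ∧ logTrunc ℚ k u = u * v := by
  refine ⟨∑ m ∈ Finset.Ico 1 k, ((-1) ^ (m + 1) / m : ℚ) • u ^ (m - 1), ?_, ?_⟩
  · exact Commute.sum_right _ _ _ fun m _ => (Commute.pow_right (Commute.refl u) _).smul_right _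
  · rw [logTrunc, Finset.mul_sum]
    refine Finset.sum_congr rfl fun m hm => ?_
    rw [mul_smul_comm, ← pow_succ', Nat.sub_add_cancel (Finset.mem_Ico.mp hm).1]

theorem logTrunc_pow_eq_zero {k : ℕ} {u : R} (hu : u ^ k = 0) : (logTrunc ℚ k u) ^ k = 0 := by
  obtain ⟨v, hv, h⟩ := logTrunc_eq_mul k u
  rw [h, hv.mul_pow, hu, zero_mul]

theorem commute_logTrunc {k : ℕ} {u v : R} (h : Commute u v) (l : ℕ) :
    Commute (logTrunc ℚ k u) (logTrunc ℚ l v) :=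
  Commute.sum_left _ _ _ fun _ _ => Commute.sum_right _ _ _ fun _ _ =>
    ((h.pow_pow _ _).smul_left _).smul_right _

theorem exp_logTrunc {k : ℕ} {u : R} (hu : u ^ k = 0) :
    IsNilpotent.exp (logTrunc ℚ k u) = 1 + u := by
  cases k with
  | zero =>
    have : Subsingleton R := subsingleton_of_zero_eq_one (by simpa using hu.symm)
    exact Subsingleton.elim _ _
  | succ n =>
    rw [IsNilpotent.exp_eq_sum (logTrunc_pow_eq_zero hu)]
    obtain ⟨q, hq⟩ := exp_log_poly n _ rfl
    have hq' := congrArg (Polynomial.aeval u) hq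
    simp only [map_sub, map_sum, map_mul, map_pow, Polynomial.aeval_C, Polynomial.aeval_X,
      map_add, map_one, hu, zero_mul, sub_eq_zero, ← Algebra.smul_def] at hq'
    rw [← hq', logTrunc, Finset.sum_Ico_eq_sum_range]
    refine Finset.sum_congr rfl fun i _ => ?_
    congr 2
    refine Finset.sum_congr (by simp) fun j _ => ?_
    rw [add_comm 1 j, add_assoc, pow_add]
    push_cast
    norm_num

theorem eq_zero_of_exp_eq_one {d : R} (hd : IsNilpotent d) (h : IsNilpotent.exp d = 1) :
    d = 0 := by
  by_contra hne
  have : Nontrivial R := ⟨d, 0, hne⟩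
  obtain ⟨m, hm⟩ : ∃ m, nilpotencyClass d = m + 2 := by
    have h0 : nilpotencyClass d ≠ 0 := fun h0 => by
      have := pow_nilpotencyClass hd
      rw [h0, pow_zero] at this
      exact one_ne_zero this
    have h1 : nilpotencyClass d ≠ 1 := fun h1 => by
      have := pow_nilpotencyClass hd
      rw [h1, pow_one] at this
      exact hne this
    exact ⟨nilpotencyClass d - 2, by omega⟩
  have hz : d ^ (m + 2) = 0 := hm ▸ pow_nilpotencyClass hd
  have hnz : d ^ (m + 1) ≠ 0 := pow_pred_nilpotencyClass hd |> fun h => by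
    rwa [hm] at h
  rw [IsNilpotent.exp_eq_sum hz, Finset.sum_range_succ', Finset.sum_range_succ'] at h
  have h' := congrArg (fun x => d ^ m * x) h
  simp only [mul_add, Finset.mul_sum, mul_smul_comm, ← pow_add] at h'
  rw [Finset.sum_eq_zero (fun i _ => by
    rw [show m + (i + 1 + 1) = (m + 2) + i by omega, pow_add, hz, zero_mul, smul_zero])] at h'
  simp at h'
  exact hnz h'

theorem logTrunc_mul_rat {a b : R} {k : ℕ} (hc : Commute a b) (ha : (a - 1) ^ k = 0)
    (hb : (b - 1) ^ k = 0) (hab : (a * b - 1) ^ k = 0) :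
    logTrunc ℚ k (a * b - 1) = logTrunc ℚ k (a - 1) + logTrunc ℚ k (b - 1) := by
  have c1 : Commute (a - 1) (b - 1) :=
    (hc.sub_left (Commute.one_left b)).sub_right (Commute.one_right _)
  have ca : Commute (a * b - 1) (a - 1) :=
    (((Commute.refl a).mul_left hc.symm).sub_left (Commute.one_left a)).sub_right
      (Commute.one_right _)
  have cb : Commute (a * b - 1) (b - 1) :=
    ((hc.mul_left (Commute.refl b)).sub_left (Commute.one_left b)).sub_right
      (Commute.one_right _)
  have n1 : IsNilpotent (logTrunc ℚ k (a - 1)) := ⟨k, logTrunc_pow_eq_zero ha⟩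
  have n2 : IsNilpotent (logTrunc ℚ k (b - 1)) := ⟨k, logTrunc_pow_eq_zero hb⟩
  have n3 : IsNilpotent (logTrunc ℚ k (a * b - 1)) := ⟨k, logTrunc_pow_eq_zero hab⟩
  have c12 := commute_logTrunc (k := k) c1 k
  have n12 := c12.isNilpotent_add n1 n2
  have c3 : Commute (logTrunc ℚ k (a * b - 1)) (logTrunc ℚ k (a - 1) + logTrunc ℚ k (b - 1)) :=
    (commute_logTrunc ca k).add_right (commute_logTrunc cb k)
  rw [← sub_eq_zero]
  refine eq_zero_of_exp_eq_one (c3.isNilpotent_sub n3 n12) ?_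
  have e : IsNilpotent.exp (logTrunc ℚ k (a * b - 1)) =
      IsNilpotent.exp (logTrunc ℚ k (a - 1) + logTrunc ℚ k (b - 1)) := by
    rw [IsNilpotent.exp_add_of_commute c12 n1 n2, exp_logTrunc ha, exp_logTrunc hb,
      exp_logTrunc hab]
    simp
  rw [sub_eq_add_neg, IsNilpotent.exp_add_of_commute c3.neg_right n3 n12.neg, e,
    IsNilpotent.exp_mul_exp_neg_self n12]

end Rat

/-- `log(ab) = log a + log b` for commuting `a` and `b`. -/
theorem logTrunc_mul {K R : Type*} [Field K] [CharZero K] [Ring R] [Algebra K R] {a b : R} {k : ℕ}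
    (hc : Commute a b) (ha : (a - 1) ^ k = 0) (hb : (b - 1) ^ k = 0) (hab : (a * b - 1) ^ k = 0) :
    logTrunc K k (a * b - 1) = logTrunc K k (a - 1) + logTrunc K k (b - 1) := by
  let _ : Algebra ℚ R := Algebra.compHom R (algebraMap ℚ K)
  have h : ∀ u : R, logTrunc K k u = logTrunc ℚ k u := fun u => by
    refine Finset.sum_congr rfl fun m _ => ?_
    change _ = (algebraMap ℚ K ((-1) ^ (m + 1) / m)) • u ^ m
    congr 1
    simp
  rw [h, h, h, logTrunc_mul_rat hc ha hb hab]

theorem map_logTrunc {K R S : Type*} [Field K] [Ring R] [Algebra K R] [Ring S] [Algebra K S]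
    (f : R →ₐ[K] S) (k : ℕ) (u : R) : f (logTrunc K k u) = logTrunc K k (f u) := by
  simp [logTrunc]


end Log

/-! ### The Malcev Lie algebra of a group -/

section Malcev

attribute [local instance] LieRing.ofAssociativeRing LieAlgebra.ofAssociativeAlgebra

variable (K : Type*) [Field K]

theorem completedLeft_commute_right (A : Type*) [Ring A] [Bialgebra K A] (x y : Completed K A) :
    Commute (completedLeft K A x) (completedRight K A y) := by
  apply Subtype.ext
  funext k
  obtain ⟨a, ha⟩ := Ideal.Quotient.mk_surjective ((x : ∀ k, AugQuot K A k) k)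
  obtain ⟨b, hb⟩ := Ideal.Quotient.mk_surjective ((y : ∀ k, AugQuot K A k) k)
  change augQuotMap _ (counit_comp_left K A) k ((x : ∀ k, AugQuot K A k) k) *
      augQuotMap _ (counit_comp_right K A) k ((y : ∀ k, AugQuot K A k) k) =
    augQuotMap _ (counit_comp_right K A) k ((y : ∀ k, AugQuot K A k) k) *
      augQuotMap _ (counit_comp_left K A) k ((x : ∀ k, AugQuot K A k) k)
  rw [← ha, ← hb]
  change Ideal.Quotient.mk _ ((a ⊗ₜ[K] (1 : A)) * ((1 : A) ⊗ₜ[K] b)) =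
    Ideal.Quotient.mk _ (((1 : A) ⊗ₜ[K] b) * (a ⊗ₜ[K] (1 : A)))
  simp

/-- The Lie algebra of primitive elements, `Δ x = x ⊗ 1 + 1 ⊗ x`, of the completion of `A`. -/
def primitives (A : Type*) [Ring A] [Bialgebra K A] : LieSubalgebra K (Completed K A) where
  carrier := {x | completedComul K A x = completedLeft K A x + completedRight K A x}
  add_mem' {x y} hx hy := by
    change completedComul K A (x + y) = completedLeft K A (x + y) + completedRight K A (x + y)
    rw [map_add, map_add, map_add, hx, hy]
    abel
  zero_mem' := by
    change completedComul K A 0 = completedLeft K A 0 + completedRight K A 0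
    simp
  smul_mem' c x hx := by
    change completedComul K A (c • x) = completedLeft K A (c • x) + completedRight K A (c • x)
    rw [map_smul, map_smul, map_smul, hx, smul_add]
  lie_mem' {x y} hx hy := by
    change completedComul K A ⁅x, y⁆ = completedLeft K A ⁅x, y⁆ + completedRight K A ⁅x, y⁆
    simp only [LieRing.of_associative_ring_bracket, map_sub, map_mul]
    rw [show completedComul K A x = _ from hx, show completedComul K A y = _ from hy]
    have h1 := (completedLeft_commute_right K A x y).eq
    have h2 := (completedLeft_commute_right K A y x).eq
    simp only [add_mul, mul_add, h1, h2]
    abel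

/-- The filtration `F_k = ker(lim_m A / I^m → A / I^k)`, restricted to the primitive elements. -/
def primitivesFiltration (A : Type*) [Ring A] [Bialgebra K A] :
    LieFiltration K (primitives K A) where
  F k :=
    { carrier := {x | (x : Completed K A).1 k = 0}
      add_mem' := fun {x y} hx hy => by
        change (x : Completed K A).1 k + (y : Completed K A).1 k = 0
        rw [show (x : Completed K A).1 k = 0 from hx, show (y : Completed K A).1 k = 0 from hy,
          add_zero]
      zero_mem' := rfl
      smul_mem' := fun c x hx => by
        change c • (x : Completed K A).1 k = 0
        rw [show (x : Completed K A).1 k = 0 from hx, smul_zero] }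
  succ_le k x hx := by
    change (x : Completed K A).1 k = 0
    rw [← (x : Completed K A).2 k, show (x : Completed K A).1 (k + 1) = 0 from hx, map_zero]
  lie_mem {k l x y} hx hy := by
    obtain ⟨a, ha⟩ := Ideal.Quotient.mk_surjective ((x : Completed K A).1 (k + l))
    obtain ⟨b, hb⟩ := Ideal.Quotient.mk_surjective ((y : Completed K A).1 (k + l))
    have ha' : a ∈ augIdeal K A ^ k := by
      rw [← Ideal.Quotient.eq_zero_iff_mem,
        Completed.eq_mk (x : Completed K A) (Nat.le_add_right k l) a ha]
      exact hx
    have hb' : b ∈ augIdeal K A ^ l := by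
      rw [← Ideal.Quotient.eq_zero_iff_mem,
        Completed.eq_mk (y : Completed K A) (Nat.le_add_left l k) b hb]
      exact hy
    change (x : Completed K A).1 (k + l) * (y : Completed K A).1 (k + l) -
      (y : Completed K A).1 (k + l) * (x : Completed K A).1 (k + l) = 0
    rw [← ha, ← hb, ← map_mul, ← map_mul, ← map_sub, Ideal.Quotient.eq_zero_iff_mem]
    refine sub_mem ?_ ?_
    · rw [Ideal.IsTwoSided.pow_add]
      exact Ideal.mul_mem_mul ha' hb'
    · rw [add_comm, Ideal.IsTwoSided.pow_add]
      exact Ideal.mul_mem_mul hb' ha'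

/-- `F_1` is everything: a primitive element has augmentation zero. -/
theorem primitivesFiltration_one (A : Type*) [Ring A] [Bialgebra K A] :
    (primitivesFiltration K A).F 1 = ⊤ := by
  refine eq_top_iff.mpr fun x _ => ?_
  change (x : Completed K A).1 1 = 0
  have hx : completedComul K A x = completedLeft K A x + completedRight K A x := x.2
  obtain ⟨a, ha⟩ := Ideal.Quotient.mk_surjective ((x : Completed K A).1 1)
  have h := congrArg (fun y : Completed K (A ⊗[K] A) => y.1 1) hx
  change augQuotMap _ (counit_comp_comul K A) 1 ((x : Completed K A).1 1) =
    augQuotMap _ (counit_comp_left K A) 1 ((x : Completed K A).1 1) +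
      augQuotMap _ (counit_comp_right K A) 1 ((x : Completed K A).1 1) at h
  rw [← ha] at h
  change Ideal.Quotient.mk _ (Bialgebra.comulAlgHom K A a) =
    Ideal.Quotient.mk _ (a ⊗ₜ[K] (1 : A)) + Ideal.Quotient.mk _ ((1 : A) ⊗ₜ[K] a) at h
  rw [← map_add, Ideal.Quotient.mk_eq_mk_iff_sub_mem, Submodule.pow_one, mem_augIdeal, map_sub,
    map_add, ← AlgHom.comp_apply, counit_comp_comul] at h
  rw [← ha, Ideal.Quotient.eq_zero_iff_mem, Submodule.pow_one, mem_augIdeal]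
  simpa using h

variable (Γ : Type*) [Group Γ]

/-- The Malcev Lie algebra `Lie(Γ(K))`: the primitive elements of the completed group algebra. -/
abbrev MalcevLie : LieSubalgebra K (Completed K (MonoidAlgebra K Γ)) :=
  primitives K (MonoidAlgebra K Γ)

/-- The filtration of the Malcev Lie algebra. -/
abbrev malcevFiltration : LieFiltration K (MalcevLie K Γ) :=
  primitivesFiltration K (MonoidAlgebra K Γ)

variable {Γ}

theorem single_sub_one_mem (γ : Γ) :
    (MonoidAlgebra.single γ 1 - 1 : MonoidAlgebra K Γ) ∈ augIdeal K (MonoidAlgebra K Γ) := by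
  rw [mem_augIdeal]
  simp

/-- The element `log γ = ∑_{m ≥ 1} (-1)^(m+1) (γ - 1)^m / m` of the completed group algebra:
its image in `K[Γ] / I^k` is the sum of the terms with `m < k`. -/
def completedLog (γ : Γ) : Completed K (MonoidAlgebra K Γ) :=
  ⟨fun k => Ideal.Quotient.mkₐ K _
      (logTrunc K k (MonoidAlgebra.single γ 1 - 1 : MonoidAlgebra K Γ)), fun k => by
    change Ideal.Quotient.mk (augIdeal K (MonoidAlgebra K Γ) ^ k) _ =
      Ideal.Quotient.mk (augIdeal K (MonoidAlgebra K Γ) ^ k) _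
    rw [Ideal.Quotient.mk_eq_mk_iff_sub_mem]
    cases k with
    | zero => simp [Submodule.pow_zero, Ideal.one_eq_top]
    | succ k =>
      rw [logTrunc, Finset.sum_Ico_succ_top (by omega), logTrunc, add_sub_cancel_left,
        Algebra.smul_def]
      exact Ideal.mul_mem_left _ _ (Ideal.pow_mem_pow (single_sub_one_mem K γ) _)⟩

variable [CharZero K]

theorem comul_logTrunc (A : Type*) [Ring A] [Bialgebra K A] {s : A} (hs1 : s - 1 ∈ augIdeal K A)
    (hs2 : Coalgebra.comul (R := K) s = s ⊗ₜ[K] s) (k : ℕ) :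
    Ideal.Quotient.mkₐ K (augIdeal K (A ⊗[K] A) ^ k)
        (Bialgebra.comulAlgHom K A (logTrunc K k (s - 1))) =
      Ideal.Quotient.mkₐ K (augIdeal K (A ⊗[K] A) ^ k)
          ((Algebra.TensorProduct.includeLeft : A →ₐ[K] A ⊗[K] A) (logTrunc K k (s - 1))) +
        Ideal.Quotient.mkₐ K (augIdeal K (A ⊗[K] A) ^ k)
          ((Algebra.TensorProduct.includeRight : A →ₐ[K] A ⊗[K] A) (logTrunc K k (s - 1))) := by
  have hz : ∀ f : A →ₐ[K] A ⊗[K] A,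
      (Bialgebra.counitAlgHom K (A ⊗[K] A)).comp f = Bialgebra.counitAlgHom K A →
      (Ideal.Quotient.mkₐ K ((augIdeal K (A ⊗[K] A)) ^ k) (f s) - 1) ^ k = 0 := fun f hf => by
    rw [← map_one (Ideal.Quotient.mkₐ K ((augIdeal K (A ⊗[K] A)) ^ k)), ← map_one f, ← map_sub, ← map_sub, ← map_pow,
      ← map_pow]
    exact Ideal.Quotient.eq_zero_iff_mem.mpr
      (map_augIdeal_pow f hf k (Ideal.pow_mem_pow hs1 k))
  have hd : Bialgebra.comulAlgHom K A s =
      (Algebra.TensorProduct.includeLeft : A →ₐ[K] A ⊗[K] A) s *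
        (Algebra.TensorProduct.includeRight : A →ₐ[K] A ⊗[K] A) s := by
    simp [hs2]
  have h1 := hz _ (counit_comp_left K A)
  have h2 := hz _ (counit_comp_right K A)
  have h3 := hz _ (counit_comp_comul K A)
  simp only [map_logTrunc, map_sub, map_one]
  rw [hd, map_mul] at h3 ⊢
  refine logTrunc_mul ?_ h1 h2 h3
  refine Commute.map ?_ _
  change _ * _ = _ * _
  simp

theorem completedLog_mem (γ : Γ) : completedLog K γ ∈ MalcevLie K Γ :=
  Subtype.ext <| funext fun k => comul_logTrunc K (MonoidAlgebra K Γ) (single_sub_one_mem K γ)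
    (by rw [MonoidAlgebra.comul_single]; simp) k

/-- `log γ`, as an element of the Malcev Lie algebra. -/
def malcevLog (γ : Γ) : MalcevLie K Γ := ⟨completedLog K γ, completedLog_mem K γ⟩

/-- The class `[log γ]_1`, in degree `1` of the completed associated graded Lie algebra of
the Malcev Lie algebra. -/
def logClass (γ : Γ) : (malcevFiltration K Γ).GrHat :=
  (malcevFiltration K Γ).grHatSingle 1
    ((malcevFiltration K Γ).cls 1 ⟨malcevLog K γ, by
      rw [primitivesFiltration_one]; trivial⟩)

end Malcev

/-! ### Finite groups acting on the projective line and orbit configuration spaces -/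

section Geometry

open Complex Set Topology

/-- The subgroup `SU₂` of `GL₂(ℂ)`. -/
def SU2 : Subgroup (GL (Fin 2) ℂ) where
  carrier := {A | (A : Matrix (Fin 2) (Fin 2) ℂ) ∈ Matrix.specialUnitaryGroup (Fin 2) ℂ}
  mul_mem' {A B} hA hB := by
    rw [Set.mem_ofPred_eq, Units.val_mul]
    exact mul_mem hA hB
  one_mem' := by
    rw [Set.mem_ofPred_eq, Units.val_one]
    exact one_mem _
  inv_mem' {A} hA := by
    have h : star (A : Matrix (Fin 2) (Fin 2) ℂ) ∈ Matrix.specialUnitaryGroup (Fin 2) ℂ :=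
      (star (⟨A, hA⟩ : Matrix.specialUnitaryGroup (Fin 2) ℂ)).2
    have h2 : ((A⁻¹ : GL (Fin 2) ℂ) : Matrix (Fin 2) (Fin 2) ℂ) = star (A : Matrix _ _ ℂ) :=
      Units.inv_eq_of_mul_eq_one_right
        (Matrix.mem_unitaryGroup_iff.mp (Matrix.mem_specialUnitaryGroup_iff.mp hA).1)
    rw [Set.mem_ofPred_eq, h2]
    exact h

/-- The group `PSU₂(ℂ)`, as a group of transformations of the projective line `ℂ ∪ {∞}`:
the homographies given by the matrices in `SU₂`. -/
def PSU2 : Subgroup (Equiv.Perm (OnePoint ℂ)) :=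
  SU2.map (MulAction.toPermHom (GL (Fin 2) ℂ) (OnePoint ℂ))

variable (G : Subgroup (Equiv.Perm (OnePoint ℂ)))

/-- The points of the projective line with a nontrivial stabilizer in `G`. -/
def exceptional : Set (OnePoint ℂ) := {p | MulAction.stabilizer G p ≠ ⊥}

variable {G} in
theorem smul_mem_exceptional (g : G) {p : OnePoint ℂ} (hp : p ∈ exceptional G) :
    g • p ∈ exceptional G := by
  intro h
  apply hp
  rw [eq_bot_iff]
  intro k hk
  have : g * k * g⁻¹ ∈ MulAction.stabilizer G (g • p) := by
    rw [MulAction.mem_stabilizer_iff, mul_smul, mul_smul, inv_smul_smul,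
      MulAction.mem_stabilizer_iff.mp hk]
  rw [h, Subgroup.mem_bot] at this
  rw [Subgroup.mem_bot]
  simpa using this

/-- The orbit configuration space: `n`-tuples of points of the projective line with trivial
stabilizers, no two of which are in the same orbit. -/
def orbitConfig (n : ℕ) : Set (Fin n → OnePoint ℂ) :=
  {z | (∀ i, z i ∉ exceptional G) ∧ ∀ i j, i ≠ j → ∀ g : G, z i ≠ g • z j}

/-- The holomorphic coordinate centered at `p` of the projective line: `z ↦ z - a` if `p = a` is
finite, and `z ↦ 1 / z` if `p = ∞`. (The value of `z ↦ z - a` at `∞` and that of `z ↦ 1 / z`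
at `0` are set to `0`; they play no role.) -/
def localCoord (p z : OnePoint ℂ) : ℂ :=
  p.elim (z.elim 0 fun b => b⁻¹) fun a => z.elim 0 fun b => b - a

/-- A map `f` from a neighbourhood of `w` in `ℂ` to the projective line, injective and continuous,
preserves the orientation at `w`: the image of a small circle around `w` turns once around `f w`,
in the positive sense. -/
def PreservesOrientationAt (f : ℂ → OnePoint ℂ) (w : ℂ) : Prop :=
  ∀ᶠ ε : ℝ in 𝓝[>] (0 : ℝ), ∃ L : ℝ → ℂ, ContinuousOn L (Icc (0 : ℝ) 1) ∧
    (∀ t : ℝ, t ∈ Icc (0 : ℝ) 1 →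
      localCoord (f w) (f (w + (ε : ℂ) * exp (2 * Real.pi * I * (t : ℂ)))) = exp (L t)) ∧
    L 1 = L 0 + 2 * Real.pi * I

variable {G} {n : ℕ}

/-- The points that the `i`-th point of a configuration must avoid when the others stay at `q_j`:
the exceptional points and the orbits of the `q_j`, `j ≠ i`. -/
def punctures (q : orbitConfig G n) (i : Fin n) : Set (OnePoint ℂ) :=
  exceptional G ∪ {p | ∃ j, j ≠ i ∧ ∃ g : G, p = g • q.1 j}

/-- The loop `γ` moves only the `i`-th point `q_i` of the configuration `q`, and moves it once
along the boundary of a closed disc `f(D)`, in the negative (clockwise) sense, where `q_i` is on the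
boundary of this disc, `p` is in its interior, and `p` is the only one of the punctures in the
disc. -/
def IsLoopAround (q : orbitConfig G n) (i : Fin n) (p : OnePoint ℂ) (γ : Path q q) : Prop :=
  ∃ (f : ℂ → OnePoint ℂ) (w : ℂ),
    ContinuousOn f (Metric.closedBall 0 1) ∧ InjOn f (Metric.closedBall 0 1) ∧
    w ∈ Metric.ball (0 : ℂ) 1 ∧ f w = p ∧ PreservesOrientationAt f w ∧
    f '' Metric.closedBall 0 1 ∩ punctures q i = {p} ∧
    f 1 = q.1 i ∧
    ∀ t : unitInterval, (γ t).1 = Function.update q.1 i (f (exp (-(2 * Real.pi * I * (t : ℝ)))))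

/-- The class `x` is represented by a loop as in `IsLoopAround`. -/
def IsClassAround (q : orbitConfig G n) (i : Fin n) (p : OnePoint ℂ)
    (x : FundamentalGroup (orbitConfig G n) q) : Prop :=
  ∃ γ : Path q q, IsLoopAround q i p γ ∧
    x = FundamentalGroup.fromPath (Path.Homotopic.Quotient.mk γ)

end Geometry

/-! ### The Lie algebra `𝔭_n(G)` -/

section OrbitLie

variable (K : Type*) [Field K] (G : Subgroup (Equiv.Perm (OnePoint ℂ))) (n : ℕ)

/-- The generators `X_{ij}(g)` for `i ≠ j`, and `X_i(p)` for `p` an exceptional point. -/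
inductive Gen : Type
  | pair (i j : Fin n) (hij : i ≠ j) (g : G) : Gen
  | point (i : Fin n) (p : exceptional G) : Gen

variable {G n} in
/-- `X_{ij}(g)` in the free Lie algebra. -/
def X {i j : Fin n} (hij : i ≠ j) (g : G) : FreeLieAlgebra K (Gen G n) :=
  FreeLieAlgebra.of K (Gen.pair i j hij g)

variable {G n} in
/-- `X_i(p)` in the free Lie algebra. -/
def Y (i : Fin n) (p : exceptional G) : FreeLieAlgebra K (Gen G n) :=
  FreeLieAlgebra.of K (Gen.point i p)

variable {G} in
/-- The action of `G` on the exceptional points. -/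
def smulExc (g : G) (p : exceptional G) : exceptional G :=
  ⟨g • (p : OnePoint ℂ), smul_mem_exceptional g p.2⟩

/-- The elements of the free Lie algebra that are set to zero in `𝔭_n(G)`. -/
inductive Rel : FreeLieAlgebra K (Gen G n) → Prop
  | symm {i j : Fin n} (hij : i ≠ j) (g : G) : Rel (X K hij g - X K hij.symm g⁻¹)
  | sum (i : Fin n) :
      Rel ((∑ᶠ p : exceptional G, Y K i p) +
        ∑ m : {m : Fin n // m ≠ i}, ∑ᶠ g : G, X K m.2.symm g)
  | four {i j k l : Fin n} (hij : i ≠ j) (hik : i ≠ k) (hil : i ≠ l) (hjk : j ≠ k) (hjl : j ≠ l)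
      (hkl : k ≠ l) (g g' : G) : Rel ⁅X K hij g, X K hkl g'⁆
  | three {i j k : Fin n} (hij : i ≠ j) (hik : i ≠ k) (hjk : j ≠ k) (g g' : G) :
      Rel ⁅X K hij g, X K hjk.symm (g' * g) + X K hik.symm g'⁆
  | threePoint {i j k : Fin n} (hij : i ≠ j) (hik : i ≠ k) (hjk : j ≠ k) (p : exceptional G)
      (g' : G) : Rel ⁅Y K i p, X K hjk g'⁆
  | twoPoint {i j : Fin n} (hij : i ≠ j) (p q : exceptional G)
      (hpq : (q : OnePoint ℂ) ∉ MulAction.orbit G (p : OnePoint ℂ)) : Rel ⁅Y K i p, Y K j q⁆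
  | stab {i j : Fin n} (hij : i ≠ j) (g : G) (p : exceptional G) :
      Rel ⁅X K hij g, Y K j p + Y K i (smulExc g p) +
        ∑ᶠ h : MulAction.stabilizer G (p : OnePoint ℂ), X K hij (g * (h : G))⁆
  | stabPoint {i j : Fin n} (hij : i ≠ j) (g : G) (p : exceptional G) :
      Rel ⁅Y K j p, Y K i (smulExc g p) +
        ∑ᶠ h : MulAction.stabilizer G (p : OnePoint ℂ), X K hij (g * (h : G))⁆

/-- The Lie algebra `𝔭_n(G)(K)` given by generators and relations. -/
abbrev OrbitLie : Type _ :=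
  FreeLieAlgebra K (Gen G n) ⧸
    (LieSubmodule.lieSpan K (FreeLieAlgebra K (Gen G n)) {x | Rel K G n x} :
      LieIdeal K (FreeLieAlgebra K (Gen G n)))

/-- The generators of `𝔭_n(G)(K)`. -/
def orbitLieGen (a : Gen G n) : OrbitLie K G n :=
  LieSubmodule.Quotient.mk (FreeLieAlgebra.of K a)

/-- The completion of `𝔭_n(G)(K)` for the degree, all generators being of degree `1`. -/
abbrev OrbitLieHat : LieSubalgebra K (LieSeq (OrbitLie K G n)) :=
  degreeCompletion K (orbitLieGen K G n)

variable {G n}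

/-- `X_{ij}(g)` in the completion of `𝔭_n(G)(K)`. -/
def hatX {i j : Fin n} (hij : i ≠ j) (g : G) : OrbitLieHat K G n :=
  degreeCompletionGen K (orbitLieGen K G n) (Gen.pair i j hij g)

/-- `X_i(p)` in the completion of `𝔭_n(G)(K)`. -/
def hatY (i : Fin n) (p : exceptional G) : OrbitLieHat K G n :=
  degreeCompletionGen K (orbitLieGen K G n) (Gen.point i p)

end OrbitLie

end

end OrbitConf

/-!
The map `γ ↦ [log γ]_1` is additive on `Γ_n`, since `log γ` is `γ - 1` modulo the square of the
augmentation ideal (`logClass_mul`), and the classes of two commuting elements of `Γ_n` have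
bracket zero (`logClass_lie_of_commute`). The completion of `𝔭_n(G)` receives a unique filtered
morphism for each choice of images of degree one of the generators that satisfy the relations
(`existsUnique_filtered_hom`). It remains to verify the relations, and this uses only the two
properties above.

An additive map `l` from the fundamental group to a commutative group extends to all paths of
configurations: it gives a functor from the fundamental groupoid, here a `PathCocycle`. In the
plane minus finitely many points, such a cocycle takes on a circle the sum of its values on small
circles around the points inside (`PathCocycle.circ_eq_regionSum`); this replaces a presentation of
the fundamental group of the punctured plane. Let the `i`-th point of a configuration turn, in the
positive sense, around one of its punctures, which are the exceptional points and the `g • z_j`. The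
value of the cocycle on such a small circle, `localVal`, does not depend on the chart, nor on the
configuration, because the configuration space is path connected (`localVal_eq`). The loops of
the statement are freely homotopic to small circles run in the negative sense
(`val_of_isLoopAround`), so that the generators are sent to the opposites of the local values.

The linear relations come from the two points `z_i` and `g • z_j` turning around each other
(`localVal_symm`), and from a circle around all punctures, which seen from the other side of the
sphere surrounds none (`sum_localVal_eq_zero`). The quadratic relations come from tori of
configurations, whose two sides give commuting elements. Two points turn around different orbits
(`lie_localVal_of_disjoint`); or two points turn on circles of different radii around the same
center, where the outer circle surrounds the center and the images of the inner point by the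
stabilizer of the center (`lie_localVal_nested`); or two points turn around each other while the
pair turns around an exceptional point (`lie_localVal_pair`). Since `G` acts by unitary matrices,
stabilizers act by rotations in a suitable chart, and the circles can be chosen concentric
(`IsAdapted.exists_rotation`).
-/

open scoped TensorProduct

namespace OrbitConf

noncomputable section

/-! ### Classes of logarithms -/

section Graded

open Finset.HasAntidiagonal (antidiagonal)

variable {K L : Type*} [CommRing K] [LieRing L] [LieAlgebra K L] (𝓕 : LieFiltration K L)

theorem LieFiltration.grHat_lie_apply (x y : 𝓕.GrHat) (n : ℕ) :
    ⁅x, y⁆ n = ∑ p : antidiagonal n,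
      𝓕.grBracket (Finset.HasAntidiagonal.mem_antidiagonal.mp p.2) (x p.1.1) (y p.1.2) := rfl

theorem LieFiltration.grHatSingle_apply_of_ne {k m : ℕ} (h : m ≠ k) (x : 𝓕.Gr k) :
    𝓕.grHatSingle k x m = 0 := Pi.single_eq_of_ne h _

theorem LieFiltration.grHatSingle_cls_add {k : ℕ} {x y z : 𝓕.F k}
    (h : (x : L) - (y + z) ∈ 𝓕.F (k + 1)) :
    𝓕.grHatSingle k (𝓕.cls k x) = 𝓕.grHatSingle k (𝓕.cls k y) + 𝓕.grHatSingle k (𝓕.cls k z) := by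
  have : 𝓕.cls k x = 𝓕.cls k y + 𝓕.cls k z := by
    rw [← map_add, ← sub_eq_zero, ← map_sub, cls_eq_zero]
    exact h
  rw [this]
  exact Pi.single_add _ _ _

theorem LieFiltration.grHatSingle_cls_lie {k l : ℕ} {x : 𝓕.F k} {y : 𝓕.F l}
    (h : ⁅(x : L), (y : L)⁆ = 0) :
    ⁅𝓕.grHatSingle k (𝓕.cls k x), 𝓕.grHatSingle l (𝓕.cls l y)⁆ = 0 := by
  apply GrHat.ext
  intro n
  rw [grHat_lie_apply]
  refine Finset.sum_eq_zero fun p _ => ?_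
  obtain ⟨⟨i, j⟩, hp⟩ := p
  by_cases hi : i = k
  · by_cases hj : j = l
    · subst hi hj
      simp only [grHatSingle, Pi.single_eq_same]
      rw [grBracket_cls, cls_eq_zero]
      simp only [h]
      exact zero_mem _
    · simp only [grHatSingle_apply_of_ne 𝓕 hj, map_zero]
  · simp only [grHatSingle_apply_of_ne 𝓕 hi, map_zero, LinearMap.zero_apply]

end Graded

section Malcev

attribute [local instance] LieRing.ofAssociativeRing LieAlgebra.ofAssociativeAlgebra

variable (K : Type*) [Field K] {Γ : Type*} [Group Γ]

/-- Modulo the square of the augmentation ideal `log γ` is `γ - 1`, and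
`(γδ - 1) - (γ - 1) - (δ - 1) = (γ - 1)(δ - 1)`. -/
theorem completedLog_mul_sub (γ δ : Γ) :
    (completedLog K (γ * δ)).1 2 - ((completedLog K γ).1 2 + (completedLog K δ).1 2) = 0 := by
  have h2 : ∀ s : MonoidAlgebra K Γ, logTrunc K 2 s = s := fun s => by
    simp [logTrunc]
  have h3 : ∀ γ : Γ, (completedLog K γ).1 2 =
      Ideal.Quotient.mk _ (MonoidAlgebra.single γ 1 - 1 : MonoidAlgebra K Γ) := fun γ => by
    conv_rhs => rw [← h2 (MonoidAlgebra.single γ 1 - 1 : MonoidAlgebra K Γ)]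
    rfl
  rw [h3, h3, h3, ← map_add, ← map_sub, Ideal.Quotient.eq_zero_iff_mem]
  have e : (MonoidAlgebra.single (γ * δ) 1 - 1 - (MonoidAlgebra.single γ 1 - 1 +
      (MonoidAlgebra.single δ 1 - 1)) : MonoidAlgebra K Γ) =
      (MonoidAlgebra.single γ 1 - 1) * (MonoidAlgebra.single δ 1 - 1) := by
    rw [sub_mul, mul_sub, MonoidAlgebra.single_mul_single]
    simp only [mul_one, one_mul]
    abel
  rw [e, Submodule.pow_succ, Submodule.pow_one]
  exact Ideal.mul_mem_mul (single_sub_one_mem K γ) (single_sub_one_mem K δ)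

/-- The logarithm is a series in `γ - 1`, so that commuting elements have commuting logarithms. -/
theorem completedLog_commute {γ δ : Γ} (h : Commute γ δ) :
    Commute (completedLog K γ) (completedLog K δ) := by
  have hs : Commute (MonoidAlgebra.single γ 1 - 1 : MonoidAlgebra K Γ)
      (MonoidAlgebra.single δ 1 - 1) := by
    refine ((Commute.sub_left ?_ (Commute.one_left _)).sub_right (Commute.one_right _))
    change _ * _ = _ * _
    rw [MonoidAlgebra.single_mul_single, MonoidAlgebra.single_mul_single, h.eq]
  apply Subtype.ext
  funext k
  have hk : Commute (logTrunc K k (MonoidAlgebra.single γ 1 - 1 : MonoidAlgebra K Γ))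
      (logTrunc K k (MonoidAlgebra.single δ 1 - 1 : MonoidAlgebra K Γ)) :=
    Commute.sum_left _ _ _ fun _ _ => Commute.sum_right _ _ _ fun _ _ =>
      ((hs.pow_pow _ _).smul_left _).smul_right _
  exact (hk.map (Ideal.Quotient.mkₐ K (augIdeal K (MonoidAlgebra K Γ) ^ k))).eq

variable [CharZero K]

theorem malcevLog_lie_of_commute {γ δ : Γ} (h : Commute γ δ) :
    ⁅malcevLog K γ, malcevLog K δ⁆ = 0 := by
  apply Subtype.ext
  exact sub_eq_zero.mpr (completedLog_commute K h).eq

theorem logClass_mul (γ δ : Γ) : logClass K (γ * δ) = logClass K γ + logClass K δ := by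
  unfold logClass
  refine LieFiltration.grHatSingle_cls_add (malcevFiltration K Γ) (k := 1) ?_
  exact completedLog_mul_sub K γ δ

theorem logClass_apply_of_ne (γ : Γ) {k : ℕ} (hk : k ≠ 1) : logClass K γ k = 0 :=
  LieFiltration.grHatSingle_apply_of_ne _ hk _

/-- Two group elements that commute have commuting classes in the associated graded Lie algebra:
their logarithms already commute. -/
theorem logClass_lie_of_commute {γ δ : Γ} (h : Commute γ δ) :
    ⁅logClass K γ, logClass K δ⁆ = 0 :=
  LieFiltration.grHatSingle_cls_lie (malcevFiltration K Γ) (malcevLog_lie_of_commute K h)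

end Malcev

/-! ### Filtered morphisms from the completion of `𝔭_n(G)` -/

section Universal

open Finset.HasAntidiagonal (antidiagonal)

variable {K L P : Type*} [CommRing K] [LieRing L] [LieAlgebra K L] [LieRing P] [LieAlgebra K P]
  {ι : Type*} {a : ι → P}

/-- The homogeneous element `x` of degree `k`, seen in the completion. -/
def degreeCompletionSingle (a : ι → P) (k : ℕ) (x : P) (hx : x ∈ degreePart K a k) :
    degreeCompletion K a :=
  ⟨fun m => if m = k then x else 0, fun m => by
    by_cases h : m = k
    · subst h
      simpa using hx
    · simp [h]⟩

theorem degreeCompletionSingle_lie {k l : ℕ} {x y : P} (hx : x ∈ degreePart K a k)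
    (hy : y ∈ degreePart K a l) :
    ⁅degreeCompletionSingle a k x hx, degreeCompletionSingle a l y hy⁆ =
      degreeCompletionSingle a (k + l) ⁅x, y⁆ (degreePart_lie K a hx hy) := by
  apply Subtype.ext
  apply LieSeq.ext
  intro n
  change ∑ p ∈ antidiagonal n, ⁅(if p.1 = k then x else 0), (if p.2 = l then y else 0)⁆ =
    if n = k + l then ⁅x, y⁆ else 0
  split_ifs with h
  · rw [Finset.sum_eq_single (k, l)]
    · simp
    · rintro ⟨i, j⟩ hp hne
      by_cases hi : i = k
      · have hj : j ≠ l := fun hj => hne (by rw [hi, hj])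
        simp [hj]
      · simp [hi]
    · intro h'
      exact absurd (Finset.HasAntidiagonal.mem_antidiagonal.mpr h.symm) h'
  · refine Finset.sum_eq_zero ?_
    rintro ⟨i, j⟩ hp
    by_cases hi : i = k
    · have hj : j ≠ l := fun hj => h (by
        rw [← Finset.HasAntidiagonal.mem_antidiagonal.mp hp, hi, hj])
      simp [hj]
    · simp [hi]

/-- A filtered morphism from the completion is determined by its values on the generators:
they determine it on homogeneous elements, and up to an element of each step of the filtration. -/
theorem degreeCompletion_hom_ext (𝓕 : LieFiltration K L)
    {φ φ' : degreeCompletion K a →ₗ⁅K⁆ 𝓕.GrHat}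
    (hφ : ∀ m : ℕ, ∀ x ∈ degreeFiltration K a m, φ x ∈ 𝓕.grHatFiltration m)
    (hφ' : ∀ m : ℕ, ∀ x ∈ degreeFiltration K a m, φ' x ∈ 𝓕.grHatFiltration m)
    (h : ∀ i, φ (degreeCompletionGen K a i) = φ' (degreeCompletionGen K a i)) : φ = φ' := by
  have hmono : ∀ {k : ℕ} {x : P}, IsLieMonomial a k x → ∀ hx : x ∈ degreePart K a k,
      φ (degreeCompletionSingle a k x hx) = φ' (degreeCompletionSingle a k x hx) := by
    intro k x hm
    induction hm with
    | of i => exact fun _ => h i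
    | lie hm₁ hm₂ ih₁ ih₂ =>
      intro _
      have h₁ : _ ∈ degreePart K a _ := Submodule.subset_span hm₁
      have h₂ : _ ∈ degreePart K a _ := Submodule.subset_span hm₂
      rw [← degreeCompletionSingle_lie h₁ h₂, LieHom.map_lie, LieHom.map_lie, ih₁ h₁, ih₂ h₂]
  have hhom : ∀ (k : ℕ) (x : P) (hx : x ∈ degreePart K a k),
      φ (degreeCompletionSingle a k x hx) = φ' (degreeCompletionSingle a k x hx) := by
    intro k x hx
    induction hx using Submodule.span_induction with
    | mem x hx => exact hmono hx _
    | zero =>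
      have : ∀ h, degreeCompletionSingle (K := K) a k 0 h = 0 := fun h =>
        Subtype.ext (LieSeq.ext fun m => ite_self _)
      exact (congrArg φ (this _)).trans ((map_zero φ).trans
        ((congrArg φ' (this _)).trans (map_zero φ')).symm)
    | add x y hx hy ihx ihy =>
      have : degreeCompletionSingle (K := K) a k (x + y) (add_mem hx hy) =
          degreeCompletionSingle a k x hx + degreeCompletionSingle a k y hy := by
        refine Subtype.ext (LieSeq.ext fun m => ?_)
        change (if m = k then x + y else 0) = (if m = k then x else 0) + (if m = k then y else 0)
        split_ifs <;> simp
      rw [this, map_add, map_add, ihx, ihy]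
    | smul c x hx ihx =>
      have : degreeCompletionSingle (K := K) a k (c • x) (Submodule.smul_mem _ c hx) =
          c • degreeCompletionSingle a k x hx := by
        refine Subtype.ext (LieSeq.ext fun m => ?_)
        change (if m = k then c • x else 0) = c • (if m = k then x else 0)
        split_ifs <;> simp
      rw [this, map_smul, map_smul, ihx]
  apply LieHom.ext
  intro x
  apply LieFiltration.GrHat.ext
  intro m
  -- Up to degree `m` the element `x` is a finite sum of homogeneous elements.
  set y : degreeCompletion K a := ∑ k ∈ Finset.range (m + 1),
    degreeCompletionSingle a k ((x : LieSeq P) k) (x.2 k) with hy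
  have hxy : x - y ∈ degreeFiltration K a (m + 1) := by
    intro k hk
    change (x : LieSeq P) k - (y : LieSeq P) k = 0
    rw [sub_eq_zero, hy]
    have : ∀ s : Finset ℕ, ((∑ k ∈ s, degreeCompletionSingle a k ((x : LieSeq P) k) (x.2 k) :
        degreeCompletion K a) : LieSeq P) k = ∑ j ∈ s, if k = j then (x : LieSeq P) j else 0 := by
      intro s
      induction s using Finset.induction_on with
      | empty => rfl
      | insert j s hj ih =>
        rw [Finset.sum_insert hj, Finset.sum_insert hj, ← ih]
        rfl
    refine Eq.trans ?_ (this _).symm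
    exact ((Finset.sum_ite_eq _ k (x : LieSeq P)).trans (if_pos (Finset.mem_range.mpr hk))).symm
  have e : φ y = φ' y := by
    rw [hy, map_sum, map_sum]
    exact Finset.sum_congr rfl fun k _ => hhom k _ _
  have h1 := hφ _ _ hxy m (Nat.lt_succ_self m)
  have h2 := hφ' _ _ hxy m (Nat.lt_succ_self m)
  rw [map_sub] at h1 h2
  have h1' : φ x m = φ y m := sub_eq_zero.mp h1
  have h2' : φ' x m = φ' y m := sub_eq_zero.mp h2
  rw [h1', h2', e]

theorem LieFiltration.lie_concentrated (𝓕 : LieFiltration K L) {k l : ℕ} {x y : 𝓕.GrHat}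
    (hx : ∀ m ≠ k, x m = 0) (hy : ∀ m ≠ l, y m = 0) : ∀ m ≠ k + l, ⁅x, y⁆ m = 0 := by
  intro m hm
  rw [grHat_lie_apply]
  refine Finset.sum_eq_zero ?_
  rintro ⟨⟨i, j⟩, hp⟩ _
  by_cases hi : i = k
  · have hj : j ≠ l := fun hj => hm (by
      rw [← Finset.HasAntidiagonal.mem_antidiagonal.mp hp, hi, hj])
    simp only [hy j hj, map_zero]
  · simp only [hx i hi, map_zero, LinearMap.zero_apply]

/-- A morphism to `∏_k gr_k` that sends the generators to elements of degree `1` sends elements of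
degree `k` to elements of degree `k`. -/
theorem LieHom.map_degreePart (𝓕 : LieFiltration K L) (ψ : P →ₗ⁅K⁆ 𝓕.GrHat)
    (hψ : ∀ i, ∀ m ≠ 1, ψ (a i) m = 0) {k : ℕ} {x : P} (hx : x ∈ degreePart K a k) :
    ∀ m ≠ k, ψ x m = 0 := by
  induction hx using Submodule.span_induction with
  | mem x hx =>
    induction hx with
    | of i => exact hψ i
    | lie _ _ ih₁ ih₂ =>
      rw [LieHom.map_lie]
      exact 𝓕.lie_concentrated ih₁ ih₂
  | zero =>
    intro m _
    rw [map_zero]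
    rfl
  | add x y _ _ ihx ihy =>
    intro m hm
    rw [map_add]
    change ψ x m + ψ y m = 0
    rw [ihx m hm, ihy m hm, add_zero]
  | smul c x _ ihx =>
    intro m hm
    rw [map_smul]
    change c • ψ x m = 0
    rw [ihx m hm, smul_zero]

/-- The extension to the completions of a graded morphism. -/
def degreeCompletionLift (𝓕 : LieFiltration K L) (ψ : P →ₗ⁅K⁆ 𝓕.GrHat)
    (hψ : ∀ i, ∀ m ≠ 1, ψ (a i) m = 0) : degreeCompletion K a →ₗ⁅K⁆ 𝓕.GrHat where
  toFun x := fun m => ψ ((x : LieSeq P) m) m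
  map_add' x y := by
    apply LieFiltration.GrHat.ext
    intro m
    change ψ ((x : LieSeq P) m + (y : LieSeq P) m) m = _
    rw [map_add]
    rfl
  map_smul' c x := by
    apply LieFiltration.GrHat.ext
    intro m
    change ψ (c • (x : LieSeq P) m) m = _
    rw [map_smul]
    rfl
  map_lie' {x y} := by
    apply LieFiltration.GrHat.ext
    intro m
    change ψ (∑ p ∈ antidiagonal m, ⁅(x : LieSeq P) p.1, (y : LieSeq P) p.2⁆) m = _
    refine Eq.trans ?_ (LieFiltration.grHat_lie_apply 𝓕 _ _ _).symm
    rw [map_sum]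
    have hs : ∀ (s : Finset (ℕ × ℕ)) (f : ℕ × ℕ → 𝓕.GrHat), (∑ p ∈ s, f p) m = ∑ p ∈ s, f p m :=
      fun s f => Finset.sum_apply m s f
    rw [hs, ← Finset.sum_coe_sort (antidiagonal m)]
    refine Finset.sum_congr rfl ?_
    rintro ⟨⟨i, j⟩, hp⟩ _
    rw [LieHom.map_lie, LieFiltration.grHat_lie_apply,
      Finset.sum_eq_single (⟨(i, j), hp⟩ : antidiagonal m) _
        (fun h => absurd (Finset.mem_univ _) h)]
    rintro ⟨⟨i', j'⟩, hp'⟩ _ hne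
    by_cases hi : i' = i
    · have hj : j' ≠ j := fun hj => hne (by subst hi hj; rfl)
      simp only [LieHom.map_degreePart 𝓕 ψ hψ (y.2 j) j' hj, map_zero]
    · simp only [LieHom.map_degreePart 𝓕 ψ hψ (x.2 i) i' hi, map_zero, LinearMap.zero_apply]

theorem degreeCompletionLift_gen (𝓕 : LieFiltration K L) (ψ : P →ₗ⁅K⁆ 𝓕.GrHat)
    (hψ : ∀ i, ∀ m ≠ 1, ψ (a i) m = 0) (i : ι) :
    degreeCompletionLift 𝓕 ψ hψ (degreeCompletionGen K a i) = ψ (a i) := by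
  apply LieFiltration.GrHat.ext
  intro m
  change ψ (if m = 1 then a i else 0) m = _
  split_ifs with h
  · rfl
  · rw [hψ i m h, map_zero]
    rfl

theorem degreeCompletionLift_mem (𝓕 : LieFiltration K L) (ψ : P →ₗ⁅K⁆ 𝓕.GrHat)
    (hψ : ∀ i, ∀ m ≠ 1, ψ (a i) m = 0) (m : ℕ) (x : degreeCompletion K a)
    (hx : x ∈ degreeFiltration K a m) : degreeCompletionLift 𝓕 ψ hψ x ∈ 𝓕.grHatFiltration m := by
  intro k hk
  change ψ ((x : LieSeq P) k) k = 0
  rw [hx k hk, map_zero]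
  rfl

end Universal

section OrbitLie

variable {K : Type*} [Field K] {G : Subgroup (Equiv.Perm (OnePoint ℂ))} {n : ℕ}

theorem orbitLieGen_symm {i j : Fin n} (hij : i ≠ j) (g : G) :
    orbitLieGen K G n (Gen.pair i j hij g) = orbitLieGen K G n (Gen.pair j i hij.symm g⁻¹) := by
  refine (Submodule.Quotient.eq _).mpr ?_
  exact LieSubmodule.subset_lieSpan (Rel.symm hij g)

theorem hatX_symm {i j : Fin n} (hij : i ≠ j) (g : G) :
    hatX K hij g = hatX K hij.symm g⁻¹ := by
  refine Subtype.ext (LieSeq.ext fun m => ?_)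
  change (if m = 1 then orbitLieGen K G n _ else 0) = if m = 1 then orbitLieGen K G n _ else 0
  rw [orbitLieGen_symm]

variable {L : Type*} [LieRing L] [LieAlgebra K L]

/-- The morphism from `𝔭_n(G)(K)` given by images of the generators that satisfy the relations. -/
def orbitLieLift (u : Gen G n → L) (hu : ∀ x, Rel K G n x → FreeLieAlgebra.lift K u x = 0) :
    OrbitLie K G n →ₗ⁅K⁆ L where
  toLinearMap := Submodule.liftQ _
    (FreeLieAlgebra.lift K u : FreeLieAlgebra K (Gen G n) →ₗ[K] L) (by
    have : LieSubmodule.lieSpan K (FreeLieAlgebra K (Gen G n)) {x | Rel K G n x} ≤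
        (FreeLieAlgebra.lift K u).ker :=
      LieSubmodule.lieSpan_le.mpr fun x hx => LieHom.mem_ker.mpr (hu x hx)
    exact fun x hx => LieHom.mem_ker.mp (this hx))
  map_lie' {x y} := by
    obtain ⟨x, rfl⟩ := Submodule.Quotient.mk_surjective _ x
    obtain ⟨y, rfl⟩ := Submodule.Quotient.mk_surjective _ y
    exact LieHom.map_lie (FreeLieAlgebra.lift K u) x y

theorem orbitLieLift_gen (u : Gen G n → L)
    (hu : ∀ x, Rel K G n x → FreeLieAlgebra.lift K u x = 0) (b : Gen G n) :
    orbitLieLift u hu (orbitLieGen K G n b) = u b := FreeLieAlgebra.lift_of_apply u b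

/-- Images of degree `1` of the generators that satisfy the relations extend uniquely to a filtered
morphism on the completion, and the generators `X_{ij}(g)` with `i < j` suffice for uniqueness. -/
theorem existsUnique_filtered_hom (𝓕 : LieFiltration K L) (u : Gen G n → 𝓕.GrHat)
    (hu1 : ∀ b, ∀ m ≠ 1, u b m = 0) (hu : ∀ x, Rel K G n x → FreeLieAlgebra.lift K u x = 0) :
    ∃! φ : OrbitLieHat K G n →ₗ⁅K⁆ 𝓕.GrHat,
      (∀ m : ℕ, ∀ a ∈ degreeFiltration K (orbitLieGen K G n) m, φ a ∈ 𝓕.grHatFiltration m) ∧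
      (∀ (i j : Fin n) (hij : i < j) (g : G), φ (hatX K hij.ne g) = u (Gen.pair i j hij.ne g)) ∧
      (∀ (k : Fin n) (p : exceptional G), φ (hatY K k p) = u (Gen.point k p)) := by
  have h1 : ∀ b, ∀ m ≠ 1, orbitLieLift u hu (orbitLieGen K G n b) m = 0 := fun b m hm => by
    rw [orbitLieLift_gen, hu1 b m hm]
  refine ⟨degreeCompletionLift 𝓕 (orbitLieLift u hu) h1, ⟨?_, ?_, ?_⟩, ?_⟩
  · exact degreeCompletionLift_mem 𝓕 _ h1
  · intro i j hij g
    exact (degreeCompletionLift_gen 𝓕 _ h1 _).trans (orbitLieLift_gen u hu _)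
  · intro k p
    exact (degreeCompletionLift_gen 𝓕 _ h1 _).trans (orbitLieLift_gen u hu _)
  · rintro φ ⟨hF, hX, hY⟩
    have hX' : ∀ (i j : Fin n) (hij : i < j) (g : G),
        φ (hatX K hij.ne g) = degreeCompletionLift 𝓕 (orbitLieLift u hu) h1 (hatX K hij.ne g) :=
      fun i j hij g => (hX i j hij g).trans
        ((degreeCompletionLift_gen 𝓕 _ h1 _).trans (orbitLieLift_gen u hu _)).symm
    refine degreeCompletion_hom_ext 𝓕 hF (degreeCompletionLift_mem 𝓕 _ h1) ?_
    rintro (⟨i, j, hij, g⟩ | ⟨i, p⟩)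
    · rcases lt_or_gt_of_ne hij with h | h
      · exact hX' i j h g
      · have := hX' j i h g⁻¹
        rw [hatX_symm, inv_inv] at this
        exact this
    · exact (hY i p).trans
        ((degreeCompletionLift_gen 𝓕 _ h1 _).trans (orbitLieLift_gen u hu _)).symm

end OrbitLie

/-! ### Cocycles on paths -/

section PathCocycle

open Set Topology Filter

/-- A functor from the fundamental groupoid of `X` to an abelian group `A`: it is additive for the
concatenation of paths and invariant under homotopies with fixed ends. It is encoded as a function
of all maps `ℝ → V`, where `V` is an ambient space; only the maps that are continuous on `[0, 1]`
with values in `X` there are subject to conditions. -/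
structure PathCocycle {V : Type*} [TopologicalSpace V] (X : Set V) (A : Type*)
    [AddCommGroup A] where
  val : (ℝ → V) → A
  congr : ∀ {f g : ℝ → V}, EqOn f g (Icc 0 1) → val f = val g
  homotopy : ∀ F : ℝ × ℝ → V, ContinuousOn F (Icc 0 1 ×ˢ Icc 0 1) →
    MapsTo F (Icc 0 1 ×ˢ Icc 0 1) X → (∀ s ∈ Icc (0 : ℝ) 1, F (s, 0) = F (0, 0)) →
    (∀ s ∈ Icc (0 : ℝ) 1, F (s, 1) = F (0, 1)) →
    val (fun t => F (0, t)) = val (fun t => F (1, t))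
  trans : ∀ f : ℝ → V, ContinuousOn f (Icc 0 1) → MapsTo f (Icc 0 1) X →
    val f = val (fun t => f (t / 2)) + val (fun t => f ((t + 1) / 2))

namespace PathCocycle

variable {V V' A : Type*} [TopologicalSpace V] [TopologicalSpace V'] [AddCommGroup A]
  {X : Set V} (c : PathCocycle X A)

/-- The pullback of a cocycle. -/
def comap (ψ : V' → V) {X' : Set V'} (hψ : ContinuousOn ψ X') (hm : MapsTo ψ X' X) :
    PathCocycle X' A where
  val f := c.val (ψ ∘ f)
  congr h := c.congr fun _ ht => congrArg ψ (h ht)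
  homotopy F hF hFm h0 h1 := c.homotopy (ψ ∘ F) (hψ.comp hF hFm) (hm.comp hFm)
    (fun s hs => congrArg ψ (h0 s hs)) (fun s hs => congrArg ψ (h1 s hs))
  trans f hf hfm := c.trans (ψ ∘ f) (hψ.comp hf hfm) (hm.comp hfm)

section Convex

variable {E : Type*} [NormedAddCommGroup E] [NormedSpace ℝ E] {Y : Set E} (d : PathCocycle Y A)

/-- The value of a cocycle on the straight path from `a` to `b`. -/
def seg (a b : E) : A := d.val (AffineMap.lineMap a b)

variable {d} {S : Set E}

/-- In a convex set all paths with the same ends are homotopic. -/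
theorem val_eq_seg (hS : Convex ℝ S) (hSY : S ⊆ Y) {f : ℝ → E} (hf : ContinuousOn f (Icc 0 1))
    (hfS : MapsTo f (Icc 0 1) S) : d.val f = d.seg (f 0) (f 1) := by
  have h0 : (0 : ℝ) ∈ Icc (0 : ℝ) 1 := by simp
  have h1 : (1 : ℝ) ∈ Icc (0 : ℝ) 1 := by simp
  have key := d.homotopy (fun x => (1 - x.1) • f x.2 + x.1 • AffineMap.lineMap (f 0) (f 1) x.2)
    (by
      refine ContinuousOn.add (ContinuousOn.smul (by fun_prop)
        (hf.comp (by fun_prop) fun x hx => hx.2)) ?_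
      exact (continuous_fst.smul
        ((AffineMap.lineMap_continuous (p := f 0) (q := f 1)).comp continuous_snd)).continuousOn)
    (by
      rintro ⟨s, t⟩ ⟨hs, ht⟩
      refine hSY (hS (hfS ht) (hS.lineMap_mem (hfS h0) (hfS h1) ht) ?_ hs.1 (by ring))
      linarith [hs.2])
    (by
      intro s _
      simp [← add_smul])
    (by
      intro s _
      simp [← add_smul])
  have key' : d.val (fun t => f t) = d.val (fun t => AffineMap.lineMap (f 0) (f 1) t) := by
    simpa using key
  exact key'

/-- In a convex set, the broken path from `a` to `b` to `e` can be straightened. -/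
theorem seg_add (hS : Convex ℝ S) (hSY : S ⊆ Y) {a b e : E} (ha : a ∈ S) (hb : b ∈ S)
    (he : e ∈ S) : d.seg a b + d.seg b e = d.seg a e := by
  set f : ℝ → E := fun t => if t ≤ 1 / 2 then AffineMap.lineMap a b (2 * t)
    else AffineMap.lineMap b e (2 * t - 1) with hf
  have hc : Continuous f := by
    refine Continuous.if_le ?_ ?_ continuous_id continuous_const ?_
    · exact AffineMap.lineMap_continuous.comp (by fun_prop)
    · exact AffineMap.lineMap_continuous.comp (by fun_prop)
    · intro t ht
      change t = 1 / 2 at ht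
      subst ht
      norm_num
  have hm : MapsTo f (Icc 0 1) S := by
    intro t ht
    simp only [hf]
    split_ifs with h
    · exact hS.lineMap_mem ha hb ⟨by linarith [ht.1], by linarith⟩
    · exact hS.lineMap_mem hb he ⟨by linarith, by linarith [ht.2]⟩
  have h1 := val_eq_seg (d := d) hS hSY hc.continuousOn hm
  have h2 := d.trans f hc.continuousOn (hm.mono_right hSY)
  have e0 : f 0 = a := by simp [hf]
  have e1 : f 1 = e := by norm_num [hf]
  have e2 : d.val (fun t => f (t / 2)) = d.seg a b := by
    refine d.congr fun t ht => ?_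
    simp only [hf]
    rw [if_pos (by linarith [ht.2])]
    congr 1
    ring
  have e3 : d.val (fun t => f ((t + 1) / 2)) = d.seg b e := by
    refine d.congr fun t ht => ?_
    simp only [hf]
    split_ifs with h
    · have : t = 0 := by linarith [ht.1]
      subst this
      norm_num
    · congr 1
      ring
  rw [← e2, ← e3, ← h2, h1, e0, e1]

theorem seg_self {a : E} (ha : a ∈ Y) : d.seg a a = 0 := by
  have := seg_add (d := d) (convex_singleton a) (singleton_subset_iff.mpr ha)
    (mem_singleton a) (mem_singleton a) (mem_singleton a)
  simpa using this

theorem seg_symm (hS : Convex ℝ S) (hSY : S ⊆ Y) {a b : E} (ha : a ∈ S) (hb : b ∈ S) :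
    d.seg b a = -d.seg a b := by
  rw [eq_neg_iff_add_eq_zero, seg_add hS hSY hb ha hb, seg_self (hSY hb)]

end Convex

variable {c}

theorem convex_unitSquare : Convex ℝ (Icc (0 : ℝ) 1 ×ˢ Icc (0 : ℝ) 1) :=
  (convex_Icc 0 1).prod (convex_Icc 0 1)

/-- A cocycle takes the same value on freely homotopic loops: the track of the base point is
run once in each direction, and `A` is commutative. -/
theorem val_eq_of_free_homotopy (F : ℝ × ℝ → V) (hF : ContinuousOn F (Icc 0 1 ×ˢ Icc 0 1))
    (hm : MapsTo F (Icc 0 1 ×ˢ Icc 0 1) X) (hper : ∀ s ∈ Icc (0 : ℝ) 1, F (s, 0) = F (s, 1)) :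
    c.val (fun t => F (0, t)) = c.val (fun t => F (1, t)) := by
  set d := c.comap F hF hm
  have hseg : ∀ {a b : ℝ × ℝ} {f : ℝ → V}, (∀ t ∈ Icc (0 : ℝ) 1,
      F (AffineMap.lineMap a b t) = f t) → d.seg a b = c.val f := fun h => c.congr h
  have e1 : d.seg (0, 0) (0, 1) = c.val (fun t => F (0, t)) := hseg fun t _ => by
    simp [AffineMap.lineMap_apply]
  have e2 : d.seg (1, 0) (1, 1) = c.val (fun t => F (1, t)) := hseg fun t _ => by
    simp [AffineMap.lineMap_apply]
  have e3 : d.seg (0, 1) (1, 1) = d.seg (0, 0) (1, 0) := hseg fun t ht => by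
    have := hper t ht
    simpa [AffineMap.lineMap_apply] using this.symm
  have m : ∀ a b : ℝ, a ∈ Icc (0 : ℝ) 1 → b ∈ Icc (0 : ℝ) 1 →
      (a, b) ∈ Icc (0 : ℝ) 1 ×ˢ Icc (0 : ℝ) 1 := fun a b ha hb => ⟨ha, hb⟩
  have i0 : (0 : ℝ) ∈ Icc (0 : ℝ) 1 := by simp
  have i1 : (1 : ℝ) ∈ Icc (0 : ℝ) 1 := by simp
  have a1 := seg_add (d := d) convex_unitSquare subset_rfl (m 0 0 i0 i0) (m 0 1 i0 i1) (m 1 1 i1 i1)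
  have a2 := seg_add (d := d) convex_unitSquare subset_rfl (m 0 0 i0 i0) (m 1 0 i1 i0) (m 1 1 i1 i1)
  rw [← e1, ← e2]
  rw [e3, ← a2, add_comm] at a1
  exact add_left_cancel a1

theorem val_reverse {f : ℝ → V} (hf : ContinuousOn f (Icc 0 1)) (hm : MapsTo f (Icc 0 1) X) :
    c.val (fun t => f (1 - t)) = -c.val f := by
  have h := seg_symm (d := c.comap f hf hm) (convex_Icc (0 : ℝ) 1) subset_rfl
    (a := 0) (b := 1) (by simp) (by simp)
  have e1 : (c.comap f hf hm).seg 1 0 = c.val (fun t => f (1 - t)) := by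
    refine c.congr fun t _ => congrArg f ?_
    simp [AffineMap.lineMap_apply]
    ring
  have e2 : (c.comap f hf hm).seg 0 1 = c.val f := by
    refine c.congr fun t _ => congrArg f ?_
    simp [AffineMap.lineMap_apply]
  rw [← e1, ← e2, h]

end PathCocycle

end PathCocycle

/-! ### Cocycles in the plane: circles and squares -/

section Planar

open Set Topology Filter Complex

namespace PathCocycle

variable {A : Type*} [AddCommGroup A] {X : Set ℂ} (c : PathCocycle X A)

/-- The value of a cocycle on the circle of center `a` and radius `r`, in the positive sense. -/
def circ (a : ℂ) (r : ℝ) : A := c.val (fun t => circleMap a r (2 * Real.pi * t))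

variable {c}

/-- In a punctured disc around `p` a loop `p + exp L` whose logarithm `L` increases by `2πi` has the
same value as a circle. -/
theorem val_add_exp_eq_circ {p : ℂ} {δ : ℝ} (hX : ∀ z, z ≠ p → ‖z - p‖ < δ → z ∈ X) {L : ℝ → ℂ}
    (hL : ContinuousOn L (Icc 0 1)) (hLδ : ∀ t ∈ Icc (0 : ℝ) 1, ‖exp (L t)‖ < δ)
    (hL1 : L 1 = L 0 + 2 * Real.pi * I) {r : ℝ} (hr : 0 < r) (hrδ : r < δ) :
    c.val (fun t => p + exp (L t)) = c.circ p r := by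
  have hδ : 0 < δ := hr.trans hrδ
  -- the exponential pulls the cocycle back to a half-plane, which is convex
  set H : Set ℂ := {z | z.re < Real.log δ} with hH
  have hHc : Convex ℝ H := convex_halfSpace_re_lt _
  have hmem : ∀ z : ℂ, ‖exp z‖ < δ ↔ z ∈ H := fun z => by
    rw [norm_exp, hH, mem_ofPred_eq, Real.lt_log_iff_exp_lt hδ]
  set d := c.comap (fun z => p + exp z) (X' := H) (by fun_prop) (fun z hz => hX _
    (by simp [exp_ne_zero]) (by simpa using (hmem z).mpr hz))
  have hper : ∀ a b : ℂ, d.seg (a + 2 * Real.pi * I) (b + 2 * Real.pi * I) = d.seg a b := by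
    intro a b
    refine c.congr fun t _ => ?_
    simp only [Function.comp, AffineMap.lineMap_apply, vsub_eq_sub, vadd_eq_add,
      add_sub_add_right_eq_sub]
    rw [← add_assoc, exp_periodic]
  have i0 : (0 : ℝ) ∈ Icc (0 : ℝ) 1 := by simp
  have i1 : (1 : ℝ) ∈ Icc (0 : ℝ) 1 := by simp
  have e1 : c.val (fun t => p + exp (L t)) = d.seg (L 0) (L 0 + 2 * Real.pi * I) := by
    rw [← hL1]
    exact val_eq_seg (d := d) hHc subset_rfl hL fun t ht => (hmem _).mp (hLδ t ht)
  have hl : (Real.log r : ℂ) ∈ H := by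
    rw [← hmem, ← ofReal_exp, Real.exp_log hr, norm_real, Real.norm_of_nonneg hr.le]
    exact hrδ
  have hl' : (Real.log r : ℂ) + 2 * Real.pi * I ∈ H := by
    rw [← hmem, exp_periodic, hmem]
    exact hl
  have e2 : c.circ p r = d.seg (Real.log r) (Real.log r + 2 * Real.pi * I) := by
    refine c.congr fun t _ => ?_
    simp only [circleMap, Function.comp, AffineMap.lineMap_apply, vsub_eq_sub, vadd_eq_add,
      add_sub_cancel_left, exp_add]
    rw [← ofReal_exp, Real.exp_log hr, mul_comm]
    congr 3
    rw [real_smul]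
    push_cast
    ring
  have h0 : L 0 ∈ H := (hmem _).mp (hLδ 0 i0)
  have h1 : L 0 + 2 * Real.pi * I ∈ H := by
    rw [← hL1]
    exact (hmem _).mp (hLδ 1 i1)
  have a1 := seg_add (d := d) hHc subset_rfl h0 h1 hl'
  have a2 := seg_add (d := d) hHc subset_rfl h0 hl hl'
  rw [hper] at a1
  rw [e1, e2]
  rw [← a2, add_comm] at a1
  exact add_left_cancel a1

/-- An arc of length a quarter of a circle can be replaced by its chord, if the cap between them is
contained in `X`. -/
theorem val_quarter_arc {p : ℂ} {η : ℝ} (α : ℝ)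
    (hX : ∀ z, ‖z - p‖ ≤ η * √2 → η ≤ (exp (-(α * I)) * (z - p)).re → z ∈ X) (hη : 0 < η) :
    c.val (fun t => circleMap p (η * √2) (α - Real.pi / 4 + t * (Real.pi / 2))) =
      c.seg (p + exp (α * I) * (η * (1 - I))) (p + exp (α * I) * (η * (1 + I))) := by
  set S : Set ℂ := {z | ‖z - p‖ ≤ η * √2} ∩ {z | η ≤ (exp (-(α * I)) * (z - p)).re} with hS
  have hSc : Convex ℝ S := by
    refine Convex.inter ?_ ?_
    · have : {z : ℂ | ‖z - p‖ ≤ η * √2} = Metric.closedBall p (η * √2) := by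
        ext z
        simp [dist_eq]
      rw [this]
      exact convex_closedBall _ _
    · intro z hz w hw a b ha hb hab
      simp only [mem_ofPred_eq] at hz hw ⊢
      have e : (exp (-(α * I)) * (a • z + b • w - p)).re =
          a * (exp (-(α * I)) * (z - p)).re + b * (exp (-(α * I)) * (w - p)).re := by
        have : p = a • p + b • p := by rw [← add_smul, hab, one_smul]
        rw [← re_ofReal_mul, ← re_ofReal_mul, ← add_re]
        congr 1
        nth_rewrite 1 [this]
        simp only [real_smul]
        ring
      rw [e]
      nlinarith
  have hρ : 0 < η * √2 := by positivity
  have h := val_eq_seg (d := c) hSc (fun z hz => hX z hz.1 hz.2)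
    (f := fun t => circleMap p (η * √2) (α - Real.pi / 4 + t * (Real.pi / 2)))
    (by fun_prop) (by
      intro t ht
      refine ⟨?_, ?_⟩
      · exact (mem_sphere_iff_norm.mp (circleMap_mem_sphere p hρ.le _)).le
      · have e : exp (-(α * I)) * (circleMap p (η * √2) (α - Real.pi / 4 + t * (Real.pi / 2)) - p)
            = ((η * √2 : ℝ) : ℂ) * exp (((t * (Real.pi / 2) - Real.pi / 4 : ℝ) : ℂ) * I) := by
          rw [circleMap, add_sub_cancel_left, mul_left_comm, ← exp_add]
          congr 2
          push_cast
          ring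
        rw [mem_ofPred_eq, e, re_ofReal_mul, exp_ofReal_mul_I_re]
        have hc : √2 / 2 ≤ Real.cos (t * (Real.pi / 2) - Real.pi / 4) := by
          rw [← Real.cos_pi_div_four, ← Real.cos_abs (t * (Real.pi / 2) - Real.pi / 4)]
          have hπ := Real.pi_pos
          refine Real.cos_le_cos_of_nonneg_of_le_pi (abs_nonneg _) (by linarith) ?_
          rw [abs_le]
          constructor <;> nlinarith [ht.1, ht.2]
        have h2 : √2 * √2 = 2 := Real.mul_self_sqrt (by norm_num)
        have h3 : 0 ≤ √2 := Real.sqrt_nonneg 2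
        nlinarith [mul_le_mul_of_nonneg_left hc (mul_nonneg hη.le h3)])
  rw [h]
  have h2 : (√2 : ℂ) * √2 = 2 := by
    rw [← ofReal_mul, Real.mul_self_sqrt (by norm_num)]
    norm_num
  have key : ∀ β : ℝ, circleMap p (η * √2) (α + β) =
      p + exp (α * I) * (η * (√2 * (Real.cos β + Real.sin β * I))) := by
    intro β
    rw [circleMap]
    push_cast
    rw [add_mul, exp_add, exp_mul_I β]
    ring
  congr 1
  · have := key (-(Real.pi / 4))
    rw [Real.cos_neg, Real.sin_neg, Real.cos_pi_div_four, Real.sin_pi_div_four] at this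
    rw [zero_mul, add_zero, sub_eq_add_neg, this]
    push_cast
    congr 3
    linear_combination (1 / 2 - I / 2) * h2
  · have := key (Real.pi / 4)
    rw [Real.cos_pi_div_four, Real.sin_pi_div_four] at this
    rw [show α - Real.pi / 4 + 1 * (Real.pi / 2) = α + Real.pi / 4 by ring, this]
    push_cast
    congr 3
    linear_combination (1 / 2 + I / 2) * h2

variable (c)

/-- The value of a cocycle on the boundary of the rectangle `[x₀, x₁] × [y₀, y₁]`. -/
def rect (x₀ x₁ y₀ y₁ : ℝ) : A :=
  c.seg ⟨x₀, y₀⟩ ⟨x₁, y₀⟩ + c.seg ⟨x₁, y₀⟩ ⟨x₁, y₁⟩ + c.seg ⟨x₁, y₁⟩ ⟨x₀, y₁⟩ +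
    c.seg ⟨x₀, y₁⟩ ⟨x₀, y₀⟩

variable {c}

/-- A circle has the same value as the inscribed square, if the caps between them are contained in
`X`. -/
theorem circ_eq_rect {p : ℂ} {η : ℝ} (hη : 0 < η)
    (hX : ∀ z, ‖z - p‖ ≤ η * √2 → η ≤ |(z - p).re| ∨ η ≤ |(z - p).im| → z ∈ X) :
    c.circ p (η * √2) = c.rect (p.re - η) (p.re + η) (p.im - η) (p.im + η) := by
  have hρ : 0 < η * √2 := by positivity
  set d := c.comap (circleMap p (η * √2)) (X' := univ) (by fun_prop) (fun θ _ => hX _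
    (mem_sphere_iff_norm.mp (circleMap_mem_sphere p hρ.le θ)).le
    (by
      by_contra! hlt
      have e : (circleMap p (η * √2) θ - p).re ^ 2 + (circleMap p (η * √2) θ - p).im ^ 2 =
          2 * η ^ 2 := by
        have h1 : (circleMap p (η * √2) θ - p) = ((η * √2 : ℝ) : ℂ) * exp (θ * I) := by
          simp [circleMap]
        rw [h1, re_ofReal_mul, im_ofReal_mul, exp_ofReal_mul_I_re, exp_ofReal_mul_I_im]
        simp only [mul_pow, Real.sq_sqrt (zero_le_two : (0 : ℝ) ≤ 2)]
        linear_combination (2 * η ^ 2) * Real.cos_sq_add_sin_sq θ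
      have h1 := sq_lt_sq' (by linarith [neg_abs_le (circleMap p (η * √2) θ - p).re])
        ((le_abs_self _).trans_lt hlt.1)
      have h2 := sq_lt_sq' (by linarith [neg_abs_le (circleMap p (η * √2) θ - p).im])
        ((le_abs_self _).trans_lt hlt.2)
      linarith))
  have hadd : ∀ a b e : ℝ, d.seg a b + d.seg b e = d.seg a e := fun a b e =>
    seg_add (d := d) convex_univ subset_rfl (mem_univ _) (mem_univ _) (mem_univ _)
  have hper : ∀ a b : ℝ, d.seg (a + 2 * Real.pi) (b + 2 * Real.pi) = d.seg a b := by
    intro a b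
    refine c.congr fun t _ => ?_
    simp only [Function.comp, AffineMap.lineMap_apply, vsub_eq_sub, vadd_eq_add,
      add_sub_add_right_eq_sub, ← add_assoc]
    exact periodic_circleMap _ _ _
  have e0 : c.circ p (η * √2) = d.seg 0 (2 * Real.pi) := by
    refine c.congr fun t _ => ?_
    simp [AffineMap.lineMap_apply, mul_comm]
  have hq : ∀ (α : ℝ), (∀ z, ‖z - p‖ ≤ η * √2 → η ≤ (exp (-(α * I)) * (z - p)).re → z ∈ X) →
      d.seg (α - Real.pi / 4) (α + Real.pi / 4) =
      c.seg (p + exp (α * I) * (η * (1 - I))) (p + exp (α * I) * (η * (1 + I))) := by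
    intro α hα
    rw [← val_quarter_arc α hα hη]
    refine c.congr fun t _ => ?_
    simp only [Function.comp, AffineMap.lineMap_apply, vsub_eq_sub, vadd_eq_add, smul_eq_mul]
    congr 1
    ring
  have x0 : exp ((0 : ℝ) * I) = 1 := by simp
  have x1 : exp ((Real.pi / 2 : ℝ) * I) = I := by
    push_cast
    exact exp_pi_div_two_mul_I
  have x2 : exp ((Real.pi : ℝ) * I) = -1 := exp_pi_mul_I
  have x3 : exp ((3 * Real.pi / 2 : ℝ) * I) = -I := by
    rw [show ((3 * Real.pi / 2 : ℝ) : ℂ) * I = Real.pi * I + (Real.pi / 2 : ℝ) * I by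
      push_cast; ring, exp_add, x1, x2]
    ring
  have q0 := hq 0 (fun z h1 h2 => hX z h1 (Or.inl (by
    rw [exp_neg, x0] at h2
    simpa using h2.trans (le_abs_self _))))
  have q1 := hq (Real.pi / 2) (fun z h1 h2 => hX z h1 (Or.inr (by
    rw [exp_neg, x1] at h2
    simp at h2
    simpa using h2.trans (le_abs_self _))))
  have q2 := hq Real.pi (fun z h1 h2 => hX z h1 (Or.inl (by
    rw [exp_neg, x2] at h2
    simp at h2
    rw [sub_re]
    exact le_trans (by linarith) (neg_le_abs _))))
  have q3 := hq (3 * Real.pi / 2) (fun z h1 h2 => hX z h1 (Or.inr (by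
    rw [exp_neg, x3] at h2
    simp at h2
    rw [sub_im]
    exact le_trans (by linarith) (neg_le_abs _))))
  rw [x0] at q0
  rw [x1] at q1
  rw [x2] at q2
  rw [x3] at q3
  -- Rotate the base point of the circle by `π / 4`, and cut the circle into quarters.
  have s1 : d.seg 0 (2 * Real.pi) = d.seg (0 - Real.pi / 4) (3 * Real.pi / 2 + Real.pi / 4) := by
    have h1 := hper (0 - Real.pi / 4) 0
    have h2 := hadd (0 - Real.pi / 4) 0 (0 - Real.pi / 4 + 2 * Real.pi)
    have h3 := hadd 0 (0 - Real.pi / 4 + 2 * Real.pi) (2 * Real.pi)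
    rw [zero_add] at h1
    rw [← h3, h1, add_comm, h2]
    congr 1
    ring
  have s2 := hadd (0 - Real.pi / 4) (0 + Real.pi / 4) (3 * Real.pi / 2 + Real.pi / 4)
  have s3 := hadd (Real.pi / 2 - Real.pi / 4) (Real.pi / 2 + Real.pi / 4)
    (3 * Real.pi / 2 + Real.pi / 4)
  have s4 := hadd (Real.pi - Real.pi / 4) (Real.pi + Real.pi / 4)
    (3 * Real.pi / 2 + Real.pi / 4)
  rw [show Real.pi - Real.pi / 4 = Real.pi / 2 + Real.pi / 4 by ring] at s4 q2
  rw [show Real.pi / 2 - Real.pi / 4 = 0 + Real.pi / 4 by ring] at s3 q1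
  rw [show 3 * Real.pi / 2 - Real.pi / 4 = Real.pi + Real.pi / 4 by ring] at q3
  rw [e0, s1, ← s2, ← s3, ← s4, q0, q1, q2, q3, rect]
  have c1 : p + 1 * (η * (1 - I)) = (⟨p.re + η, p.im - η⟩ : ℂ) := by
    apply Complex.ext <;> simp
    ring
  have c2 : p + 1 * (η * (1 + I)) = (⟨p.re + η, p.im + η⟩ : ℂ) := by
    apply Complex.ext <;> simp
  have c3 : p + I * (η * (1 - I)) = (⟨p.re + η, p.im + η⟩ : ℂ) := by
    apply Complex.ext <;> simp
  have c4 : p + I * (η * (1 + I)) = (⟨p.re - η, p.im + η⟩ : ℂ) := by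
    apply Complex.ext <;> simp
    ring
  have c5 : p + -1 * (η * (1 - I)) = (⟨p.re - η, p.im + η⟩ : ℂ) := by
    apply Complex.ext <;> simp
    ring
  have c6 : p + -1 * (η * (1 + I)) = (⟨p.re - η, p.im - η⟩ : ℂ) := by
    apply Complex.ext <;> simp <;> ring
  have c7 : p + -I * (η * (1 - I)) = (⟨p.re - η, p.im - η⟩ : ℂ) := by
    apply Complex.ext <;> simp <;> ring
  have c8 : p + -I * (η * (1 + I)) = (⟨p.re + η, p.im - η⟩ : ℂ) := by
    apply Complex.ext <;> simp
    ring
  rw [c1, c2, c3, c4, c5, c6, c7, c8]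
  abel

end PathCocycle

end Planar

/-! ### Cocycles in the plane: rectangles and punctures -/

section Planar

open Set Topology Filter Complex

namespace PathCocycle

variable {A : Type*} [AddCommGroup A] {X : Set ℂ} {c : PathCocycle X A}

theorem convex_reProdIm {s t : Set ℝ} (hs : Convex ℝ s) (ht : Convex ℝ t) :
    Convex ℝ (s ×ℂ t) :=
  (hs.linear_preimage reLm).inter (ht.linear_preimage imLm)

theorem rect_cut_vertical {x₀ m x₁ y₀ y₁ : ℝ} (h0 : x₀ ≤ m) (h1 : m ≤ x₁) (hy : y₀ ≤ y₁)
    (hX : ∀ z : ℂ, z ∈ Icc x₀ x₁ ×ℂ Icc y₀ y₁ → (z.im = y₀ ∨ z.im = y₁ ∨ z.re = m) → z ∈ X) :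
    c.rect x₀ x₁ y₀ y₁ = c.rect x₀ m y₀ y₁ + c.rect m x₁ y₀ y₁ := by
  have hb : Convex ℝ (Icc x₀ x₁ ×ℂ {y₀}) := convex_reProdIm (convex_Icc _ _) (convex_singleton _)
  have ht : Convex ℝ (Icc x₀ x₁ ×ℂ {y₁}) := convex_reProdIm (convex_Icc _ _) (convex_singleton _)
  have hm : Convex ℝ ({m} ×ℂ Icc y₀ y₁) := convex_reProdIm (convex_singleton _) (convex_Icc _ _)
  have hbX : Icc x₀ x₁ ×ℂ {y₀} ⊆ X := fun z hz => hX z ⟨hz.1, by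
    rw [mem_preimage, show z.im = y₀ from hz.2]; exact left_mem_Icc.mpr hy⟩ (Or.inl hz.2)
  have htX : Icc x₀ x₁ ×ℂ {y₁} ⊆ X := fun z hz => hX z ⟨hz.1, by
    rw [mem_preimage, show z.im = y₁ from hz.2]; exact right_mem_Icc.mpr hy⟩ (Or.inr (Or.inl hz.2))
  have hmX : {m} ×ℂ Icc y₀ y₁ ⊆ X := fun z hz => hX z ⟨by
    rw [mem_preimage, show z.re = m from hz.1]; exact ⟨h0, h1⟩, hz.2⟩ (Or.inr (Or.inr hz.1))
  have h01 := h0.trans h1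
  have e1 := seg_add (d := c) hb hbX (a := ⟨x₀, y₀⟩) (b := ⟨m, y₀⟩) (e := ⟨x₁, y₀⟩)
    ⟨⟨le_rfl, h01⟩, rfl⟩ ⟨⟨h0, h1⟩, rfl⟩ ⟨⟨h01, le_rfl⟩, rfl⟩
  have e2 := seg_add (d := c) ht htX (a := ⟨x₁, y₁⟩) (b := ⟨m, y₁⟩) (e := ⟨x₀, y₁⟩)
    ⟨⟨h01, le_rfl⟩, rfl⟩ ⟨⟨h0, h1⟩, rfl⟩ ⟨⟨le_rfl, h01⟩, rfl⟩
  have e3 := seg_symm (d := c) hm hmX (a := ⟨m, y₀⟩) (b := ⟨m, y₁⟩)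
    ⟨rfl, ⟨le_rfl, hy⟩⟩ ⟨rfl, ⟨hy, le_rfl⟩⟩
  rw [rect, rect, rect, ← e1, ← e2, e3]
  abel

theorem rect_cut_horizontal {x₀ x₁ y₀ m y₁ : ℝ} (h0 : y₀ ≤ m) (h1 : m ≤ y₁) (hx : x₀ ≤ x₁)
    (hX : ∀ z : ℂ, z ∈ Icc x₀ x₁ ×ℂ Icc y₀ y₁ → (z.re = x₀ ∨ z.re = x₁ ∨ z.im = m) → z ∈ X) :
    c.rect x₀ x₁ y₀ y₁ = c.rect x₀ x₁ y₀ m + c.rect x₀ x₁ m y₁ := by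
  have hb : Convex ℝ ({x₀} ×ℂ Icc y₀ y₁) := convex_reProdIm (convex_singleton _) (convex_Icc _ _)
  have ht : Convex ℝ ({x₁} ×ℂ Icc y₀ y₁) := convex_reProdIm (convex_singleton _) (convex_Icc _ _)
  have hm : Convex ℝ (Icc x₀ x₁ ×ℂ {m}) := convex_reProdIm (convex_Icc _ _) (convex_singleton _)
  have hbX : {x₀} ×ℂ Icc y₀ y₁ ⊆ X := fun z hz => hX z ⟨by
    rw [mem_preimage, show z.re = x₀ from hz.1]; exact left_mem_Icc.mpr hx, hz.2⟩ (Or.inl hz.1)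
  have htX : {x₁} ×ℂ Icc y₀ y₁ ⊆ X := fun z hz => hX z ⟨by
    rw [mem_preimage, show z.re = x₁ from hz.1]; exact right_mem_Icc.mpr hx, hz.2⟩
    (Or.inr (Or.inl hz.1))
  have hmX : Icc x₀ x₁ ×ℂ {m} ⊆ X := fun z hz => hX z ⟨hz.1, by
    rw [mem_preimage, show z.im = m from hz.2]; exact ⟨h0, h1⟩⟩ (Or.inr (Or.inr hz.2))
  have h01 := h0.trans h1
  have e1 := seg_add (d := c) hb hbX (a := ⟨x₀, y₁⟩) (b := ⟨x₀, m⟩) (e := ⟨x₀, y₀⟩)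
    ⟨rfl, ⟨h01, le_rfl⟩⟩ ⟨rfl, ⟨h0, h1⟩⟩ ⟨rfl, ⟨le_rfl, h01⟩⟩
  have e2 := seg_add (d := c) ht htX (a := ⟨x₁, y₀⟩) (b := ⟨x₁, m⟩) (e := ⟨x₁, y₁⟩)
    ⟨rfl, ⟨le_rfl, h01⟩⟩ ⟨rfl, ⟨h0, h1⟩⟩ ⟨rfl, ⟨h01, le_rfl⟩⟩
  have e3 := seg_symm (d := c) hm hmX (a := ⟨x₀, m⟩) (b := ⟨x₁, m⟩)
    ⟨⟨le_rfl, hx⟩, rfl⟩ ⟨⟨hx, le_rfl⟩, rfl⟩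
  rw [rect, rect, rect, ← e1, ← e2, e3]
  abel

/-- A rectangle without punctures. -/
theorem rect_eq_zero {x₀ x₁ y₀ y₁ : ℝ} (hx : x₀ ≤ x₁) (hy : y₀ ≤ y₁)
    (hX : Icc x₀ x₁ ×ℂ Icc y₀ y₁ ⊆ X) : c.rect x₀ x₁ y₀ y₁ = 0 := by
  have hS : Convex ℝ (Icc x₀ x₁ ×ℂ Icc y₀ y₁) := convex_reProdIm (convex_Icc _ _) (convex_Icc _ _)
  have m00 : (⟨x₀, y₀⟩ : ℂ) ∈ Icc x₀ x₁ ×ℂ Icc y₀ y₁ := ⟨⟨le_rfl, hx⟩, ⟨le_rfl, hy⟩⟩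
  have m10 : (⟨x₁, y₀⟩ : ℂ) ∈ Icc x₀ x₁ ×ℂ Icc y₀ y₁ := ⟨⟨hx, le_rfl⟩, ⟨le_rfl, hy⟩⟩
  have m11 : (⟨x₁, y₁⟩ : ℂ) ∈ Icc x₀ x₁ ×ℂ Icc y₀ y₁ := ⟨⟨hx, le_rfl⟩, ⟨hy, le_rfl⟩⟩
  have m01 : (⟨x₀, y₁⟩ : ℂ) ∈ Icc x₀ x₁ ×ℂ Icc y₀ y₁ := ⟨⟨le_rfl, hx⟩, ⟨hy, le_rfl⟩⟩
  rw [rect, seg_add hS hX m00 m10 m11, seg_add hS hX m00 m11 m01, seg_add hS hX m00 m01 m00,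
    seg_self (hX m00)]

open Classical in
/-- The sum of the values `t p` attached to the points `p ∈ P` of a region. -/
def regionSum (P : Finset ℂ) (t : ℂ → A) (R : Set ℂ) : A := ∑ p ∈ P, if p ∈ R then t p else 0

theorem regionSum_congr {P : Finset ℂ} {t : ℂ → A} {R R' : Set ℂ}
    (h : ∀ p ∈ P, p ∈ R ↔ p ∈ R') : regionSum P t R = regionSum P t R' := by
  classical
  refine Finset.sum_congr rfl fun p hp => ?_
  simp only [h p hp]

theorem regionSum_add {P : Finset ℂ} {t : ℂ → A} {R R₁ R₂ : Set ℂ}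
    (h : ∀ p ∈ P, p ∈ R ↔ p ∈ R₁ ∨ p ∈ R₂) (h' : ∀ p ∈ P, p ∈ R₁ → p ∉ R₂) :
    regionSum P t R = regionSum P t R₁ + regionSum P t R₂ := by
  classical
  unfold regionSum
  rw [← Finset.sum_add_distrib]
  refine Finset.sum_congr rfl fun p hp => ?_
  by_cases h1 : p ∈ R₁
  · simp [h p hp, h1, h' p hp h1]
  · simp [h p hp, h1]

/-- The value of a cocycle on the boundary of a rectangle is the sum of its values on small circles
around the punctures in the rectangle. A small square is cut out around one of the punctures; the
four rectangles around this square have fewer punctures. -/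
theorem rect_eq_regionSum (P : Finset ℂ) {c : PathCocycle ((P : Set ℂ)ᶜ) A} (t : ℂ → A)
    (ht : ∀ p ∈ P, ∀ᶠ r in 𝓝[>] (0 : ℝ), c.circ p r = t p) {x₀ x₁ y₀ y₁ : ℝ} (hx : x₀ ≤ x₁)
    (hy : y₀ ≤ y₁)
    (hP : ∀ p ∈ P, p ∈ Icc x₀ x₁ ×ℂ Icc y₀ y₁ → p ∈ Ioo x₀ x₁ ×ℂ Ioo y₀ y₁) :
    c.rect x₀ x₁ y₀ y₁ = regionSum P t (Ioo x₀ x₁ ×ℂ Ioo y₀ y₁) := by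
  classical
  induction hk : (P.filter (· ∈ Ioo x₀ x₁ ×ℂ Ioo y₀ y₁)).card using Nat.strong_induction_on
    generalizing x₀ x₁ y₀ y₁ with
  | _ k ih =>
  by_cases hne : ∃ p ∈ P, p ∈ Ioo x₀ x₁ ×ℂ Ioo y₀ y₁
  swap
  · push Not at hne
    rw [rect_eq_zero hx hy fun z hz hzP => hne z hzP (hP z hzP hz)]
    exact (Finset.sum_eq_zero fun p hp => if_neg (hne p hp)).symm
  obtain ⟨p, hpP, ⟨hp1, hp2⟩, ⟨hp3, hp4⟩⟩ := hne
  have hlin : Tendsto (fun η : ℝ => η * √2) (𝓝[>] 0) (𝓝[>] 0) := by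
    refine tendsto_nhdsWithin_iff.mpr ⟨?_, ?_⟩
    · refine tendsto_nhdsWithin_of_tendsto_nhds ?_
      have : Continuous fun η : ℝ => η * √2 := by fun_prop
      simpa using this.tendsto 0
    · filter_upwards [self_mem_nhdsWithin] with η hη
      exact mul_pos (mem_Ioi.mp hη) (by positivity)
  have hsm : ∀ ε : ℝ, 0 < ε → ∀ᶠ η in 𝓝[>] (0 : ℝ), η * √2 < ε := fun ε hε =>
    hlin.eventually (Ioo_mem_nhdsGT hε) |>.mono fun η h => h.2
  have hsm' : ∀ ε : ℝ, 0 < ε → ∀ᶠ η in 𝓝[>] (0 : ℝ), η < ε := fun ε hε =>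
    eventually_of_mem (Ioo_mem_nhdsGT hε) fun η h => h.2
  have hsep : ∀ᶠ η in 𝓝[>] (0 : ℝ), ∀ z ∈ P, z ≠ p → η * √2 < ‖z - p‖ := by
    rw [Filter.eventually_all_finset]
    intro z _
    by_cases hz : z = p
    · simp [hz]
    · filter_upwards [hsm ‖z - p‖ (norm_pos_iff.mpr (sub_ne_zero.mpr hz))] with η h _ using h
  -- for all but finitely many sizes of the square, the lines that extend its sides avoid `P`
  have hgen : ∀ᶠ η in 𝓝[>] (0 : ℝ), ∀ z ∈ P, |z.re - p.re| ≠ η ∧ |z.im - p.im| ≠ η := by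
    rw [Filter.eventually_all_finset]
    intro z _
    have : ∀ a : ℝ, 0 ≤ a → ∀ᶠ η in 𝓝[>] (0 : ℝ), a ≠ η := fun a ha => by
      rcases ha.eq_or_lt with rfl | ha
      · filter_upwards [self_mem_nhdsWithin] with η hη using (ne_of_gt hη).symm
      · filter_upwards [hsm' a ha] with η h using ne_of_gt h
    exact (this _ (abs_nonneg _)).and (this _ (abs_nonneg _))
  obtain ⟨η, hη, hcirc, hsep, hgen, h1, h2, h3, h4⟩ := (eventually_mem_nhdsWithin.and
    ((hlin.eventually (ht p hpP)).and (hsep.and (hgen.and ((hsm' _ (sub_pos.mpr hp1)).and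
    ((hsm' _ (sub_pos.mpr hp2)).and ((hsm' _ (sub_pos.mpr hp3)).and
    (hsm' _ (sub_pos.mpr hp4))))))))).exists
  change 0 < η at hη
  have g : ∀ z ∈ P, z.re ≠ p.re - η ∧ z.re ≠ p.re + η ∧ z.im ≠ p.im - η ∧ z.im ≠ p.im + η := by
    intro z hz
    obtain ⟨ha, hb⟩ := hgen z hz
    refine ⟨fun h => ha ?_, fun h => ha ?_, fun h => hb ?_, fun h => hb ?_⟩ <;> rw [h]
    · simp [abs_of_pos hη]
    · simp [abs_of_pos hη]
    · simp [abs_of_pos hη]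
    · simp [abs_of_pos hη]
  -- no puncture lies on the boundary of the large rectangle or on one of the four cuts
  have hbd : ∀ z ∈ P, z ∈ Icc x₀ x₁ ×ℂ Icc y₀ y₁ →
      z.re ≠ x₀ ∧ z.re ≠ x₁ ∧ z.im ≠ y₀ ∧ z.im ≠ y₁ := fun z hz hzR => by
    obtain ⟨⟨a1, a2⟩, ⟨a3, a4⟩⟩ := hP z hz hzR
    exact ⟨a1.ne', a2.ne, a3.ne', a4.ne⟩
  have hsub : ∀ a b d e : ℝ, x₀ ≤ a → a ≤ b → b ≤ x₁ → y₀ ≤ d → d ≤ e → e ≤ y₁ →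
      (a = x₀ ∨ a = p.re - η ∨ a = p.re + η) → (b = x₁ ∨ b = p.re - η ∨ b = p.re + η) →
      (d = y₀ ∨ d = p.im - η ∨ d = p.im + η) → (e = y₁ ∨ e = p.im - η ∨ e = p.im + η) →
      p ∉ Ioo a b ×ℂ Ioo d e →
      c.rect a b d e = regionSum P t (Ioo a b ×ℂ Ioo d e) := by
    intro a b d e ha hab hb hd hde he ca cb cd ce hp
    refine ih _ ?_ hab hde ?_ rfl
    · rw [← hk]
      refine Finset.card_lt_card (Finset.ssubset_iff_of_subset ?_ |>.mpr
        ⟨p, Finset.mem_filter.mpr ⟨hpP, ⟨hp1, hp2⟩, ⟨hp3, hp4⟩⟩, fun h =>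
          hp (Finset.mem_filter.mp h).2⟩)
      intro z hz
      obtain ⟨hzP, ⟨a1, a2⟩, ⟨a3, a4⟩⟩ := Finset.mem_filter.mp hz
      exact Finset.mem_filter.mpr ⟨hzP, ⟨ha.trans_lt a1, a2.trans_le hb⟩,
        ⟨hd.trans_lt a3, a4.trans_le he⟩⟩
    · rintro z hz ⟨⟨a1, a2⟩, ⟨a3, a4⟩⟩
      obtain ⟨g1, g2, g3, g4⟩ := g z hz
      obtain ⟨b1, b2, b3, b4⟩ := hbd z hz ⟨⟨ha.trans a1, a2.trans hb⟩, ⟨hd.trans a3, a4.trans he⟩⟩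
      refine ⟨⟨lt_of_le_of_ne a1 ?_, lt_of_le_of_ne a2 ?_⟩,
        ⟨lt_of_le_of_ne a3 ?_, lt_of_le_of_ne a4 ?_⟩⟩
      · rcases ca with rfl | rfl | rfl
        exacts [b1.symm, g1.symm, g2.symm]
      · rcases cb with rfl | rfl | rfl
        exacts [b2, g1, g2]
      · rcases cd with rfl | rfl | rfl
        exacts [b3.symm, g3.symm, g4.symm]
      · rcases ce with rfl | rfl | rfl
        exacts [b4, g3, g4]
  have hsq : c.rect (p.re - η) (p.re + η) (p.im - η) (p.im + η) =
      regionSum P t (Ioo (p.re - η) (p.re + η) ×ℂ Ioo (p.im - η) (p.im + η)) := by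
    rw [← circ_eq_rect hη, hcirc, regionSum, Finset.sum_eq_single_of_mem p hpP]
    · rw [if_pos]
      exact ⟨⟨by linarith, by linarith⟩, ⟨by linarith, by linarith⟩⟩
    · rintro z hz hzp
      rw [if_neg]
      rintro ⟨⟨a1, a2⟩, ⟨a3, a4⟩⟩
      have hlt := hsep z hz hzp
      refine absurd hlt (not_lt.mpr ?_)
      have b1 : |(z - p).re| ≤ η := by rw [sub_re, abs_le]; constructor <;> linarith
      have b2 : |(z - p).im| ≤ η := by rw [sub_im, abs_le]; constructor <;> linarith
      rw [mul_comm]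
      exact (norm_le_sqrt_two_mul_max (z - p)).trans
        (mul_le_mul_of_nonneg_left (max_le b1 b2) (Real.sqrt_nonneg 2))
    · rintro z hz hzc hzP
      by_cases hzp : z = p
      · subst hzp
        simp at hzc
        linarith
      · exact absurd (hsep z hzP hzp) (not_lt.mpr hz)
  have q : ∀ {a b d e : ℝ} {z : ℂ}, z ∈ Ioo a b ×ℂ Ioo d e ↔
      (a < z.re ∧ z.re < b) ∧ (d < z.im ∧ z.im < e) := Iff.rfl
  have q' : ∀ {a b d e : ℝ} {z : ℂ}, z ∈ Icc a b ×ℂ Icc d e ↔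
      (a ≤ z.re ∧ z.re ≤ b) ∧ (d ≤ z.im ∧ z.im ≤ e) := Iff.rfl
  -- the cuts
  have k1 : c.rect x₀ x₁ y₀ y₁ = _ := rect_cut_vertical (m := p.re - η) (by linarith)
    (by linarith) hy fun z hz hz' hzP => by
      have := hbd z hzP hz
      have := g z hzP
      tauto
  have k2 : c.rect (p.re - η) x₁ y₀ y₁ = _ := rect_cut_vertical (m := p.re + η) (by linarith)
    (by linarith) hy fun z hz hz' hzP => by
      have := hbd z hzP ⟨⟨by linarith [(q'.mp hz).1.1], hz.1.2⟩, hz.2⟩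
      have := g z hzP
      tauto
  have k3 : c.rect (p.re - η) (p.re + η) y₀ y₁ = _ := rect_cut_horizontal (m := p.im - η)
    (by linarith) (by linarith) (by linarith) fun z hz hz' hzP => by
      have := g z hzP
      tauto
  have k4 : c.rect (p.re - η) (p.re + η) (p.im - η) y₁ = _ :=
    rect_cut_horizontal (m := p.im + η) (by linarith) (by linarith) (by linarith)
      fun z hz hz' hzP => by
        have := g z hzP
        tauto
  rw [k1, k2, k3, k4, hsq,
    hsub x₀ (p.re - η) y₀ y₁ le_rfl (by linarith) (by linarith) le_rfl hy le_rfl (by simp) (by simp)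
      (by simp) (by simp) (fun h => by linarith [(q.mp h).1.2]),
    hsub (p.re + η) x₁ y₀ y₁ (by linarith) (by linarith) le_rfl le_rfl hy le_rfl (by simp) (by simp)
      (by simp) (by simp) (fun h => by linarith [(q.mp h).1.1]),
    hsub (p.re - η) (p.re + η) y₀ (p.im - η) (by linarith) (by linarith) (by linarith) le_rfl
      (by linarith) (by linarith) (by simp) (by simp) (by simp) (by simp)
      (fun h => by linarith [(q.mp h).2.2]),
    hsub (p.re - η) (p.re + η) (p.im + η) y₁ (by linarith) (by linarith) (by linarith)
      (by linarith) (by linarith) le_rfl (by simp) (by simp) (by simp) (by simp)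
      (fun h => by linarith [(q.mp h).2.1])]
  symm
  rw [regionSum_add (R₁ := Ioo x₀ (p.re - η) ×ℂ Ioo y₀ y₁) (R₂ := Ioo (p.re - η) x₁ ×ℂ Ioo y₀ y₁),
    regionSum_add (R := Ioo (p.re - η) x₁ ×ℂ Ioo y₀ y₁)
      (R₁ := Ioo (p.re - η) (p.re + η) ×ℂ Ioo y₀ y₁) (R₂ := Ioo (p.re + η) x₁ ×ℂ Ioo y₀ y₁),
    regionSum_add (R := Ioo (p.re - η) (p.re + η) ×ℂ Ioo y₀ y₁)
      (R₁ := Ioo (p.re - η) (p.re + η) ×ℂ Ioo y₀ (p.im - η))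
      (R₂ := Ioo (p.re - η) (p.re + η) ×ℂ Ioo (p.im - η) y₁),
    regionSum_add (R := Ioo (p.re - η) (p.re + η) ×ℂ Ioo (p.im - η) y₁)
      (R₁ := Ioo (p.re - η) (p.re + η) ×ℂ Ioo (p.im - η) (p.im + η))
      (R₂ := Ioo (p.re - η) (p.re + η) ×ℂ Ioo (p.im + η) y₁)]
  all_goals
    intro z hz
    obtain ⟨g1, g2, g3, g4⟩ := g z hz
    simp only [q]
  · constructor
    · rintro ⟨⟨a1, a2⟩, a3, a4⟩
      rcases lt_or_gt_of_ne g4 with h | h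
      · exact Or.inl ⟨⟨a1, a2⟩, a3, h⟩
      · exact Or.inr ⟨⟨a1, a2⟩, h, a4⟩
    · rintro (⟨⟨a1, a2⟩, a3, a4⟩ | ⟨⟨a1, a2⟩, a3, a4⟩)
      · exact ⟨⟨a1, a2⟩, a3, by linarith⟩
      · exact ⟨⟨a1, a2⟩, by linarith, a4⟩
  · rintro ⟨⟨a1, a2⟩, a3, a4⟩ ⟨⟨b1, b2⟩, b3, b4⟩
    linarith
  · constructor
    · rintro ⟨⟨a1, a2⟩, a3, a4⟩
      rcases lt_or_gt_of_ne g3 with h | h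
      · exact Or.inl ⟨⟨a1, a2⟩, a3, h⟩
      · exact Or.inr ⟨⟨a1, a2⟩, h, a4⟩
    · rintro (⟨⟨a1, a2⟩, a3, a4⟩ | ⟨⟨a1, a2⟩, a3, a4⟩)
      · exact ⟨⟨a1, a2⟩, a3, by linarith⟩
      · exact ⟨⟨a1, a2⟩, by linarith, a4⟩
  · rintro ⟨⟨a1, a2⟩, a3, a4⟩ ⟨⟨b1, b2⟩, b3, b4⟩
    linarith
  · constructor
    · rintro ⟨⟨a1, a2⟩, a3, a4⟩
      rcases lt_or_gt_of_ne g2 with h | h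
      · exact Or.inl ⟨⟨a1, h⟩, a3, a4⟩
      · exact Or.inr ⟨⟨h, a2⟩, a3, a4⟩
    · rintro (⟨⟨a1, a2⟩, a3, a4⟩ | ⟨⟨a1, a2⟩, a3, a4⟩)
      · exact ⟨⟨a1, by linarith⟩, a3, a4⟩
      · exact ⟨⟨by linarith, a2⟩, a3, a4⟩
  · rintro ⟨⟨a1, a2⟩, a3, a4⟩ ⟨⟨b1, b2⟩, b3, b4⟩
    linarith
  · constructor
    · rintro ⟨⟨a1, a2⟩, a3, a4⟩
      rcases lt_or_gt_of_ne g1 with h | h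
      · exact Or.inl ⟨⟨a1, h⟩, a3, a4⟩
      · exact Or.inr ⟨⟨h, a2⟩, a3, a4⟩
    · rintro (⟨⟨a1, a2⟩, a3, a4⟩ | ⟨⟨a1, a2⟩, a3, a4⟩)
      · exact ⟨⟨a1, by linarith⟩, a3, a4⟩
      · exact ⟨⟨by linarith, a2⟩, a3, a4⟩
  · rintro ⟨⟨a1, a2⟩, a3, a4⟩ ⟨⟨b1, b2⟩, b3, b4⟩
    linarith

/-- The value of a cocycle on a circle is the sum of its values on small circles around the
punctures inside, if these lie close to the center: the circle can be replaced by the inscribed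
square. -/
theorem circ_eq_regionSum (P : Finset ℂ) {c : PathCocycle ((P : Set ℂ)ᶜ) A} (t : ℂ → A)
    (ht : ∀ p ∈ P, ∀ᶠ r in 𝓝[>] (0 : ℝ), c.circ p r = t p) {a : ℂ} {R : ℝ} (hR : 0 < R)
    (hP : ∀ p ∈ P, ‖p - a‖ ≤ R → ‖p - a‖ < R / 4) :
    c.circ a R = regionSum P t (Metric.ball a R) := by
  set η := R / √2 with hη
  have h2 : 0 < √2 := by positivity
  have hηp : 0 < η := by positivity
  have hηR : η * √2 = R := div_mul_cancel₀ R h2.ne'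
  have hη4 : R / 4 < η := by
    have : √2 < 2 := by
      rw [Real.sqrt_lt' (by norm_num)]
      norm_num
    nlinarith
  have hball : ∀ z : ℂ, z ∈ Icc (a.re - η) (a.re + η) ×ℂ Icc (a.im - η) (a.im + η) →
      ‖z - a‖ ≤ R := by
    rintro z ⟨⟨a1, a2⟩, ⟨a3, a4⟩⟩
    have b1 : |(z - a).re| ≤ η := by rw [sub_re, abs_le]; constructor <;> linarith
    have b2 : |(z - a).im| ≤ η := by rw [sub_im, abs_le]; constructor <;> linarith
    rw [← hηR, mul_comm]
    exact (norm_le_sqrt_two_mul_max (z - a)).trans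
      (mul_le_mul_of_nonneg_left (max_le b1 b2) h2.le)
  have hin : ∀ z : ℂ, ‖z - a‖ < R / 4 →
      z ∈ Ioo (a.re - η) (a.re + η) ×ℂ Ioo (a.im - η) (a.im + η) := by
    intro z hz
    have b1 := abs_lt.mp ((abs_re_le_norm (z - a)).trans_lt (hz.trans hη4))
    have b2 := abs_lt.mp ((abs_im_le_norm (z - a)).trans_lt (hz.trans hη4))
    rw [sub_re] at b1
    rw [sub_im] at b2
    exact ⟨⟨by linarith [b1.1], by linarith [b1.2]⟩, ⟨by linarith [b2.1], by linarith [b2.2]⟩⟩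
  have hIoo : ∀ z : ℂ, z ∈ Ioo (a.re - η) (a.re + η) ×ℂ Ioo (a.im - η) (a.im + η) →
      z ∈ Icc (a.re - η) (a.re + η) ×ℂ Icc (a.im - η) (a.im + η) := fun z hz =>
    ⟨Ioo_subset_Icc_self hz.1, Ioo_subset_Icc_self hz.2⟩
  rw [← hηR, circ_eq_rect hηp, rect_eq_regionSum P t ht (by linarith) (by linarith), hηR]
  · refine regionSum_congr fun p hp => ?_
    rw [Metric.mem_ball, dist_eq]
    refine ⟨fun h => ?_, fun h => hin p (hP p hp h.le)⟩
    exact (hP p hp (hball p (hIoo p h))).trans (by linarith)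
  · exact fun p hp h => hin p (hP p hp (hball p h))
  · intro z hz hz' hzP
    rw [hηR] at hz
    have h4 := hP z hzP hz
    rcases hz' with h | h
    · linarith [abs_re_le_norm (z - a)]
    · linarith [abs_im_le_norm (z - a)]

end PathCocycle

end Planar

/-! ### Homographies and charts of the projective line -/

section ProjectiveLine

open Set Topology Filter Complex OnePoint

/-- The matrix of `z ↦ 1 / z`. -/
def swapGL : GL (Fin 2) ℂ := Matrix.GeneralLinearGroup.mkOfDetNeZero !![0, 1; 1, 0] (by simp)

/-- The matrix of `z ↦ z + a`. -/
def translGL (a : ℂ) : GL (Fin 2) ℂ :=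
  Matrix.GeneralLinearGroup.mkOfDetNeZero !![1, a; 0, 1] (by simp)

theorem swapGL_mul_self : swapGL * swapGL = 1 := by
  apply Units.ext
  change !![(0 : ℂ), 1; 1, 0] * !![0, 1; 1, 0] = 1
  simp [Matrix.one_fin_two]

theorem swapGL_smul_swapGL_smul (z : OnePoint ℂ) : swapGL • swapGL • z = z := by
  rw [← mul_smul, swapGL_mul_self, one_smul]

theorem swapGL_smul_coe (w : ℂ) :
    swapGL • (w : OnePoint ℂ) = if w = 0 then ∞ else ((w⁻¹ : ℂ) : OnePoint ℂ) := by
  rw [smul_some_eq_ite]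
  simp [swapGL]

theorem swapGL_smul_zero : swapGL • ((0 : ℂ) : OnePoint ℂ) = ∞ := by
  rw [swapGL_smul_coe, if_pos rfl]

theorem swapGL_smul_infty : swapGL • (∞ : OnePoint ℂ) = ((0 : ℂ) : OnePoint ℂ) := by
  rw [← swapGL_smul_zero, swapGL_smul_swapGL_smul]

theorem translGL_smul_coe (a w : ℂ) :
    translGL a • (w : OnePoint ℂ) = ((w + a : ℂ) : OnePoint ℂ) := by
  rw [smul_some_eq_ite]
  simp [translGL]

theorem continuous_swapGL_smul : Continuous fun z : OnePoint ℂ => swapGL • z := by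
  rw [continuous_iff_continuousAt]
  intro z
  induction z using OnePoint.rec with
  | infty =>
    rw [continuousAt_infty', swapGL_smul_infty, coclosedCompact_eq_cocompact,
      ← Metric.cobounded_eq_cocompact]
    refine Tendsto.congr' (f₁ := fun w : ℂ => ((w⁻¹ : ℂ) : OnePoint ℂ)) ?_
      ((continuous_coe.tendsto 0).comp tendsto_inv₀_cobounded)
    filter_upwards [Bornology.eventually_ne_cobounded (0 : ℂ)] with w hw
    simp [swapGL_smul_coe, hw]
  | coe z =>
    rw [continuousAt_coe]
    by_cases hz : z = 0
    · subst hz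
      rw [continuousAt_iff_punctured_nhds]
      simp only [Function.comp, swapGL_smul_zero]
      refine Tendsto.congr' (f₁ := fun w : ℂ => ((w⁻¹ : ℂ) : OnePoint ℂ)) ?_ ?_
      · filter_upwards [self_mem_nhdsWithin] with w hw
        exact ((swapGL_smul_coe w).trans (if_neg hw)).symm
      · refine Tendsto.comp (y := coclosedCompact ℂ) tendsto_coe_infty ?_
        rw [coclosedCompact_eq_cocompact,
          ← Metric.cobounded_eq_cocompact]
        exact tendsto_inv₀_nhdsNE_zero
    · refine ContinuousAt.congr (f := fun w : ℂ => ((w⁻¹ : ℂ) : OnePoint ℂ)) ?_ ?_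
      · exact continuous_coe.continuousAt.comp (continuousAt_inv₀ hz)
      · filter_upwards [isOpen_ne.mem_nhds hz] with w hw
        rw [Function.comp, swapGL_smul_coe, if_neg hw]

theorem continuousAt_gl_smul_coe (M : GL (Fin 2) ℂ) {z : ℂ} (hz : M 1 0 * z + M 1 1 ≠ 0) :
    ContinuousAt (fun z : OnePoint ℂ => M • z) z := by
  rw [continuousAt_coe]
  refine ContinuousAt.congr
    (f := fun w : ℂ => (((M 0 0 * w + M 0 1) / (M 1 0 * w + M 1 1) : ℂ) : OnePoint ℂ)) ?_ ?_
  · refine continuous_coe.continuousAt.comp (ContinuousAt.div ?_ ?_ hz) <;> fun_prop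
  · have : ContinuousAt (fun w : ℂ => M 1 0 * w + M 1 1) z := by fun_prop
    filter_upwards [this.eventually_ne hz] with w hw
    rw [Function.comp, smul_some_eq_ite, if_neg hw]

/-- Homographies are continuous: at a pole and at `∞`, compose with `z ↦ 1 / z`. -/
theorem continuous_gl_smul (M : GL (Fin 2) ℂ) : Continuous fun z : OnePoint ℂ => M • z := by
  have hfin : ∀ (M : GL (Fin 2) ℂ) (z : ℂ), ContinuousAt (fun z : OnePoint ℂ => M • z) z := by
    intro M z
    by_cases hz : M 1 0 * z + M 1 1 = 0
    · have hz' : (swapGL * M) 1 0 * z + (swapGL * M) 1 1 ≠ 0 := by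
        have e0 : (swapGL * M) 1 0 = M 0 0 := by
          rw [Matrix.GeneralLinearGroup.coe_mul, Matrix.mul_apply]
          simp [swapGL]
        have e1 : (swapGL * M) 1 1 = M 0 1 := by
          rw [Matrix.GeneralLinearGroup.coe_mul, Matrix.mul_apply]
          simp [swapGL]
        rw [e0, e1]
        intro h
        refine M.det_ne_zero ?_
        rw [Matrix.det_fin_two]
        by_cases hz0 : M 1 0 = 0
        · rw [hz0, zero_mul, zero_add] at hz
          rw [hz0, hz]
          ring
        · linear_combination (-M 0 0) * hz * (-1) - M 1 0 * h
      have h := (continuous_swapGL_smul.continuousAt (x := (swapGL * M) • (z : OnePoint ℂ))).comp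
        (continuousAt_gl_smul_coe (swapGL * M) hz')
      refine h.congr (Eventually.of_forall fun w => ?_)
      simp only [Function.comp, mul_smul, swapGL_smul_swapGL_smul]
    · exact continuousAt_gl_smul_coe M hz
  rw [continuous_iff_continuousAt]
  intro z
  induction z using OnePoint.rec with
  | infty =>
    have h1 := hfin (M * swapGL) 0
    rw [← swapGL_smul_infty] at h1
    refine (h1.comp continuous_swapGL_smul.continuousAt).congr (Eventually.of_forall fun w => ?_)
    simp only [Function.comp, mul_smul, swapGL_smul_swapGL_smul]
  | coe z => exact hfin M z

/-- The coordinate `w ↦ M • w` on the complement of `M • ∞` in the projective line. -/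
def chart (M : GL (Fin 2) ℂ) (w : ℂ) : OnePoint ℂ := M • (w : OnePoint ℂ)

theorem continuous_chart (M : GL (Fin 2) ℂ) : Continuous (chart M) :=
  (continuous_gl_smul M).comp continuous_coe

theorem chart_injective (M : GL (Fin 2) ℂ) : Function.Injective (chart M) :=
  (MulAction.injective M).comp coe_injective

theorem chart_mul (M N : GL (Fin 2) ℂ) (w : ℂ) : chart (M * N) w = M • chart N w :=
  mul_smul _ _ _

theorem isOpenMap_chart (M : GL (Fin 2) ℂ) : IsOpenMap (chart M) := by
  have : IsOpenMap fun z : OnePoint ℂ => M • z := by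
    intro s hs
    have : (fun z : OnePoint ℂ => M • z) '' s = (fun z : OnePoint ℂ => M⁻¹ • z) ⁻¹' s := by
      ext z
      constructor
      · rintro ⟨w, hw, rfl⟩
        simpa using hw
      · intro hz
        exact ⟨M⁻¹ • z, hz, by simp⟩
    rw [this]
    exact hs.preimage (continuous_gl_smul M⁻¹)
  exact this.comp isOpenMap_coe

theorem exists_chart_eq {M : GL (Fin 2) ℂ} {z : OnePoint ℂ} (hz : z ≠ M • (∞ : OnePoint ℂ)) :
    ∃ w, chart M w = z := by
  have : M⁻¹ • z ≠ ∞ := fun h => hz (by rw [← h, smul_inv_smul])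
  obtain ⟨w, hw⟩ := ne_infty_iff_exists.mp this
  exact ⟨w, by rw [chart, hw, smul_inv_smul]⟩

/-- The chart centered at `p` whose inverse is the coordinate `localCoord p`. -/
def localChart (p : OnePoint ℂ) : GL (Fin 2) ℂ := p.elim swapGL fun a => translGL a

theorem chart_localChart_zero (p : OnePoint ℂ) : chart (localChart p) 0 = p := by
  induction p using OnePoint.rec with
  | infty => exact swapGL_smul_zero
  | coe a =>
    change translGL a • ((0 : ℂ) : OnePoint ℂ) = a
    rw [translGL_smul_coe, zero_add]

theorem localCoord_chart_localChart (p : OnePoint ℂ) (w : ℂ) :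
    localCoord p (chart (localChart p) w) = w := by
  induction p using OnePoint.rec with
  | infty =>
    change (swapGL • (w : OnePoint ℂ)).elim 0 (fun b => b⁻¹) = w
    rw [swapGL_smul_coe]
    split_ifs with h
    · rw [elim_infty, h]
    · rw [elim_some, inv_inv]
  | coe a =>
    change (translGL a • (w : OnePoint ℂ)).elim 0 (fun b => b - a) = w
    rw [translGL_smul_coe, elim_some, add_sub_cancel_right]

/-- Paths in the projective line avoiding a finite set: choose a chart containing both ends. -/
theorem joinedIn_compl_of_finite {F : Set (OnePoint ℂ)} (hF : F.Finite) {x y : OnePoint ℂ}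
    (hx : x ∉ F) (hy : y ∉ F) : JoinedIn Fᶜ x y := by
  obtain ⟨m, hm⟩ := (Set.toFinite {x, y}).infinite_compl.nonempty
  rw [mem_compl_iff, mem_insert_iff, mem_singleton_iff, not_or] at hm
  set M := localChart m * swapGL with hM
  have hMi : M • (∞ : OnePoint ℂ) = m := by
    rw [hM, mul_smul, swapGL_smul_infty]
    exact chart_localChart_zero m
  obtain ⟨a, rfl⟩ := exists_chart_eq (M := M) (z := x) (by rw [hMi]; exact Ne.symm hm.1)
  obtain ⟨b, rfl⟩ := exists_chart_eq (M := M) (z := y) (by rw [hMi]; exact Ne.symm hm.2)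
  have hc : (chart M ⁻¹' F).Countable :=
    (hF.preimage (chart_injective M).injOn).countable
  have h := (hc.isPathConnected_compl_of_one_lt_rank (by
    rw [Complex.rank_real_complex]; exact Nat.one_lt_ofNat)).joinedIn a hx b hy
  obtain ⟨γ, hγ⟩ := h
  exact ⟨γ.map (continuous_chart M), fun t => hγ t⟩

/-- `SU₂` acts transitively on the projective line. -/
theorem exists_SU2_smul_zero (p : OnePoint ℂ) : ∃ U ∈ SU2, chart U 0 = p := by
  induction p using OnePoint.rec with
  | infty =>
    refine ⟨Matrix.GeneralLinearGroup.mkOfDetNeZero !![0, 1; -1, 0] (by simp), ?_, ?_⟩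
    · change !![(0 : ℂ), 1; -1, 0] ∈ Matrix.specialUnitaryGroup (Fin 2) ℂ
      rw [Matrix.mem_specialUnitaryGroup_iff, Matrix.mem_unitaryGroup_iff]
      constructor
      · rw [Matrix.star_eq_conjTranspose]
        ext i j
        fin_cases i <;> fin_cases j <;> simp [Matrix.mul_apply]
      · simp
    · rw [chart, smul_some_eq_ite]
      simp
  | coe z =>
    set s : ℝ := (√(1 + normSq z))⁻¹ with hs
    have hpos : 0 < 1 + normSq z := by linarith [normSq_nonneg z]
    have hs0 : (s : ℂ) ≠ 0 := by
      rw [hs]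
      have : √(1 + normSq z) ≠ 0 := (Real.sqrt_pos.mpr hpos).ne'
      exact_mod_cast inv_ne_zero this
    have hss : (s : ℂ) * s * (1 + z * (starRingEnd ℂ) z) = 1 := by
      rw [mul_conj]
      have : s * s * (1 + normSq z) = 1 := by
        rw [hs, ← mul_inv, Real.mul_self_sqrt hpos.le, inv_mul_cancel₀ hpos.ne']
      exact_mod_cast this
    have hdet : (!![(s : ℂ), s * z; -(s * (starRingEnd ℂ) z), s]).det = 1 := by
      rw [Matrix.det_fin_two_of]
      linear_combination hss
    refine ⟨Matrix.GeneralLinearGroup.mkOfDetNeZero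
      !![(s : ℂ), s * z; -(s * (starRingEnd ℂ) z), s] (by rw [hdet]; exact one_ne_zero), ?_, ?_⟩
    · change !![(s : ℂ), s * z; -(s * (starRingEnd ℂ) z), s] ∈
        Matrix.specialUnitaryGroup (Fin 2) ℂ
      rw [Matrix.mem_specialUnitaryGroup_iff, Matrix.mem_unitaryGroup_iff]
      refine ⟨?_, hdet⟩
      rw [Matrix.star_eq_conjTranspose]
      ext i j
      fin_cases i <;> fin_cases j <;> simp [Matrix.mul_apply]
      · linear_combination hss
      · ring
      · ring
      · linear_combination hss
    · rw [chart, smul_some_eq_ite]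
      simp [hs0]

/-- The elements of `SU₂` fixing `0` act as rotations. -/
theorem exists_rotation_of_fixes_zero {B : GL (Fin 2) ℂ} (hB : B ∈ SU2)
    (h0 : B • ((0 : ℂ) : OnePoint ℂ) = ((0 : ℂ) : OnePoint ℂ)) :
    ∃ ζ : ℂ, ‖ζ‖ = 1 ∧ ∀ w : ℂ, B • (w : OnePoint ℂ) = ((ζ * w : ℂ) : OnePoint ℂ) := by
  have hU : star (B : Matrix (Fin 2) (Fin 2) ℂ) * (B : Matrix (Fin 2) (Fin 2) ℂ) = 1 :=
    Matrix.mem_unitaryGroup_iff'.mp (Matrix.mem_specialUnitaryGroup_iff.mp hB).1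
  rw [Matrix.star_eq_conjTranspose] at hU
  rw [smul_some_eq_ite, mul_zero, zero_add, mul_zero, zero_add] at h0
  have h11 : B 1 1 ≠ 0 := fun h => by
    rw [if_pos h] at h0
    exact infty_ne_coe _ h0
  rw [if_neg h11] at h0
  have h01 : B 0 1 = 0 := by
    have := coe_injective h0
    simpa [h11] using this
  have e1 := congrFun (congrFun hU 0) 1
  have e2 := congrFun (congrFun hU 1) 1
  have e3 := congrFun (congrFun hU 0) 0
  simp only [Matrix.mul_apply, Fin.sum_univ_two, Matrix.conjTranspose_apply, h01, mul_zero,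
    star_zero, zero_add, Matrix.one_apply_eq] at e1 e2 e3
  have h10 : B 1 0 = 0 := by
    have : star (B 1 0) * B 1 1 = 0 := by simpa using e1
    simpa [h11] using this
  simp only [h10, mul_zero, add_zero] at e3
  have n : ∀ z : ℂ, star z * z = 1 → ‖z‖ = 1 := fun z hz => by
    have := congrArg norm hz
    rw [norm_mul, norm_star, norm_one] at this
    nlinarith [norm_nonneg z]
  refine ⟨B 0 0 / B 1 1, ?_, fun w => ?_⟩
  · rw [norm_div, n _ e2, n _ e3, div_one]
  · rw [smul_some_eq_ite, h10, h01, zero_mul, zero_add, if_neg h11, add_zero, div_mul_eq_mul_div]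

theorem finite_fixedPoints {M : GL (Fin 2) ℂ} (hM : ∃ z : OnePoint ℂ, M • z ≠ z) :
    {z : OnePoint ℂ | M • z = z}.Finite := by
  have hne : M.fixpointPolynomial ≠ 0 := by
    intro h
    rw [Matrix.GeneralLinearGroup.fixpointPolynomial_eq_zero_iff] at h
    obtain ⟨a, ha⟩ := h
    have h00 : M 0 0 = a := by rw [← ha]; simp
    have h11 : M 1 1 = a := by rw [← ha]; simp
    have h01 : M 0 1 = 0 := by rw [← ha]; simp
    have h10 : M 1 0 = 0 := by rw [← ha]; simp
    have ha0 : a ≠ 0 := by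
      rintro rfl
      apply M.det_ne_zero
      rw [Matrix.det_fin_two, h00, h01, zero_mul, zero_mul, sub_zero]
    obtain ⟨z, hz⟩ := hM
    apply hz
    induction z using OnePoint.rec with
    | infty => rw [smul_infty_eq_ite, if_pos h10]
    | coe z =>
      rw [smul_some_eq_ite, h00, h11, h01, h10, zero_mul, zero_add, if_neg ha0, add_zero,
        mul_div_cancel_left₀ _ ha0]
  have hroots := M.fixpointPolynomial.rootSet_finite ℂ
  refine ((hroots.image ((↑) : ℂ → OnePoint ℂ)).union (finite_singleton ∞)).subset ?_
  intro z hz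
  induction z using OnePoint.rec with
  | infty => exact Or.inr rfl
  | coe z =>
    refine Or.inl ⟨z, ?_, rfl⟩
    rw [Polynomial.mem_rootSet]
    exact ⟨hne, Matrix.GeneralLinearGroup.fixpointPolynomial_aeval_eq_zero_iff.mpr hz⟩

end ProjectiveLine

/-! ### The cocycle defined by a homomorphism from the fundamental group -/

section FundamentalCocycle

open Set Topology Filter

variable {V : Type*} [TopologicalSpace V] {X : Set V}

/-- A map that is continuous on `[0, 1]` with values in `X` there, seen as a path in `X`. -/
def pathOf (f : ℝ → V) (hc : ContinuousOn f (Icc 0 1)) (hm : MapsTo f (Icc 0 1) X)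
    {x y : X} (hx : f 0 = x) (hy : f 1 = y) : Path x y where
  toFun t := ⟨f t, hm t.2⟩
  continuous_toFun := (continuousOn_iff_continuous_domRestrict.mp hc).subtype_mk _
  source' := Subtype.ext hx
  target' := Subtype.ext hy

variable {q : X} (b : ∀ x : X, Path.Homotopic.Quotient q x)

/-- The class at `q` of a path of `X`, closed up to a loop with the base paths `b`. -/
def closeUp {x y : X} (γ : Path.Homotopic.Quotient x y) : FundamentalGroup X q :=
  FundamentalGroup.fromPath (((b x).trans γ).trans (b y).symm)

/-- The product of the fundamental group is opposite to the concatenation of paths. -/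
theorem closeUp_trans {x y z : X} (γ : Path.Homotopic.Quotient x y)
    (δ : Path.Homotopic.Quotient y z) :
    closeUp b (γ.trans δ) = closeUp b δ * closeUp b γ := by
  rw [FundamentalGroup.mul_def]
  change Path.Homotopic.Quotient.trans _ _ =
    Path.Homotopic.Quotient.trans (Path.Homotopic.Quotient.trans _ _)
      (Path.Homotopic.Quotient.trans _ _)
  have h : ∀ ε : Path.Homotopic.Quotient y q, (b y).symm.trans ((b y).trans ε) = ε := fun ε => by
    rw [← Path.Homotopic.Quotient.trans_assoc, Path.Homotopic.Quotient.symm_trans,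
      Path.Homotopic.Quotient.refl_trans]
  simp only [Path.Homotopic.Quotient.trans_assoc, h]

variable {A : Type*} [AddCommGroup A] (l : FundamentalGroup X q → A)

open Classical in
/-- The value on a path of the functor defined by `l` and the base paths `b`; by convention
`0` if `f` is not a path in `X`. -/
def closeUpVal (f : ℝ → V) : A :=
  if h : ContinuousOn f (Icc 0 1) ∧ MapsTo f (Icc 0 1) X then
    l (closeUp b (Path.Homotopic.Quotient.mk (pathOf f h.1 h.2
      (x := ⟨f 0, h.2 (by simp)⟩) (y := ⟨f 1, h.2 (by simp)⟩) rfl rfl)))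
  else 0

theorem closeUpVal_eq {f : ℝ → V} {x y : X} (γ : Path x y) (h : ∀ t : unitInterval, f t = γ t) :
    closeUpVal b l f = l (closeUp b (Path.Homotopic.Quotient.mk γ)) := by
  have hc : ContinuousOn f (Icc 0 1) := by
    rw [continuousOn_iff_continuous_domRestrict]
    have : (Icc (0 : ℝ) 1).domRestrict f = fun t => (γ t : V) := funext fun t => h t
    rw [this]
    exact continuous_subtype_val.comp γ.continuous
  have hm : MapsTo f (Icc 0 1) X := fun t ht => by
    have := h ⟨t, ht⟩
    change f t = _ at this
    rw [this]
    exact (γ _).2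
  obtain rfl : x = ⟨f 0, hm (by simp)⟩ := Subtype.ext (by
    have := h 0
    rw [γ.source] at this
    exact this.symm)
  obtain rfl : y = ⟨f 1, hm (by simp)⟩ := Subtype.ext (by
    have := h 1
    rw [γ.target] at this
    exact this.symm)
  rw [closeUpVal, dif_pos ⟨hc, hm⟩]
  congr 3
  ext t
  exact h t

/-- On loops at `q` the choice of the base path `b q` does not matter, because `A` is
commutative. -/
theorem closeUpVal_loop (hl : ∀ γ δ, l (γ * δ) = l γ + l δ)
    (γ : Path q q) {f : ℝ → V} (h : ∀ t : unitInterval, f t = γ t) :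
    closeUpVal b l f = l (FundamentalGroup.fromPath (Path.Homotopic.Quotient.mk γ)) := by
  rw [closeUpVal_eq b l γ h]
  let β : FundamentalGroup X q := FundamentalGroup.fromPath (b q)
  have e : closeUp b (Path.Homotopic.Quotient.mk γ) =
      β⁻¹ * (FundamentalGroup.fromPath (Path.Homotopic.Quotient.mk γ) * β) := rfl
  have h1 : l 1 = 0 := by
    have := hl 1 1
    rwa [mul_one, left_eq_add] at this
  have h2 := hl β⁻¹ β
  rw [inv_mul_cancel, h1] at h2
  rw [e, hl, hl, add_comm (l _) (l β), ← add_assoc, ← h2, zero_add]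

/-- The cocycle on `X` that extends a homomorphism `l` from the fundamental group. -/
def fundamentalCocycle (hl : ∀ γ δ, l (γ * δ) = l γ + l δ) : PathCocycle X A where
  val := closeUpVal b l
  congr {f g} h := by
    by_cases hf : ContinuousOn f (Icc 0 1) ∧ MapsTo f (Icc 0 1) X
    · have h0 : f 0 ∈ X := hf.2 (by simp)
      have h1 : f 1 ∈ X := hf.2 (by simp)
      let γ := pathOf f hf.1 hf.2 (x := ⟨f 0, h0⟩) (y := ⟨f 1, h1⟩) rfl rfl
      rw [closeUpVal_eq b l γ (fun _ => rfl), closeUpVal_eq b l γ (fun t => (h t.2).symm)]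
    · have hg : ¬ (ContinuousOn g (Icc 0 1) ∧ MapsTo g (Icc 0 1) X) := fun hg =>
        hf ⟨hg.1.congr h, hg.2.congr h.symm⟩
      rw [closeUpVal, closeUpVal, dif_neg hf, dif_neg hg]
  homotopy F hc hm h0 h1 := by
    have i0 : (0 : ℝ) ∈ Icc (0 : ℝ) 1 := by simp
    have i1 : (1 : ℝ) ∈ Icc (0 : ℝ) 1 := by simp
    have hcs : ∀ s ∈ Icc (0 : ℝ) 1, ContinuousOn (fun t => F (s, t)) (Icc 0 1) := fun s hs =>
      hc.comp (by fun_prop) fun t ht => ⟨hs, ht⟩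
    have hms : ∀ s ∈ Icc (0 : ℝ) 1, MapsTo (fun t => F (s, t)) (Icc 0 1) X := fun s hs t ht =>
      hm ⟨hs, ht⟩
    let γ : ∀ s ∈ Icc (0 : ℝ) 1, Path (⟨F (0, 0), hm ⟨i0, i0⟩⟩ : X) ⟨F (0, 1), hm ⟨i0, i1⟩⟩ :=
      fun s hs => pathOf _ (hcs s hs) (hms s hs) (h0 s hs) (h1 s hs)
    rw [closeUpVal_eq b l (γ 0 i0) (fun _ => rfl), closeUpVal_eq b l (γ 1 i1) (fun _ => rfl)]
    congr 2
    refine Path.Homotopic.Quotient.eq.mpr ⟨⟨⟨⟨fun x => ⟨F (x.1, x.2), hm ⟨x.1.2, x.2.2⟩⟩, ?_⟩, ?_,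
      ?_⟩, ?_⟩⟩
    · refine Continuous.subtype_mk ?_ _
      exact hc.comp_continuous (by fun_prop) fun x => ⟨x.1.2, x.2.2⟩
    · intro t
      rfl
    · intro t
      rfl
    · rintro s t (rfl | rfl)
      · exact Subtype.ext (h0 s s.2)
      · exact Subtype.ext (h1 s s.2)
  trans f hc hm := by
    have i0 : (0 : ℝ) ∈ Icc (0 : ℝ) 1 := by simp
    have i1 : (1 : ℝ) ∈ Icc (0 : ℝ) 1 := by simp
    have ih : (1 / 2 : ℝ) ∈ Icc (0 : ℝ) 1 := by norm_num
    have ml : MapsTo (fun t : ℝ => t / 2) (Icc 0 1) (Icc 0 1) := fun t ht =>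
      ⟨by linarith [ht.1], by linarith [ht.2]⟩
    have mr : MapsTo (fun t : ℝ => (t + 1) / 2) (Icc 0 1) (Icc 0 1) := fun t ht =>
      ⟨by linarith [ht.1], by linarith [ht.2]⟩
    let γ₁ : Path (⟨f 0, hm i0⟩ : X) ⟨f (1 / 2), hm ih⟩ :=
      pathOf (fun t => f (t / 2)) (hc.comp (by fun_prop) ml) (hm.comp ml) (by simp) rfl
    let γ₂ : Path (⟨f (1 / 2), hm ih⟩ : X) ⟨f 1, hm i1⟩ :=
      pathOf (fun t => f ((t + 1) / 2)) (hc.comp (by fun_prop) mr) (hm.comp mr) (by simp)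
        (by norm_num)
    rw [closeUpVal_eq b l (f := fun t => f (t / 2)) γ₁ (fun _ => rfl),
      closeUpVal_eq b l (f := fun t => f ((t + 1) / 2)) γ₂ (fun _ => rfl),
      closeUpVal_eq b l (γ₁.trans γ₂), Path.Homotopic.Quotient.mk_trans, closeUp_trans,
      hl, add_comm]
    intro t
    rw [Path.trans_apply]
    split_ifs with h
    · change f t = f (2 * t / 2)
      congr 1
      ring
    · change f t = f ((2 * t - 1 + 1) / 2)
      congr 1
      ring

theorem fundamentalCocycle_loop (hl : ∀ γ δ, l (γ * δ) = l γ + l δ)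
    (γ : Path q q) {f : ℝ → V} (h : ∀ t : unitInterval, f t = γ t) :
    (fundamentalCocycle b l hl).val f =
      l (FundamentalGroup.fromPath (Path.Homotopic.Quotient.mk γ)) :=
  closeUpVal_loop b l hl γ h

theorem exists_fundamentalCocycle_eq (hl : ∀ γ δ, l (γ * δ) = l γ + l δ)
    (f : ℝ → V) : ∃ γ, (fundamentalCocycle b l hl).val f = l γ := by
  change ∃ γ, closeUpVal b l f = l γ
  unfold closeUpVal
  split_ifs with h
  · exact ⟨_, rfl⟩
  · refine ⟨1, ?_⟩
    have := hl 1 1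
    rwa [mul_one, left_eq_add, eq_comm] at this

/-- The values of the cocycle on the two sides of a torus come from commuting elements. -/
theorem exists_commute_of_torus (hl : ∀ γ δ, l (γ * δ) = l γ + l δ)
    {T : ℝ × ℝ → V} (hT : Continuous T) (hm : ∀ x, T x ∈ X)
    (h1 : ∀ s, T (0, s) = T (1, s)) (h2 : ∀ s, T (s, 0) = T (s, 1)) :
    ∃ γ δ, Commute γ δ ∧ (fundamentalCocycle b l hl).val (fun t => T (t, 0)) = l γ ∧
      (fundamentalCocycle b l hl).val (fun t => T (0, t)) = l δ := by
  let x : X := ⟨T (0, 0), hm _⟩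
  let α : Path x x := pathOf (fun t => T (t, 0)) (by fun_prop) (fun t _ => hm _) rfl (h1 0).symm
  let β : Path x x := pathOf (fun t => T (0, t)) (by fun_prop) (fun t _ => hm _) rfl (h2 0).symm
  refine ⟨closeUp b (Path.Homotopic.Quotient.mk α), closeUp b (Path.Homotopic.Quotient.mk β), ?_,
    closeUpVal_eq b l (f := fun t => T (t, 0)) α (fun _ => rfl),
    closeUpVal_eq b l (f := fun t => T (0, t)) β (fun _ => rfl)⟩
  change _ * _ = _ * _
  rw [← closeUp_trans, ← closeUp_trans, ← Path.Homotopic.Quotient.mk_trans,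
    ← Path.Homotopic.Quotient.mk_trans]
  congr 1
  -- the two ways around the unit square are homotopic in the square
  let u : unitInterval → ℝ := fun t => min (2 * t) 1
  let v : unitInterval → ℝ := fun t => max (2 * t - 1) 0
  have hu0 : u 0 = 0 := by simp [u]
  have hu1 : u 1 = 1 := by norm_num [u]
  have hv0 : v 0 = 0 := by norm_num [v]
  have hv1 : v 1 = 1 := by norm_num [v]
  refine Path.Homotopic.Quotient.eq.mpr ⟨⟨⟨⟨fun y =>
    ⟨T ((1 - y.1) * v y.2 + y.1 * u y.2, (1 - y.1) * u y.2 + y.1 * v y.2), hm _⟩, ?_⟩, ?_, ?_⟩, ?_⟩⟩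
  · refine Continuous.subtype_mk (hT.comp ?_) _
    have : Continuous u := by fun_prop
    have : Continuous v := by fun_prop
    fun_prop
  · intro t
    apply Subtype.ext
    simp only [Set.Icc.coe_zero, sub_zero, one_mul, zero_mul, add_zero]
    change _ = ((β.trans α) t : V)
    rw [Path.trans_apply]
    split_ifs with h
    · change _ = T (0, 2 * t)
      simp only [u, v]
      rw [max_eq_right (by linarith), min_eq_left (by linarith)]
    · change _ = T (2 * t - 1, 0)
      simp only [u, v]
      rw [max_eq_left (by linarith), min_eq_right (by linarith), h2]
  · intro t
    apply Subtype.ext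
    simp only [Set.Icc.coe_one, sub_self, one_mul, zero_mul, zero_add]
    change _ = ((α.trans β) t : V)
    rw [Path.trans_apply]
    split_ifs with h
    · change _ = T (2 * t, 0)
      simp only [u, v]
      rw [max_eq_right (by linarith), min_eq_left (by linarith)]
    · change _ = T (0, 2 * t - 1)
      simp only [u, v]
      rw [max_eq_left (by linarith), min_eq_right (by linarith), h1]
  · rintro s t (rfl | rfl)
    · refine Subtype.ext ?_
      change T ((1 - s) * v 0 + s * u 0, (1 - s) * u 0 + s * v 0) = ((β.trans α) 0 : V)
      rw [Path.source, hu0, hv0]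
      simp [x]
    · refine Subtype.ext ?_
      change T ((1 - s) * v 1 + s * u 1, (1 - s) * u 1 + s * v 1) = ((β.trans α) 1 : V)
      rw [Path.target, hu1, hv1]
      have : ((1 - s) * 1 + s * 1 : ℝ) = 1 := by ring
      rw [this, ← h1, ← h2]

end FundamentalCocycle

/-! ### Configurations and punctures -/

section Configurations

open Set Topology Filter OnePoint

variable {G : Subgroup (Equiv.Perm (OnePoint ℂ))} {n : ℕ}

theorem exists_SU2_smul_eq (hG : G ≤ PSU2) (g : G) :
    ∃ M ∈ SU2, ∀ z : OnePoint ℂ, g • z = M • z := by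
  obtain ⟨M, hM, h⟩ := hG g.2
  refine ⟨M, hM, fun z => ?_⟩
  change (g : Equiv.Perm (OnePoint ℂ)) z = _
  rw [← h]
  rfl

theorem continuous_smul_of_le_PSU2 (hG : G ≤ PSU2) (g : G) :
    Continuous fun z : OnePoint ℂ => g • z := by
  obtain ⟨M, _, h⟩ := exists_SU2_smul_eq hG g
  simp only [h]
  exact continuous_gl_smul M

theorem mem_exceptional_iff {p : OnePoint ℂ} :
    p ∈ exceptional G ↔ ∃ g : G, g ≠ 1 ∧ g • p = p := by
  change MulAction.stabilizer G p ≠ ⊥ ↔ _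
  rw [Subgroup.ne_bot_iff_exists_ne_one]
  constructor
  · rintro ⟨⟨g, hg⟩, h⟩
    exact ⟨g, fun h' => h (Subtype.ext h'), hg⟩
  · rintro ⟨g, hg, h⟩
    exact ⟨⟨g, h⟩, fun h' => hg (congrArg Subtype.val h')⟩

theorem smul_right_injective_of_notMem_exceptional {p : OnePoint ℂ} (hp : p ∉ exceptional G)
    {g h : G} (hgh : g • p = h • p) : g = h := by
  by_contra hne
  refine hp (mem_exceptional_iff.mpr ⟨h⁻¹ * g, fun e => hne ?_, ?_⟩)
  · exact (inv_mul_eq_one.mp e).symm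
  · rw [mul_smul, hgh, inv_smul_smul]

theorem smul_mem_exceptional_iff (g : G) {p : OnePoint ℂ} :
    g • p ∈ exceptional G ↔ p ∈ exceptional G :=
  ⟨fun h => by simpa using smul_mem_exceptional g⁻¹ h, smul_mem_exceptional g⟩

/-- Each nontrivial homography has finitely many fixed points. -/
theorem finite_exceptional [Finite G] (hG : G ≤ PSU2) : (exceptional G).Finite := by
  have : exceptional G ⊆ ⋃ g : {g : G // g ≠ 1}, {p | g.1 • p = p} := by
    intro p hp
    obtain ⟨g, hg, h⟩ := mem_exceptional_iff.mp hp
    exact mem_iUnion.mpr ⟨⟨g, hg⟩, h⟩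
  refine Set.Finite.subset (finite_iUnion fun g => ?_) this
  obtain ⟨M, _, h⟩ := exists_SU2_smul_eq hG g.1
  simp only [h]
  apply finite_fixedPoints
  by_contra! hM
  refine g.2 (Subtype.ext (Equiv.ext fun z => ?_))
  change g.1 • z = z
  rw [h, hM]

variable (G) in
/-- The punctures of the projective line seen by the `i`-th point of a configuration are indexed by
the exceptional points and by the pairs `(j, g)` with `j ≠ i`. -/
abbrev PunctureIdx (i : Fin n) : Type := exceptional G ⊕ ({j : Fin n // j ≠ i} × G)

/-- The puncture of a given index: an exceptional point, or `g • z_j`. -/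
def puncture (i : Fin n) (z : Fin n → OnePoint ℂ) : PunctureIdx G i → OnePoint ℂ
  | Sum.inl p => p
  | Sum.inr (j, g) => g • z j

theorem puncture_injective {z : Fin n → OnePoint ℂ} (hz : z ∈ orbitConfig G n) (i : Fin n) :
    Function.Injective (puncture (G := G) i z) := by
  have h : ∀ (p : exceptional G) (j : Fin n) (g : G), (p : OnePoint ℂ) ≠ g • z j :=
    fun p j g e => hz.1 j ((smul_mem_exceptional_iff g).mp (e ▸ p.2))
  rintro (p | ⟨j, g⟩) (p' | ⟨j', g'⟩) e
  · exact congrArg Sum.inl (Subtype.ext e)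
  · exact absurd e (h _ _ _)
  · exact absurd e.symm (h _ _ _)
  · change g • z j = g' • z j' at e
    have hj : j = j' := by
      by_contra hne
      refine hz.2 j j' (fun h => hne (Subtype.ext h)) (g⁻¹ * g') ?_
      rw [mul_smul, ← e, inv_smul_smul]
    subst hj
    rw [smul_right_injective_of_notMem_exceptional (hz.1 j) e]

theorem puncture_update (i : Fin n) (z : Fin n → OnePoint ℂ) (w : OnePoint ℂ) :
    puncture (G := G) i (Function.update z i w) = puncture i z := by
  funext e
  rcases e with p | ⟨j, g⟩
  · rfl
  · simp [puncture, Function.update_of_ne j.2]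

theorem punctures_eq_range (q : orbitConfig G n) (i : Fin n) :
    punctures q i = range (puncture (G := G) i q.1) := by
  ext p
  constructor
  · rintro (hp | ⟨j, hj, g, rfl⟩)
    · exact ⟨Sum.inl ⟨p, hp⟩, rfl⟩
    · exact ⟨Sum.inr (⟨j, hj⟩, g), rfl⟩
  · rintro ⟨p | ⟨j, g⟩, rfl⟩
    · exact Or.inl p.2
    · exact Or.inr ⟨j, j.2, g, rfl⟩

theorem update_mem_orbitConfig {z : Fin n → OnePoint ℂ} (hz : z ∈ orbitConfig G n) {i : Fin n}
    {w : OnePoint ℂ} (hw : ∀ e, puncture (G := G) i z e ≠ w) :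
    Function.update z i w ∈ orbitConfig G n := by
  refine ⟨fun k => ?_, fun k l hkl g => ?_⟩
  · by_cases hk : k = i
    · subst hk
      rw [Function.update_self]
      exact fun h => hw (Sum.inl ⟨w, h⟩) rfl
    · rw [Function.update_of_ne hk]
      exact hz.1 k
  · by_cases hk : k = i
    · subst hk
      rw [Function.update_self, Function.update_of_ne hkl.symm]
      exact fun h => hw (Sum.inr (⟨l, hkl.symm⟩, g)) h.symm
    · rw [Function.update_of_ne hk]
      by_cases hl : l = i
      · subst hl
        rw [Function.update_self]
        intro h
        exact hw (Sum.inr (⟨k, hkl⟩, g⁻¹)) (by simp [puncture, h])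
      · rw [Function.update_of_ne hl]
        exact hz.2 k l hkl g

theorem puncture_ne_self {z : Fin n → OnePoint ℂ} (hz : z ∈ orbitConfig G n) (i : Fin n)
    (e : PunctureIdx G i) : puncture i z e ≠ z i := by
  rcases e with p | ⟨j, g⟩
  · exact fun h => hz.1 i (h ▸ p.2)
  · exact fun h => hz.2 i j j.2.symm g h.symm

theorem puncture_ne_of_update_mem {z : Fin n → OnePoint ℂ} {i : Fin n} {w : OnePoint ℂ}
    (hz : Function.update z i w ∈ orbitConfig G n) (e : PunctureIdx G i) : puncture i z e ≠ w := by
  have := puncture_ne_self hz i e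
  rwa [puncture_update, Function.update_self] at this

theorem continuous_puncture (hG : G ≤ PSU2) (i : Fin n) (e : PunctureIdx G i) :
    Continuous fun z => puncture (G := G) i z e := by
  rcases e with p | ⟨j, g⟩
  · exact continuous_const
  · exact (continuous_smul_of_le_PSU2 hG g).comp (continuous_apply _)

variable [Finite G]

theorem finite_range_puncture (hG : G ≤ PSU2) (i : Fin n) (z : Fin n → OnePoint ℂ) :
    (range (puncture (G := G) i z)).Finite := by
  have := (finite_exceptional hG).to_subtype
  exact finite_range _

theorem joinedIn_update {z : Fin n → OnePoint ℂ} (hG : G ≤ PSU2) (hz : z ∈ orbitConfig G n)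
    {i : Fin n} {w : OnePoint ℂ} (hw : ∀ e, puncture (G := G) i z e ≠ w) :
    JoinedIn (orbitConfig G n) z (Function.update z i w) := by
  obtain ⟨γ, hγ⟩ := joinedIn_compl_of_finite (finite_range_puncture hG i z) (x := z i) (y := w)
    (by rintro ⟨e, he⟩; exact puncture_ne_self hz i e he) (by rintro ⟨e, he⟩; exact hw e he)
  refine ⟨⟨⟨fun t => Function.update z i (γ t), by fun_prop⟩, ?_, ?_⟩, fun t => ?_⟩
  · simp
  · simp
  · exact update_mem_orbitConfig hz fun e he => hγ t ⟨e, he⟩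

/-- Configurations whose points lie in different orbits are joined by moving the points one by
one. -/
theorem joinedIn_of_compatible {x u : Fin n → OnePoint ℂ} (hG : G ≤ PSU2)
    (hx : x ∈ orbitConfig G n) (hu : u ∈ orbitConfig G n)
    (hxu : ∀ (i j : Fin n) (g : G), u i ≠ g • x j) : JoinedIn (orbitConfig G n) x u := by
  classical
  have hmem : ∀ s : Finset (Fin n), s.piecewise u x ∈ orbitConfig G n := by
    intro s
    refine ⟨fun i => ?_, fun i j hij g => ?_⟩
    · by_cases hi : i ∈ s
      · rw [Finset.piecewise_eq_of_mem _ _ _ hi]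
        exact hu.1 i
      · rw [Finset.piecewise_eq_of_notMem _ _ _ hi]
        exact hx.1 i
    · by_cases hi : i ∈ s <;> by_cases hj : j ∈ s <;>
        simp only [hi, hj, Finset.piecewise_eq_of_mem, Finset.piecewise_eq_of_notMem, ne_eq,
          not_false_iff]
      · exact hu.2 i j hij g
      · exact hxu i j g
      · intro h
        exact hxu j i g⁻¹ (by rw [h, inv_smul_smul])
      · exact hx.2 i j hij g
  have : ∀ s : Finset (Fin n), JoinedIn (orbitConfig G n) x (s.piecewise u x) := by
    intro s
    induction s using Finset.induction_on with
    | empty =>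
      rw [Finset.piecewise_empty]
      exact JoinedIn.refl hx
    | insert i s hi ih =>
      refine ih.trans ?_
      have h := hmem (insert i s)
      rw [Finset.piecewise_insert] at h ⊢
      exact joinedIn_update hG (hmem s) (puncture_ne_of_update_mem h)
  have h := this Finset.univ
  rwa [Finset.piecewise_univ] at h

/-- The orbit configuration space is path connected: two configurations are joined by way of a third
one whose points avoid the orbits of both, and the points are moved one after the other. -/
theorem joinedIn_orbitConfig (hG : G ≤ PSU2) {x y : Fin n → OnePoint ℂ}
    (hx : x ∈ orbitConfig G n) (hy : y ∈ orbitConfig G n) : JoinedIn (orbitConfig G n) x y := by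
  have horb : ∀ z : OnePoint ℂ, (range fun g : G => g • z).Finite := fun z => finite_range _
  have hfin : ((exceptional G) ∪ ((⋃ j, range fun g : G => g • x j) ∪
      (⋃ j, range fun g : G => g • y j))).Finite :=
    (finite_exceptional hG).union ((finite_iUnion fun j => horb _).union
      (finite_iUnion fun j => horb _))
  obtain ⟨f, hf1, hf2⟩ := exists_seq_of_forall_finset_exists (α := OnePoint ℂ)
    (fun p => p ∉ (exceptional G) ∪ ((⋃ j, range fun g : G => g • x j) ∪
      (⋃ j, range fun g : G => g • y j))) (fun p p' => ∀ g : G, p' ≠ g • p) (by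
      intro s _
      obtain ⟨p, hp⟩ := (hfin.union (s.finite_toSet.biUnion fun p _ =>
        horb p)).infinite_compl.nonempty
      rw [mem_compl_iff, mem_union, not_or] at hp
      refine ⟨p, hp.1, fun a ha g hg => hp.2 ?_⟩
      exact mem_biUnion (Finset.mem_coe.mpr ha) ⟨g, hg.symm⟩)
  simp only [mem_union, mem_iUnion, mem_range, not_or, not_exists] at hf1
  have hu : (fun i : Fin n => f i) ∈ orbitConfig G n := by
    refine ⟨fun i => (hf1 i).1, fun i j hij g => ?_⟩
    rcases lt_or_gt_of_ne hij with h | h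
    · intro e
      change f i = g • f j at e
      exact hf2 i j h g⁻¹ (by rw [e, inv_smul_smul])
    · exact hf2 j i h g
  exact (joinedIn_of_compatible hG hx hu fun i j g h => (hf1 i).2.1 j g h.symm).trans
    (joinedIn_of_compatible hG hy hu fun i j g h => (hf1 i).2.2 j g h.symm).symm

end Configurations

/-! ### Values on small circles around a puncture -/

section LocalClasses

open Set Topology Filter Complex OnePoint

/-- Two charts centered at the same point: in the second one, a small circle around the center of
the first one is the exponential of a path that increases by `2πi`. -/
theorem exists_log_of_chart_eq {M N : GL (Fin 2) ℂ} {a : ℂ} (h : chart M a = chart N 0) {δ : ℝ}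
    (hδ : 0 < δ) : ∀ᶠ r in 𝓝[>] (0 : ℝ), ∃ L : ℝ → ℂ, Continuous L ∧
      (∀ t, ‖exp (L t)‖ < δ) ∧ L 1 = L 0 + 2 * Real.pi * I ∧
      ∀ t : ℝ, chart M (circleMap a r (2 * Real.pi * t)) = chart N (exp (L t)) := by
  set B := N⁻¹ * M * translGL a with hB
  have hBc : ∀ w : ℂ, N • B • (w : OnePoint ℂ) = chart M (a + w) := fun w => by
    rw [hB, mul_smul, mul_smul, smul_inv_smul, translGL_smul_coe, add_comm]
    rfl
  have hB0 : B • ((0 : ℂ) : OnePoint ℂ) = ((0 : ℂ) : OnePoint ℂ) := by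
    have := hBc 0
    rw [add_zero, h] at this
    exact MulAction.injective N this
  rw [smul_some_eq_ite, mul_zero, zero_add, mul_zero, zero_add] at hB0
  have h11 : B 1 1 ≠ 0 := fun h => by
    rw [if_pos h] at hB0
    exact infty_ne_coe _ hB0
  rw [if_neg h11] at hB0
  have h01 : B 0 1 = 0 := by
    have := coe_injective hB0
    simpa [h11] using this
  have h00 : B 0 0 ≠ 0 := fun h => B.det_ne_zero (by
    rw [Matrix.det_fin_two, h, h01]
    ring)
  -- `B` acts as `w ↦ λ w / (1 + κ w)`
  set lam := B 0 0 / B 1 1 with hlam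
  set κ := B 1 0 / B 1 1 with hκ
  have hlam0 : lam ≠ 0 := div_ne_zero h00 h11
  have hact : ∀ w : ℂ, 1 + κ * w ≠ 0 →
      B • (w : OnePoint ℂ) = ((w * lam / (1 + κ * w) : ℂ) : OnePoint ℂ) := by
    intro w hw
    have e : B 1 0 * w + B 1 1 = B 1 1 * (1 + κ * w) := by
      rw [hκ]
      field_simp
      ring
    rw [smul_some_eq_ite, e, if_neg (mul_ne_zero h11 hw), h01, add_zero, hlam]
    congr 1
    field_simp
  have hsmall : ∀ᶠ w in 𝓝 (0 : ℂ), ‖κ * w‖ < 1 ∧ ‖w * lam / (1 + κ * w)‖ < δ := by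
    have c1 : ContinuousAt (fun w : ℂ => ‖κ * w‖) 0 := by fun_prop
    have c2 : ContinuousAt (fun w : ℂ => ‖w * lam / (1 + κ * w)‖) 0 := by
      refine ContinuousAt.norm (ContinuousAt.div ?_ ?_ (by simp)) <;> fun_prop
    exact (c1.eventually_lt_const (by simp)).and (c2.eventually_lt_const (by simpa))
  obtain ⟨ρ, hρ, hball⟩ := Metric.eventually_nhds_iff.mp hsmall
  filter_upwards [Ioo_mem_nhdsGT hρ] with r hr
  set w : ℝ → ℂ := fun t => r * exp (2 * Real.pi * t * I) with hw
  have hwn : ∀ t, ‖w t‖ = r := fun t => by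
    have : (2 * Real.pi * t * I : ℂ) = ((2 * Real.pi * t : ℝ) : ℂ) * I := by push_cast; ring
    rw [hw]
    simp only [norm_mul, this, norm_exp_ofReal_mul_I, mul_one, norm_real,
      Real.norm_of_nonneg hr.1.le]
  have hws := fun t => hball (y := w t) (by rw [dist_zero_right, hwn]; exact hr.2)
  have hslit : ∀ t, 1 + κ * w t ∈ slitPlane := fun t => mem_slitPlane_of_norm_lt_one (hws t).1
  set L : ℝ → ℂ := fun t =>
    Real.log r + 2 * Real.pi * t * I + log lam - log (1 + κ * w t) with hL
  have hwc : Continuous w := by fun_prop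
  have hexp : ∀ t, exp (L t) = w t * lam / (1 + κ * w t) := by
    intro t
    rw [hL]
    simp only
    rw [exp_sub, exp_add, exp_add, exp_log hlam0, exp_log (slitPlane_ne_zero (hslit t)),
      ← ofReal_exp, Real.exp_log hr.1]
  refine ⟨L, ?_, fun t => ?_, ?_, fun t => ?_⟩
  · exact Continuous.sub (by fun_prop) (Continuous.clog (by fun_prop) hslit)
  · rw [hexp]
    exact (hws t).2
  · have : w 1 = w 0 := by
      simp [hw, exp_two_pi_mul_I]
    rw [hL]
    simp only
    rw [this]
    push_cast
    ring
  · rw [hexp]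
    change _ = N • ((w t * lam / (1 + κ * w t) : ℂ) : OnePoint ℂ)
    rw [← hact _ (slitPlane_ne_zero (hslit t)), hBc, circleMap]
    push_cast
    rfl

variable {G : Subgroup (Equiv.Perm (OnePoint ℂ))} {n : ℕ} {A : Type*} [AddCommGroup A]
  (c : PathCocycle (orbitConfig G n) A)

/-- The value of a cocycle on the loop moving the `i`-th point of `z` along a circle in a chart. -/
def circVal (i : Fin n) (z : Fin n → OnePoint ℂ) (M : GL (Fin 2) ℂ) (a : ℂ) (r : ℝ) : A :=
  c.val (fun t => Function.update z i (chart M (circleMap a r (2 * Real.pi * t))))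

variable [Finite G]

/-- The coordinates of the punctures seen by the `i`-th point of `z`. -/
def punctureCoords (hG : G ≤ PSU2) (i : Fin n) (z : Fin n → OnePoint ℂ) (M : GL (Fin 2) ℂ) :
    Finset ℂ :=
  ((finite_range_puncture hG i z).preimage (chart_injective M).injOn).toFinset

theorem mem_punctureCoords {hG : G ≤ PSU2} {i : Fin n} {z : Fin n → OnePoint ℂ}
    {M : GL (Fin 2) ℂ} {w : ℂ} :
    w ∈ punctureCoords hG i z M ↔ ∃ e, puncture (G := G) i z e = chart M w := by
  rw [punctureCoords, Set.Finite.mem_toFinset]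
  rfl

variable {c} {z : Fin n → OnePoint ℂ}

/-- The pullback of a cocycle to the plane punctured at the coordinates of the punctures. -/
def coordCocycle (c : PathCocycle (orbitConfig G n) A) (hG : G ≤ PSU2)
    (hz : z ∈ orbitConfig G n) (i : Fin n) (M : GL (Fin 2) ℂ) :
    PathCocycle ((punctureCoords hG i z M : Set ℂ)ᶜ) A :=
  c.comap (fun w => Function.update z i (chart M w))
    (by
      have := continuous_chart M
      fun_prop)
    (fun w hw => update_mem_orbitConfig hz fun e he => hw (mem_punctureCoords.mpr ⟨e, he⟩))

theorem exists_radius (hG : G ≤ PSU2) (i : Fin n) (z : Fin n → OnePoint ℂ)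
    (M : GL (Fin 2) ℂ) (a : ℂ) :
    ∃ δ > 0, ∀ w, w ≠ a → ‖w - a‖ < δ → w ∉ punctureCoords hG i z M := by
  have h : ∀ᶠ w in 𝓝 a, w ∉ (punctureCoords hG i z M).erase a :=
    ((punctureCoords hG i z M).erase a).finite_toSet.isClosed.isOpen_compl.mem_nhds (by simp)
  obtain ⟨δ, hδ, hb⟩ := Metric.eventually_nhds_iff.mp h
  refine ⟨δ, hδ, fun w hw hwd hwP => hb (by rwa [dist_eq]) (Finset.mem_erase.mpr ⟨hw, hwP⟩)⟩

/-- All small circles around a puncture, in all charts, give the same value. -/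
theorem exists_localVal (c : PathCocycle (orbitConfig G n) A) (hG : G ≤ PSU2)
    (hz : z ∈ orbitConfig G n) (i : Fin n) (p : OnePoint ℂ) :
    ∃ τ : A, (∀ M a, chart M a = p → ∀ᶠ r in 𝓝[>] (0 : ℝ), circVal c i z M a r = τ) ∧
      ∃ δ > 0, ∀ L : ℝ → ℂ, ContinuousOn L (Icc 0 1) → (∀ t ∈ Icc (0 : ℝ) 1, ‖exp (L t)‖ < δ) →
        L 1 = L 0 + 2 * Real.pi * I →
        c.val (fun t => Function.update z i (chart (localChart p) (exp (L t)))) = τ := by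
  obtain ⟨δ, hδ, hX⟩ := exists_radius hG i z (localChart p) 0
  have key : ∀ L : ℝ → ℂ, ContinuousOn L (Icc 0 1) → (∀ t ∈ Icc (0 : ℝ) 1, ‖exp (L t)‖ < δ) →
      L 1 = L 0 + 2 * Real.pi * I →
      c.val (fun t => Function.update z i (chart (localChart p) (exp (L t)))) =
        circVal c i z (localChart p) 0 (δ / 2) := by
    intro L hL hLδ hL1
    have := PathCocycle.val_add_exp_eq_circ (c := coordCocycle c hG hz i (localChart p)) hX hL hLδ
      hL1 (half_pos hδ) (half_lt_self hδ)
    refine Eq.trans ?_ this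
    refine c.congr fun t _ => ?_
    simp only [Function.comp, zero_add]
  refine ⟨circVal c i z (localChart p) 0 (δ / 2), fun M a hM => ?_, δ, hδ, key⟩
  filter_upwards [exists_log_of_chart_eq (N := localChart p)
    (hM.trans (chart_localChart_zero p).symm) hδ] with r hr
  obtain ⟨L, hLc, hLδ, hL1, hLM⟩ := hr
  rw [← key L hLc.continuousOn (fun t _ => hLδ t) hL1]
  exact c.congr fun t _ => by simp only [hLM]

open Classical in
/-- The value of a cocycle on the loop moving the `i`-th point of the configuration `z` along a
small circle around the puncture `e`; by convention `0` if `z` is not a configuration. -/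
def localVal (c : PathCocycle (orbitConfig G n) A) (hG : G ≤ PSU2) (i : Fin n)
    (z : Fin n → OnePoint ℂ) (e : PunctureIdx G i) : A :=
  if hz : z ∈ orbitConfig G n then (exists_localVal c hG hz i (puncture i z e)).choose else 0

theorem circVal_eventually_eq (hG : G ≤ PSU2) (hz : z ∈ orbitConfig G n) (i : Fin n)
    (e : PunctureIdx G i) {M : GL (Fin 2) ℂ} {a : ℂ} (h : chart M a = puncture i z e) :
    ∀ᶠ r in 𝓝[>] (0 : ℝ), circVal c i z M a r = localVal c hG i z e := by
  rw [localVal, dif_pos hz]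
  exact (exists_localVal c hG hz i (puncture i z e)).choose_spec.1 M a h

theorem exists_val_exp_eq_localVal (c : PathCocycle (orbitConfig G n) A) (hG : G ≤ PSU2)
    (hz : z ∈ orbitConfig G n) (i : Fin n) (e : PunctureIdx G i) :
    ∃ δ > 0, ∀ L : ℝ → ℂ, ContinuousOn L (Icc 0 1) → (∀ t ∈ Icc (0 : ℝ) 1, ‖exp (L t)‖ < δ) →
      L 1 = L 0 + 2 * Real.pi * I →
      c.val (fun t => Function.update z i (chart (localChart (puncture i z e)) (exp (L t)))) =
        localVal c hG i z e := by
  rw [localVal, dif_pos hz]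
  exact (exists_localVal c hG hz i (puncture i z e)).choose_spec.2

theorem exists_val_eq_localVal (hG : G ≤ PSU2) (hz : z ∈ orbitConfig G n) (i : Fin n)
    (e : PunctureIdx G i) : ∃ f, c.val f = localVal c hG i z e := by
  obtain ⟨r, hr⟩ := (circVal_eventually_eq (c := c) hG hz i e
    (chart_localChart_zero (puncture i z e))).exists
  exact ⟨_, hr⟩

/-- The value of a cocycle on the loop moving the `i`-th point of `z` along a circle is the sum of
the values on small circles around the punctures inside, if these lie close to the center. -/
theorem circVal_eq_sum_localVal (hG : G ≤ PSU2) (hz : z ∈ orbitConfig G n) (i : Fin n)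
    {M : GL (Fin 2) ℂ} {a : ℂ} {R : ℝ} (hR : 0 < R) (S : Finset (PunctureIdx G i))
    (hin : ∀ e ∈ S, ∃ w, chart M w = puncture i z e ∧ ‖w - a‖ < R / 4)
    (hout : ∀ e ∉ S, ∀ w, chart M w = puncture i z e → R < ‖w - a‖) :
    circVal c i z M a R = ∑ e ∈ S, localVal c hG i z e := by
  classical
  set P := punctureCoords hG i z M with hP
  have hidx : ∀ w (_ : w ∈ P), ∃ e : PunctureIdx G i, puncture i z e = chart M w := fun w hw =>
    mem_punctureCoords.mp hw
  choose E hE using hidx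
  have h1 := PathCocycle.circ_eq_regionSum P (c := coordCocycle c hG hz i M)
    (fun w => if hw : w ∈ P then localVal c hG i z (E w hw) else 0)
    (fun p hp => by
      rw [dif_pos hp]
      exact circVal_eventually_eq hG hz i (E p hp) (hE p hp).symm) (a := a) hR (by
      intro p hp hpR
      by_cases he : E p hp ∈ S
      · obtain ⟨w, hw, hwR⟩ := hin _ he
        rw [hE p hp] at hw
        rwa [← chart_injective M hw]
      · exact absurd hpR (not_le.mpr (hout _ he p (hE p hp).symm)))
  refine Eq.trans h1 ?_
  rw [PathCocycle.regionSum, ← Finset.sum_filter]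
  refine Finset.sum_bij (fun w hw => E w (Finset.mem_filter.mp hw).1) ?_ ?_ ?_ ?_
  · intro w hw
    obtain ⟨hwP, hwR⟩ := Finset.mem_filter.mp hw
    by_contra he
    have := hout _ he w (hE w hwP).symm
    rw [Metric.mem_ball, dist_eq] at hwR
    linarith
  · intro w hw w' hw' h
    have e1 := hE w (Finset.mem_filter.mp hw).1
    have e2 := hE w' (Finset.mem_filter.mp hw').1
    rw [h, e2] at e1
    exact (chart_injective M e1).symm
  · intro e he
    obtain ⟨w, hw, hwR⟩ := hin e he
    have hwP : w ∈ P := mem_punctureCoords.mpr ⟨e, hw.symm⟩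
    refine ⟨w, Finset.mem_filter.mpr ⟨hwP, ?_⟩, ?_⟩
    · rw [Metric.mem_ball, dist_eq]
      linarith
    · exact puncture_injective hz i ((hE w hwP).trans hw)
  · intro w hw
    rw [dif_pos (Finset.mem_filter.mp hw).1]

end LocalClasses

/-! ### Independence of the configuration, and loops along discs -/

section LocalClasses

open Set Topology Filter Complex OnePoint

variable {G : Subgroup (Equiv.Perm (OnePoint ℂ))} {n : ℕ} {A : Type*} [AddCommGroup A]
  {c : PathCocycle (orbitConfig G n) A} [Finite G]

/-- The value on small circles around a puncture does not depend on the configuration: it is locally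
constant along paths of configurations, because a fixed circle can be used around a puncture that
moves little. -/
theorem localVal_eq (hG : G ≤ PSU2) (i : Fin n) (e : PunctureIdx G i) {z z' : Fin n → OnePoint ℂ}
    (hz : z ∈ orbitConfig G n) (hz' : z' ∈ orbitConfig G n) :
    localVal c hG i z e = localVal c hG i z' e := by
  have := (finite_exceptional hG).to_subtype
  obtain ⟨γ, hγ⟩ := joinedIn_orbitConfig hG hz hz'
  set Z : ℝ → Fin n → OnePoint ℂ := fun s => γ.extend s with hZ
  have hZc : Continuous Z := γ.extend.continuous
  have hZm : ∀ s, Z s ∈ orbitConfig G n := fun s => hγ _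
  have hloc : IsLocallyConstant fun s => localVal c hG i (Z s) e := by
    rw [IsLocallyConstant.iff_eventually_eq]
    intro s₀
    -- in a fixed chart, a circle that encloses the puncture `e` alone at time `s₀`
    set M := localChart (puncture i (Z s₀) e) with hM
    have hM0 : chart M 0 = puncture i (Z s₀) e := chart_localChart_zero _
    obtain ⟨δ, hδ, hδP⟩ := exists_radius hG i (Z s₀) M 0
    set R := δ / 2 with hR
    have hR0 : 0 < R := half_pos hδ
    have ev1 : ∀ᶠ s in 𝓝 s₀, puncture i (Z s) e ∈ chart M '' Metric.ball 0 (R / 4) := by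
      have : Continuous fun s => puncture i (Z s) e := (continuous_puncture hG i e).comp hZc
      refine this.continuousAt.eventually_mem ((isOpenMap_chart M _ Metric.isOpen_ball).mem_nhds ?_)
      exact ⟨0, Metric.mem_ball_self (by positivity), hM0⟩
    have ev2 : ∀ᶠ s in 𝓝 s₀, ∀ e', e' ≠ e →
        puncture i (Z s) e' ∉ chart M '' Metric.closedBall 0 R := by
      rw [eventually_all]
      intro e'
      by_cases he : e' = e
      · simp [he]
      have : Continuous fun s => puncture i (Z s) e' := (continuous_puncture hG i e').comp hZc
      have hcl : IsClosed (chart M '' Metric.closedBall 0 R) :=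
        ((isCompact_closedBall 0 R).image (continuous_chart M)).isClosed
      filter_upwards [this.continuousAt.eventually_mem (hcl.isOpen_compl.mem_nhds (by
        rintro ⟨w, hw, hwe⟩
        rw [Metric.mem_closedBall, dist_eq] at hw
        refine hδP w ?_ (hw.trans_lt (half_lt_self hδ)) (mem_punctureCoords.mpr ⟨e', hwe.symm⟩)
        rintro rfl
        exact he (puncture_injective (hZm s₀) i (hwe.symm.trans hM0))))] with s hs _ using hs
    obtain ⟨η, hη, hball⟩ := Metric.eventually_nhds_iff.mp (ev1.and ev2)
    have hcirc : ∀ s, dist s s₀ < η → circVal c i (Z s) M 0 R = localVal c hG i (Z s) e := by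
      intro s hs
      rw [circVal_eq_sum_localVal hG (hZm s) i hR0 {e}, Finset.sum_singleton]
      · intro e' he'
        rw [Finset.mem_singleton] at he'
        subst he'
        obtain ⟨w, hw, hwe⟩ := (hball hs).1
        exact ⟨w, hwe, by rwa [Metric.mem_ball, dist_eq] at hw⟩
      · intro e' he' w hw
        rw [Finset.mem_singleton] at he'
        by_contra hlt
        refine (hball hs).2 e' he' ⟨w, ?_, hw⟩
        rw [Metric.mem_closedBall, dist_eq]
        exact not_lt.mp hlt
    rw [Metric.eventually_nhds_iff]
    refine ⟨η, hη, fun s hs => ?_⟩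
    rw [← hcirc s hs, ← hcirc s₀ (by simpa using hη)]
    have hM' := continuous_chart M
    have key := PathCocycle.val_eq_of_free_homotopy (c := c)
      (fun x => Function.update (Z (s₀ + x.1 * (s - s₀))) i
        (chart M (circleMap 0 R (2 * Real.pi * x.2)))) (by fun_prop) (by
        rintro ⟨u, t⟩ ⟨hu, _⟩
        have hd : dist (s₀ + u * (s - s₀)) s₀ < η := by
          rw [Real.dist_eq] at hs ⊢
          rw [add_sub_cancel_left, abs_mul, abs_of_nonneg hu.1]
          nlinarith [abs_nonneg (s - s₀), hu.2]
        refine update_mem_orbitConfig (hZm _) fun e' he' => ?_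
        have hn : ‖circleMap 0 R (2 * Real.pi * t)‖ = R := by
          simpa using mem_sphere_iff_norm.mp (circleMap_mem_sphere 0 hR0.le (2 * Real.pi * t))
        by_cases h : e' = e
        · subst h
          obtain ⟨w, hw, hwe⟩ := (hball hd).1
          have := chart_injective M (hwe.trans he')
          rw [Metric.mem_ball, dist_zero_right, this, hn] at hw
          linarith
        · refine (hball hd).2 e' h ⟨_, ?_, he'.symm⟩
          rw [Metric.mem_closedBall, dist_zero_right, hn]) (by
        intro u _
        simp only [mul_zero, mul_one]
        congr 2
        have := periodic_circleMap 0 R 0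
        rw [zero_add] at this
        exact this.symm)
    simp only [zero_mul, add_zero, one_mul, add_sub_cancel] at key
    exact key.symm
  have := hloc.apply_eq_of_preconnectedSpace 0 1
  simpa [hZ] using this

/-- A loop along the boundary of a disc as in `IsLoopAround`, run in the negative sense, has the
value opposite to that of a small circle: in the disc minus a point, it is freely homotopic to the
image of a small circle around that point. -/
theorem val_of_isLoopAround (hG : G ≤ PSU2) (q : orbitConfig G n) (i : Fin n) (e : PunctureIdx G i)
    {γ : Path q q} (h : IsLoopAround q i (puncture i q.1 e) γ) :
    ∃ f : ℝ → Fin n → OnePoint ℂ, (∀ t : unitInterval, f t = γ t) ∧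
      c.val f = -localVal c hG i q.1 e := by
  obtain ⟨f, w, hfc, hfi, hw, hfw, hor, hdisc, -, hγ⟩ := h
  set p := puncture i q.1 e with hp
  refine ⟨fun t => Function.update q.1 i (f (exp (-(2 * Real.pi * I * t)))),
    fun t => (hγ t).symm, ?_⟩
  obtain ⟨δ, hδ, hval⟩ := exists_val_exp_eq_localVal c hG q.2 i e
  rw [mem_ball_zero_iff] at hw
  have hfat : ContinuousAt f w := hfc.continuousAt
    (Filter.mem_of_superset (Metric.isOpen_ball.mem_nhds (mem_ball_zero_iff.mpr hw))
      Metric.ball_subset_closedBall)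
  have hnear : ∀ᶠ ζ in 𝓝 w, f ζ ∈ chart (localChart p) '' Metric.ball 0 δ := by
    refine hfat.eventually_mem ((isOpenMap_chart _ _ Metric.isOpen_ball).mem_nhds ?_)
    exact ⟨0, Metric.mem_ball_self hδ, by rw [chart_localChart_zero, hfw]⟩
  obtain ⟨ρ, hρ, hball⟩ := Metric.eventually_nhds_iff.mp hnear
  have e1 : ∀ᶠ ε in 𝓝[>] (0 : ℝ), ε ∈ Ioo 0 ρ := Ioo_mem_nhdsGT hρ
  have e2 : ∀ᶠ ε in 𝓝[>] (0 : ℝ), ε ∈ Ioo 0 (1 - ‖w‖) := Ioo_mem_nhdsGT (sub_pos.mpr hw)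
  obtain ⟨ε, ⟨L, hLc, hLf, hL1⟩, ⟨hε0, hερ⟩, -, hεw⟩ :=
    (Filter.Eventually.and hor (Filter.Eventually.and e1 e2)).exists
  have hunit : ∀ t : ℝ, ‖exp (2 * Real.pi * I * t)‖ = 1 := fun t => by
    rw [show (2 * Real.pi * I * t : ℂ) = ((2 * Real.pi * t : ℝ) : ℂ) * I by push_cast; ring,
      norm_exp_ofReal_mul_I]
  -- the small circle
  have hsmall : c.val (fun t => Function.update q.1 i (f (w + ε * exp (2 * Real.pi * I * t)))) =
      localVal c hG i q.1 e := by
    have hη : ∀ t ∈ Icc (0 : ℝ) 1, ‖exp (L t)‖ < δ ∧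
        f (w + ε * exp (2 * Real.pi * I * t)) = chart (localChart p) (exp (L t)) := by
      intro t ht
      obtain ⟨η, hη, hηf⟩ := hball (y := w + ε * exp (2 * Real.pi * I * t)) (by
        rw [dist_eq, add_sub_cancel_left, norm_mul, hunit, mul_one, norm_real,
          Real.norm_of_nonneg hε0.le]
        exact hερ)
      have h1 := hLf t ht
      rw [hfw, ← hηf, localCoord_chart_localChart] at h1
      rw [← h1, ← hηf]
      exact ⟨mem_ball_zero_iff.mp hη, rfl⟩
    rw [← hval L hLc (fun t ht => (hη t ht).1) hL1]
    exact c.congr fun t ht => congrArg _ (hη t ht).2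
  -- shrink the boundary of the disc to the small circle
  have hin : ∀ x ∈ Icc (0 : ℝ) 1 ×ˢ Icc (0 : ℝ) 1,
      (x.1 : ℂ) * w + (1 - x.1 + x.1 * ε) * exp (2 * Real.pi * I * (x.2 : ℝ)) ∈
        Metric.closedBall (0 : ℂ) 1 ∧
      (x.1 : ℂ) * w + (1 - x.1 + x.1 * ε) * exp (2 * Real.pi * I * (x.2 : ℝ)) ≠ w := by
    rintro ⟨s, t⟩ ⟨hs, -⟩
    replace hs : 0 ≤ s ∧ s ≤ 1 := hs
    simp only
    have hpos : 0 < 1 - s + s * ε := by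
      have : ε ≤ 1 := by linarith [norm_nonneg w]
      nlinarith [mul_nonneg (sub_nonneg.mpr hs.2) (sub_nonneg.mpr this)]
    have hnorm : ‖((1 - s + s * ε : ℂ)) * exp (2 * Real.pi * I * t)‖ = 1 - s + s * ε := by
      rw [norm_mul, hunit, mul_one, show (1 - s + s * ε : ℂ) = ((1 - s + s * ε : ℝ) : ℂ) by
        push_cast; ring, norm_real, Real.norm_of_nonneg hpos.le]
    constructor
    · rw [mem_closedBall_zero_iff]
      refine (norm_add_le _ _).trans ?_
      rw [hnorm, norm_mul, norm_real, Real.norm_of_nonneg hs.1]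
      nlinarith [hs.1]
    · intro h
      have h1 : ((1 - s + s * ε : ℂ)) * exp (2 * Real.pi * I * t) = ((1 - s : ℝ) : ℂ) * w := by
        push_cast
        linear_combination h
      have h2 := congrArg norm h1
      rw [hnorm, norm_mul, norm_real, Real.norm_of_nonneg (by linarith [hs.2])] at h2
      nlinarith [hs.1, hs.2]
  have hmem : ∀ ζ ∈ Metric.closedBall (0 : ℂ) 1, ζ ≠ w →
      Function.update q.1 i (f ζ) ∈ orbitConfig G n := by
    intro ζ hζ hζw
    refine update_mem_orbitConfig q.2 fun e' he' => hζw ?_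
    have : f ζ ∈ f '' Metric.closedBall 0 1 ∩ punctures q i :=
      ⟨⟨ζ, hζ, rfl⟩, by rw [punctures_eq_range]; exact ⟨e', he'⟩⟩
    rw [hdisc, mem_singleton_iff, ← hfw] at this
    exact hfi hζ (mem_closedBall_zero_iff.mpr hw.le) this
  have hcont : ContinuousOn (fun ζ => Function.update q.1 i (f ζ)) (Metric.closedBall 0 1) := by
    have : Continuous fun y : OnePoint ℂ => Function.update q.1 i y := by fun_prop
    exact this.comp_continuousOn hfc
  have hhom := PathCocycle.val_eq_of_free_homotopy (c := c)
    (fun x => Function.update q.1 i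
      (f ((x.1 : ℂ) * w + (1 - x.1 + x.1 * ε) * exp (2 * Real.pi * I * (x.2 : ℝ)))))
    (hcont.comp (f := fun x : ℝ × ℝ =>
      (x.1 : ℂ) * w + (1 - x.1 + x.1 * ε) * exp (2 * Real.pi * I * (x.2 : ℝ)))
      (by fun_prop) fun x hx => (hin x hx).1)
    (fun x hx => hmem _ (hin x hx).1 (hin x hx).2)
    (fun s _ => by simp [exp_two_pi_mul_I])
  simp only [ofReal_zero, zero_mul, sub_zero, add_zero, zero_add, one_mul, ofReal_one,
    sub_self] at hhom
  rw [hsmall] at hhom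
  rw [← hhom]
  have hcb : ∀ t : ℝ, exp (2 * Real.pi * I * t) ∈ Metric.closedBall (0 : ℂ) 1 := fun t => by
    rw [mem_closedBall_zero_iff, hunit]
  rw [← PathCocycle.val_reverse (c := c)
    (f := fun t : ℝ => Function.update q.1 i (f (exp (2 * Real.pi * I * t))))
    (hcont.comp (f := fun t : ℝ => exp (2 * Real.pi * I * t)) (by fun_prop) fun t _ => hcb t)
    (fun t _ => hmem _ (hcb t) fun h => by
      have := hunit t
      rw [h] at this
      linarith)]
  refine c.congr fun t _ => ?_
  congr 2
  rw [ofReal_sub, ofReal_one, mul_sub, mul_one, exp_sub, exp_two_pi_mul_I, exp_neg, one_div]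

end LocalClasses

/-! ### Adapted discs and tori of configurations -/

section Tori

open Set Topology Filter Complex OnePoint

variable {G : Subgroup (Equiv.Perm (OnePoint ℂ))} {n : ℕ}

/-- A matrix in `SU₂` giving the homography `g`. -/
def smulMatrix (hG : G ≤ PSU2) (g : G) : GL (Fin 2) ℂ := (exists_SU2_smul_eq hG g).choose

theorem smulMatrix_mem (hG : G ≤ PSU2) (g : G) : smulMatrix hG g ∈ SU2 :=
  (exists_SU2_smul_eq hG g).choose_spec.1

theorem smulMatrix_smul (hG : G ≤ PSU2) (g : G) (z : OnePoint ℂ) : smulMatrix hG g • z = g • z :=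
  ((exists_SU2_smul_eq hG g).choose_spec.2 z).symm

theorem chart_smulMatrix_mul (hG : G ≤ PSU2) (g : G) (M : GL (Fin 2) ℂ) (w : ℂ) :
    chart (smulMatrix hG g * M) w = g • chart M w := by
  rw [chart_mul, smulMatrix_smul]

variable (G) in
/-- The exceptional points and the orbits of the points of a configuration. -/
def avoided (z : Fin n → OnePoint ℂ) : Set (OnePoint ℂ) :=
  exceptional G ∪ ⋃ k, MulAction.orbit G (z k)

theorem smul_mem_avoided_iff (g : G) {z : Fin n → OnePoint ℂ} {x : OnePoint ℂ} :
    g • x ∈ avoided G z ↔ x ∈ avoided G z := by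
  simp only [avoided, mem_union, mem_iUnion, smul_mem_exceptional_iff]
  refine or_congr Iff.rfl (exists_congr fun k => ?_)
  rw [← MulAction.orbit_eq_iff, ← MulAction.orbit_eq_iff (b := z k), MulAction.orbit_smul]

theorem update_mem_of_notMem_avoided {z : Fin n → OnePoint ℂ} (hz : z ∈ orbitConfig G n)
    {x : OnePoint ℂ} (hx : x ∉ avoided G z) (a : Fin n) :
    Function.update z a x ∈ orbitConfig G n := by
  refine update_mem_orbitConfig hz ?_
  rintro (p | ⟨j, g⟩) rfl
  · exact hx (Or.inl p.2)
  · exact hx (Or.inr (mem_iUnion.mpr ⟨j, g, rfl⟩))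

theorem update_update_mem {z : Fin n → OnePoint ℂ} (hz : z ∈ orbitConfig G n)
    {x y : OnePoint ℂ} (hx : x ∉ avoided G z) (hy : y ∉ avoided G z) (hxy : ∀ g : G, g • x ≠ y)
    (a b : Fin n) : Function.update (Function.update z a x) b y ∈ orbitConfig G n := by
  refine update_mem_orbitConfig (update_mem_of_notMem_avoided hz hx a) ?_
  rintro (p | ⟨j, g⟩) rfl
  · exact hy (Or.inl p.2)
  · by_cases hj : j.1 = a
    · refine hxy g ?_
      simp [puncture, hj]
    · refine hy (Or.inr (mem_iUnion.mpr ⟨j, g, ?_⟩))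
      simp [puncture, Function.update_of_ne hj]

/-- When only the `k`-th point has moved, a puncture is an image of that point, or is avoided by
the initial configuration. -/
theorem puncture_update_cases {z : Fin n → OnePoint ℂ} {i k : Fin n} (hki : k ≠ i) (y : OnePoint ℂ)
    (e : PunctureIdx G i) : puncture i (Function.update z k y) e ∈ avoided G z ∨
      ∃ h : G, e = Sum.inr (⟨k, hki⟩, h) ∧ puncture i (Function.update z k y) e = h • y := by
  rcases e with p | ⟨⟨j, hj⟩, g⟩
  · exact Or.inl (Or.inl p.2)
  · by_cases hjk : j = k
    · subst hjk
      exact Or.inr ⟨g, rfl, by simp [puncture]⟩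
    · refine Or.inl (Or.inr (mem_iUnion.mpr ⟨j, g, ?_⟩))
      simp [puncture, Function.update_of_ne hjk]

section Radius

variable [Finite G]

theorem finite_avoided (hG : G ≤ PSU2) (z : Fin n → OnePoint ℂ) : (avoided G z).Finite :=
  (finite_exceptional hG).union (finite_iUnion fun _ => finite_range _)

theorem exists_radius_notMem {F : Set (OnePoint ℂ)} (hF : F.Finite) (M : GL (Fin 2) ℂ) :
    ∃ ρ > 0, ∀ u : ℂ, u ≠ 0 → ‖u‖ < ρ → chart M u ∉ F := by
  have h0 : ∀ᶠ x in 𝓝 (chart M 0), x ∉ F \ {chart M 0} :=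
    (hF.subset sdiff_subset).isClosed.isOpen_compl.mem_nhds (by simp)
  obtain ⟨ρ, hρ, h⟩ := Metric.eventually_nhds_iff.mp
    ((continuous_chart M).continuousAt.eventually h0)
  refine ⟨ρ, hρ, fun u hu huρ huF => h (by rwa [dist_zero_right]) ⟨huF, fun e => ?_⟩⟩
  exact hu (chart_injective M e)

theorem exists_radius_smul (hG : G ≤ PSU2) (M N : GL (Fin 2) ℂ) :
    ∃ ρ > 0, ∀ (g : G) (u v : ℂ), ‖u‖ < ρ → ‖v‖ < ρ → g • chart M u = chart N v →
      g • chart M 0 = chart N 0 := by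
  have h : ∀ᶠ x in 𝓝 ((0 : ℂ), (0 : ℂ)), ∀ g : G, g • chart M x.1 = chart N x.2 →
      g • chart M 0 = chart N 0 := by
    rw [eventually_all]
    intro g
    by_cases hg : g • chart M 0 = chart N 0
    · exact Eventually.of_forall fun _ _ => hg
    have hcl : IsClosed {x : ℂ × ℂ | g • chart M x.1 = chart N x.2} :=
      isClosed_eq ((continuous_smul_of_le_PSU2 hG g).comp
        ((continuous_chart M).comp continuous_fst)) ((continuous_chart N).comp continuous_snd)
    filter_upwards [hcl.isOpen_compl.mem_nhds hg] with x hx hx' using absurd hx' hx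
  obtain ⟨ρ, hρ, h⟩ := Metric.eventually_nhds_iff.mp h
  refine ⟨ρ, hρ, fun g u v hu hv hg => h (y := (u, v)) ?_ g hg⟩
  rw [Prod.dist_eq, dist_zero_right, dist_zero_right]
  exact max_lt hu hv

/-- The unitary chart `U` and the radius `ρ` are such that the disc of radius `ρ` contains no point
avoided by the configuration `z`, except possibly for its center, and that two points of the disc
in the same orbit differ by an element of the stabilizer of the center. -/
structure IsAdapted (z : Fin n → OnePoint ℂ) (U : GL (Fin 2) ℂ) (ρ : ℝ) : Prop where
  mem : U ∈ SU2
  pos : 0 < ρ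
  smul_center : ∀ (g : G) (u v : ℂ), ‖u‖ < ρ → ‖v‖ < ρ → g • chart U u = chart U v →
    g • chart U 0 = chart U 0
  notMem : ∀ u : ℂ, u ≠ 0 → ‖u‖ < ρ → chart U u ∉ avoided G z

theorem exists_isAdapted (hG : G ≤ PSU2) (z : Fin n → OnePoint ℂ) (p : OnePoint ℂ) :
    ∃ U ρ, chart U 0 = p ∧ IsAdapted (G := G) z U ρ := by
  obtain ⟨U, hU, hp⟩ := exists_SU2_smul_zero p
  obtain ⟨ρ, hρ, h1⟩ := exists_radius_smul hG U U
  obtain ⟨ρ', hρ', h2⟩ := exists_radius_notMem (finite_avoided hG z) U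
  exact ⟨U, min ρ ρ', hp, hU, lt_min hρ hρ',
    fun g u v hu hv => h1 g u v (lt_min_iff.mp hu).1 (lt_min_iff.mp hv).1,
    fun u hu hu' => h2 u hu (lt_min_iff.mp hu').2⟩

end Radius

theorem smul_smul_eq_iff_inv_mul_mul {g₁ g₂ h : G} {x y : OnePoint ℂ} :
    h • g₁ • x = g₂ • y ↔ (g₂⁻¹ * h * g₁) • x = y := by
  rw [mul_smul, mul_smul, inv_smul_eq_iff]

namespace IsAdapted

variable {z : Fin n → OnePoint ℂ} {U : GL (Fin 2) ℂ} {ρ : ℝ}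

/-- The stabilizer of the center acts on the disc by rotations. -/
theorem exists_rotation (had : IsAdapted (G := G) z U ρ) (hG : G ≤ PSU2)
    {g : G} (hg : g • chart U 0 = chart U 0) :
    ∃ ζ : ℂ, ‖ζ‖ = 1 ∧ ∀ w, g • chart U w = chart U (ζ * w) := by
  obtain ⟨ζ, hζ, h⟩ := exists_rotation_of_fixes_zero (B := U⁻¹ * smulMatrix hG g * U)
    (mul_mem (mul_mem (inv_mem had.mem) (smulMatrix_mem hG g)) had.mem) (by
      rw [mul_smul, mul_smul, smulMatrix_smul, inv_smul_eq_iff]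
      exact hg)
  refine ⟨ζ, hζ, fun w => ?_⟩
  have := h w
  rw [mul_smul, mul_smul, smulMatrix_smul, inv_smul_eq_iff] at this
  exact this

theorem norm_eq (had : IsAdapted (G := G) z U ρ) (hG : G ≤ PSU2) {g : G} {u v : ℂ}
    (hu : ‖u‖ < ρ) (hv : ‖v‖ < ρ)
    (h : g • chart U u = chart U v) : ‖u‖ = ‖v‖ := by
  obtain ⟨ζ, hζ, hr⟩ := had.exists_rotation hG (had.smul_center g u v hu hv h)
  rw [← chart_injective U ((hr u).symm.trans h), norm_mul, hζ, one_mul]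

theorem smul_notMem (had : IsAdapted (G := G) z U ρ) (g : G) {u : ℂ} (hu0 : u ≠ 0) (hu : ‖u‖ < ρ) :
    g • chart U u ∉ avoided G z := by
  rw [smul_mem_avoided_iff]
  exact had.notMem u hu0 hu

theorem eq_zero_or_of_eq_puncture (had : IsAdapted (G := G) z U ρ) {i k : Fin n}
    (hki : k ≠ i) {y : OnePoint ℂ}
    {e : PunctureIdx G i} {g : G} {w : ℂ} (hw : ‖w‖ < ρ)
    (h : g • chart U w = puncture i (Function.update z k y) e) :
    w = 0 ∨ ∃ h : G, e = Sum.inr (⟨k, hki⟩, h) ∧ h • y = g • chart U w := by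
  by_cases hw0 : w = 0
  · exact Or.inl hw0
  · rcases puncture_update_cases hki y e with h' | ⟨h', he, h''⟩
    · rw [← h] at h'
      exact absurd h' (had.smul_notMem g hw0 hw)
    · exact Or.inr ⟨h', he, h''.symm.trans h.symm⟩

/-- Two points near the same orbit, at different distances from it. -/
theorem update_update_mem (had : IsAdapted (G := G) z U ρ) (hG : G ≤ PSU2)
    (hz : z ∈ orbitConfig G n) {u v : ℂ} (hu0 : u ≠ 0) (hv0 : v ≠ 0) (hu : ‖u‖ < ρ) (hv : ‖v‖ < ρ)
    (huv : ‖u‖ ≠ ‖v‖) (g₁ g₂ : G) (a b : Fin n) :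
    Function.update (Function.update z a (g₁ • chart U u)) b (g₂ • chart U v) ∈ orbitConfig G n :=
  OrbitConf.update_update_mem hz (had.smul_notMem g₁ hu0 hu) (had.smul_notMem g₂ hv0 hv)
    (fun _ hh => huv (had.norm_eq hG hu hv (smul_smul_eq_iff_inv_mul_mul.mp hh))) a b

end IsAdapted

variable {A : Type*} [LieRing A] {c : PathCocycle (orbitConfig G n) A}

/-- The values of `c` on the two sides of a torus of configurations commute. -/
def TorusCommutes (c : PathCocycle (orbitConfig G n) A) : Prop :=
  ∀ T : ℝ × ℝ → Fin n → OnePoint ℂ, Continuous T → (∀ x, T x ∈ orbitConfig G n) →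
    (∀ s, T (0, s) = T (1, s)) → (∀ s, T (s, 0) = T (s, 1)) →
    ⁅c.val (fun t => T (t, 0)), c.val (fun t => T (0, t))⁆ = 0

theorem circleMap_two_pi_zero (a : ℂ) (r : ℝ) : circleMap a r (2 * Real.pi * 0) = a + r := by
  simp [circleMap]

theorem circleMap_two_pi_one (a : ℂ) (r : ℝ) : circleMap a r (2 * Real.pi * 1) = a + r := by
  simp [circleMap, exp_two_pi_mul_I]

theorem norm_circleMap_sub {a : ℂ} {r : ℝ} (hr : 0 ≤ r) (θ : ℝ) : ‖circleMap a r θ - a‖ = r :=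
  mem_sphere_iff_norm.mp (circleMap_mem_sphere a hr θ)

/-- Two points of a configuration moving independently along circles form a torus. -/
theorem lie_circVal_circVal (hc : TorusCommutes c) {z : Fin n → OnePoint ℂ} {a b : Fin n}
    (hab : a ≠ b) {M N : GL (Fin 2) ℂ} {x y : ℂ} {r s : ℝ} (hr : 0 ≤ r) (hs : 0 ≤ s)
    (hm : ∀ u v, ‖u - x‖ = r → ‖v - y‖ = s →
      Function.update (Function.update z a (chart M u)) b (chart N v) ∈ orbitConfig G n) :
    ⁅circVal c a (Function.update z b (chart N (y + s))) M x r,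
      circVal c b (Function.update z a (chart M (x + r))) N y s⁆ = 0 := by
  have hM := continuous_chart M
  have hN := continuous_chart N
  have key := hc (fun t => Function.update (Function.update z a
    (chart M (circleMap x r (2 * Real.pi * t.1)))) b (chart N (circleMap y s (2 * Real.pi * t.2))))
    (by fun_prop)
    (fun t => hm _ _ (norm_circleMap_sub hr _) (norm_circleMap_sub hs _))
    (fun t => by simp only [circleMap_two_pi_zero, circleMap_two_pi_one])
    (fun t => by simp only [circleMap_two_pi_zero, circleMap_two_pi_one])
  simp only [circleMap_two_pi_zero] at key
  rw [circVal, circVal]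
  simpa only [Function.update_comm hab.symm] using key

end Tori

/-! ### The linear relations between local values -/

section Relations

open Set Topology Filter Complex OnePoint

variable {G : Subgroup (Equiv.Perm (OnePoint ℂ))} {n : ℕ} [Finite G]

section Additive

variable {A : Type*} [AddCommGroup A] {c : PathCocycle (orbitConfig G n) A}
  {z : Fin n → OnePoint ℂ} {U : GL (Fin 2) ℂ} {ρ : ℝ}

/-- The sum of the local values vanishes: a circle around all punctures is, seen from the other
side, a circle around none. -/
theorem sum_localVal_eq_zero (c : PathCocycle (orbitConfig G n) A) (hG : G ≤ PSU2)
    (hz : z ∈ orbitConfig G n) (i : Fin n)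
    [Fintype (PunctureIdx G i)] : ∑ e : PunctureIdx G i, localVal c hG i z e = 0 := by
  set M := localChart (z i) with hM
  set N := M * swapGL with hN
  have hNinf : N • (∞ : OnePoint ℂ) = z i := by
    rw [hN, mul_smul, swapGL_smul_infty]
    exact chart_localChart_zero _
  have hMN : ∀ w : ℂ, w ≠ 0 → chart N w = chart M w⁻¹ := fun w hw => by
    rw [hN, chart, mul_smul, swapGL_smul_coe, if_neg hw]
    rfl
  have hcoord : ∀ e : PunctureIdx G i, ∃ w, chart N w = puncture i z e := fun e =>
    exists_chart_eq (by rw [hNinf]; exact puncture_ne_self hz i e)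
  choose w hw using hcoord
  obtain ⟨B, hB⟩ := (Set.finite_range fun e => ‖w e‖).bddAbove
  replace hB : ∀ e, ‖w e‖ ≤ B := fun e => hB ⟨e, rfl⟩
  -- the factor `4` is required by `circVal_eq_sum_localVal`
  set R := 4 * (|B| + 1) with hR
  have hR0 : 0 < R := by positivity
  have hwR : ∀ e, ‖w e‖ < R / 4 := fun e => by
    rw [hR]
    linarith [hB e, le_abs_self B]
  rw [← circVal_eq_sum_localVal hG hz i (M := N) (a := 0) hR0 Finset.univ
    (fun e _ => ⟨w e, hw e, by rw [sub_zero]; exact hwR e⟩)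
    (fun e he => absurd (Finset.mem_univ e) he)]
  have hout : ∀ (e : PunctureIdx G i) (v : ℂ), chart M v = puncture i z e → R⁻¹ < ‖v‖ := by
    intro e v hv
    have hv0 : v ≠ 0 := by
      rintro rfl
      exact puncture_ne_self hz i e (hv.symm.trans (chart_localChart_zero _))
    have h1 : chart N v⁻¹ = chart N (w e) := by
      rw [hMN _ (inv_ne_zero hv0), inv_inv, hv, hw]
    have h2 := hwR e
    rw [← chart_injective N h1, norm_inv] at h2
    rw [inv_lt_comm₀ hR0 (norm_pos_iff.mpr hv0)]
    linarith
  have hsmall := circVal_eq_sum_localVal (c := c) hG hz i (M := M) (a := 0) (inv_pos.mpr hR0) ∅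
    (fun e he => absurd he (Finset.notMem_empty e))
    (fun e _ v hv => by rw [sub_zero]; exact hout e v hv)
  rw [Finset.sum_empty] at hsmall
  have hMc := continuous_chart M
  refine Eq.trans ?_ (neg_eq_zero.mpr hsmall)
  rw [circVal, circVal, ← PathCocycle.val_reverse (c := c) (f := fun t =>
    Function.update z i (chart M (circleMap 0 R⁻¹ (2 * Real.pi * t))))
    (Continuous.continuousOn (by fun_prop))
    (fun t _ => update_mem_orbitConfig hz fun e he => by
      have h1 := hout e _ he.symm
      have h2 := norm_circleMap_sub (a := 0) (inv_pos.mpr hR0).le (2 * Real.pi * t)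
      rw [sub_zero] at h2
      linarith)]
  refine c.congr fun t _ => congrArg _ ?_
  rw [hMN _ (circleMap_ne_center hR0.ne'), circleMap, circleMap]
  congr 1
  push_cast
  rw [zero_add, zero_add, mul_inv, ← exp_neg]
  congr 1
  rw [← exp_periodic]
  congr 1
  ring

/-- The local classes of the `i`-th point around `g • z_j` and of the `j`-th point around
`g⁻¹ • z_i` agree: the two points can turn around each other. -/
theorem localVal_symm (c : PathCocycle (orbitConfig G n) A) (hG : G ≤ PSU2)
    (hz : z ∈ orbitConfig G n) {i j : Fin n} (hij : i ≠ j) (g : G) :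
    localVal c hG i z (Sum.inr (⟨j, hij.symm⟩, g)) =
      localVal c hG j z (Sum.inr (⟨i, hij⟩, g⁻¹)) := by
  obtain ⟨U, ρ, hp, had⟩ := exists_isAdapted hG z (z j)
  have htriv : ∀ (h : G) (u v : ℂ), ‖u‖ < ρ → ‖v‖ < ρ → h • chart U u = chart U v → h = 1 := by
    intro h u v hu hv huv
    have := had.smul_center h u v hu hv huv
    rw [hp] at this
    exact smul_right_injective_of_notMem_exceptional (hz.1 j) (by rw [this, one_smul])
  have hρ := had.pos
  -- the disc of center `a` and radius `r` lies in the disc of radius `ρ` and does not contain `0`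
  set a : ℝ := ρ / 2 with ha
  set r : ℝ := ρ / 4 with hr
  have hr0 : 0 < r := by rw [hr]; linarith
  have hball : ∀ w : ℂ, ‖w - a‖ ≤ r → ‖w‖ < ρ ∧ w ≠ 0 := by
    intro w hw
    have h2 : ‖(a : ℂ)‖ = a := by rw [norm_real, Real.norm_of_nonneg (by linarith)]
    constructor
    · have := norm_add_le (w - a) (a : ℂ)
      rw [sub_add_cancel] at this
      linarith
    · rintro rfl
      rw [zero_sub, norm_neg] at hw
      linarith
  have haρ := hball a (by simp [hr0.le])
  have hmem : ∀ u v : ℂ, ‖u - a‖ ≤ r → ‖v - a‖ ≤ r → u ≠ v →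
      Function.update (Function.update z j (chart U u)) i (g • chart U v) ∈ orbitConfig G n := by
    intro u v hu hv huv
    refine update_update_mem hz (had.notMem u (hball u hu).2 (hball u hu).1)
      (had.smul_notMem g (hball v hv).2 (hball v hv).1) ?_ _ _
    intro h hh
    have h1 := htriv (g⁻¹ * h) u v (hball u hu).1 (hball v hv).1 (by
      rw [mul_smul, hh, inv_smul_smul])
    rw [inv_mul_eq_one.mp h1] at hh
    exact huv (chart_injective U (MulAction.injective h hh))
  set M := smulMatrix hG g * U with hM
  have hMc : ∀ w, chart M w = g • chart U w := chart_smulMatrix_mul hG g U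
  have hzj : Function.update z j (chart U a) ∈ orbitConfig G n :=
    update_mem_of_notMem_avoided hz (had.notMem _ haρ.2 haρ.1) _
  have hzi : Function.update z i (chart M a) ∈ orbitConfig G n := by
    rw [hMc]
    exact update_mem_of_notMem_avoided hz (had.smul_notMem g haρ.2 haρ.1) _
  have e1 : circVal c i (Function.update z j (chart U a)) M a r =
      localVal c hG i z (Sum.inr (⟨j, hij.symm⟩, g)) := by
    rw [circVal_eq_sum_localVal hG hzj i hr0 {Sum.inr (⟨j, hij.symm⟩, g)}, Finset.sum_singleton,
      localVal_eq hG i _ hzj hz]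
    · intro e he
      rw [Finset.mem_singleton] at he
      subst he
      exact ⟨a, by simp [puncture, hMc], by simpa using hr0⟩
    · intro e he w hw
      by_contra! hle
      rw [hMc] at hw
      rcases had.eq_zero_or_of_eq_puncture hij.symm (hball w hle).1 hw with h0 | ⟨h, rfl, hh⟩
      · exact (hball w hle).2 h0
      · have h1 := htriv (g⁻¹ * h) a w haρ.1 (hball w hle).1 (by
          rw [mul_smul, hh, inv_smul_smul])
        rw [inv_mul_eq_one.mp h1] at he
        exact he (Finset.mem_singleton_self _)
  have e2 : circVal c j (Function.update z i (chart M a)) U a r =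
      localVal c hG j z (Sum.inr (⟨i, hij⟩, g⁻¹)) := by
    rw [circVal_eq_sum_localVal hG hzi j hr0 {Sum.inr (⟨i, hij⟩, g⁻¹)}, Finset.sum_singleton,
      localVal_eq hG j _ hzi hz]
    · intro e he
      rw [Finset.mem_singleton] at he
      subst he
      exact ⟨a, by simp [puncture, hMc], by simpa using hr0⟩
    · intro e he w hw
      by_contra! hle
      rw [← one_smul G (chart U w)] at hw
      rcases had.eq_zero_or_of_eq_puncture hij (hball w hle).1 hw with h0 | ⟨h, rfl, hh⟩
      · exact (hball w hle).2 h0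
      · have h1 := htriv (h * g) a w haρ.1 (hball w hle).1 (by
          rw [mul_smul, ← hMc, hh, one_smul])
        rw [eq_inv_of_mul_eq_one_left h1] at he
        exact he (Finset.mem_singleton_self _)
  rw [← e1, ← e2, circVal, circVal]
  -- the difference of the two coordinates is kept of modulus `r`, and is turned by half a turn
  have hU := continuous_chart U
  have hM' := continuous_chart M
  have hd : ∀ s t : ℝ, ‖(r * exp ((2 * Real.pi * t + Real.pi * s) * I) : ℂ)‖ = r := fun s t => by
    rw [show ((2 * Real.pi * t + Real.pi * s) * I : ℂ) =
      ((2 * Real.pi * t + Real.pi * s : ℝ) : ℂ) * I by push_cast; ring, norm_mul,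
      norm_exp_ofReal_mul_I, mul_one, norm_real, Real.norm_of_nonneg hr0.le]
  have key := PathCocycle.val_eq_of_free_homotopy (c := c)
    (fun x => Function.update (Function.update z j
      (chart U (a - x.1 * (r * exp ((2 * Real.pi * (x.2 : ℝ) + Real.pi * (x.1 : ℝ)) * I))))) i
      (chart M (a + (1 - x.1) * (r * exp ((2 * Real.pi * (x.2 : ℝ) + Real.pi * (x.1 : ℝ)) * I)))))
    (Continuous.continuousOn (by fun_prop)) (by
      rintro ⟨s, t⟩ ⟨hs, -⟩
      replace hs : 0 ≤ s ∧ s ≤ 1 := hs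
      simp only [hMc]
      refine hmem _ _ ?_ ?_ ?_
      · rw [sub_sub_cancel_left, norm_neg, norm_mul, hd, norm_real, Real.norm_of_nonneg hs.1]
        nlinarith
      · rw [add_sub_cancel_left, norm_mul, hd, ← ofReal_one, ← ofReal_sub, norm_real,
          Real.norm_of_nonneg (by linarith)]
        nlinarith
      · intro h
        have h0 : (r * exp ((2 * Real.pi * t + Real.pi * s) * I) : ℂ) = 0 := by
          linear_combination -h
        have h1 := hd s t
        rw [h0, norm_zero] at h1
        linarith) (by
      intro s _
      have : exp ((2 * Real.pi * (1 : ℝ) + Real.pi * s) * I) =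
          exp ((2 * Real.pi * (0 : ℝ) + Real.pi * s) * I) := by
        rw [← exp_periodic ((2 * Real.pi * (0 : ℝ) + Real.pi * s) * I)]
        congr 1
        push_cast
        ring
      simp only [this])
  refine Eq.trans ?_ (key.trans ?_)
  · refine c.congr fun t _ => ?_
    simp [circleMap]
  · refine c.congr fun t _ => ?_
    simp only [Function.update_comm hij.symm]
    have : exp ((2 * Real.pi * t + Real.pi) * I) = - exp (2 * Real.pi * t * I) := by
      rw [add_mul, exp_add, exp_pi_mul_I, mul_neg_one]
    simp [circleMap, this]

end Additive

end Relations

/-! ### The quadratic relations between local values -/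

section Relations

open Set Topology Filter Complex OnePoint

variable {G : Subgroup (Equiv.Perm (OnePoint ℂ))} {n : ℕ} [Finite G]

section Additive

variable {A : Type*} [AddCommGroup A] {c : PathCocycle (orbitConfig G n) A}
  {z : Fin n → OnePoint ℂ} {U : GL (Fin 2) ℂ} {ρ : ℝ}

/-- The circle of the point closer to the center encloses the center only. -/
theorem IsAdapted.circVal_inner (had : IsAdapted (G := G) z U ρ) (hG : G ≤ PSU2)
    (hz : z ∈ orbitConfig G n) {a b : Fin n} (hab : a ≠ b) (g₁ g₂ : G) {e : PunctureIdx G a}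
    (he : ∀ y, puncture a (Function.update z b y) e = g₁ • chart U 0) {r : ℝ} {v : ℂ} (hr : 0 < r)
    (hrv : r < ‖v‖) (hv : ‖v‖ < ρ) :
    circVal c a (Function.update z b (g₂ • chart U v)) (smulMatrix hG g₁ * U) 0 r =
      localVal c hG a z e := by
  have hv0 : v ≠ 0 := norm_pos_iff.mp (hr.trans hrv)
  have hzb : Function.update z b (g₂ • chart U v) ∈ orbitConfig G n :=
    update_mem_of_notMem_avoided hz (had.smul_notMem g₂ hv0 hv) b
  rw [circVal_eq_sum_localVal hG hzb a hr {e}, Finset.sum_singleton, localVal_eq hG a e hzb hz]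
  · intro e' he'
    rw [Finset.mem_singleton] at he'
    subst he'
    exact ⟨0, by rw [chart_smulMatrix_mul, he], by simpa using hr⟩
  · intro e' he' w hw
    by_contra! hle
    rw [sub_zero] at hle
    rw [chart_smulMatrix_mul] at hw
    rcases had.eq_zero_or_of_eq_puncture hab.symm (hle.trans_lt (hrv.trans hv)) hw with
      rfl | ⟨h, rfl, hh⟩
    · rw [← he (g₂ • chart U v)] at hw
      exact he' (Finset.mem_singleton.mpr (puncture_injective hzb a hw.symm))
    · have := had.norm_eq hG hv (hle.trans_lt (hrv.trans hv)) (smul_smul_eq_iff_inv_mul_mul.mp hh)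
      linarith

/-- The circle of the point farther away from the center encloses the center and the images of the
other point by the stabilizer of the center. -/
theorem IsAdapted.circVal_outer (had : IsAdapted (G := G) z U ρ) (hG : G ≤ PSU2)
    (hz : z ∈ orbitConfig G n) {a b : Fin n} (hab : a ≠ b) (g₁ g₂ : G) {e : PunctureIdx G b}
    (he : ∀ y, puncture b (Function.update z a y) e = g₂ • chart U 0) {s : ℝ} {u : ℂ} (hu0 : u ≠ 0)
    (hus : ‖u‖ < s / 4) (hs : s < ρ) :
    circVal c b (Function.update z a (g₁ • chart U u)) (smulMatrix hG g₂ * U) 0 s =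
      localVal c hG b z e + ∑ᶠ h : MulAction.stabilizer G (chart U 0),
        localVal c hG b z (Sum.inr (⟨a, hab⟩, g₂ * h * g₁⁻¹)) := by
  classical
  have hs0 : 0 < s := by linarith [norm_nonneg u]
  have huρ : ‖u‖ < ρ := by linarith
  have hza : Function.update z a (g₁ • chart U u) ∈ orbitConfig G n :=
    update_mem_of_notMem_avoided hz (had.smul_notMem g₁ hu0 huρ) a
  have := Fintype.ofFinite (MulAction.stabilizer G (chart U 0))
  rw [finsum_eq_sum_of_fintype]
  set E : MulAction.stabilizer G (chart U 0) → PunctureIdx G b :=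
    fun h => Sum.inr (⟨a, hab⟩, g₂ * h * g₁⁻¹) with hE
  have hEinj : Function.Injective E := by
    intro h h' hh
    have := (Prod.ext_iff.mp (Sum.inr_injective hh)).2
    exact Subtype.ext (mul_left_cancel (mul_right_cancel this))
  have hEp : ∀ h, puncture b (Function.update z a (g₁ • chart U u)) (E h) =
      g₂ • (h : G) • chart U u := by
    intro h
    simp [hE, puncture, mul_smul]
  have heE : e ∉ Finset.univ.image E := by
    intro hmem
    obtain ⟨h, -, rfl⟩ := Finset.mem_image.mp hmem
    have h1 := he (g₁ • chart U u)
    rw [hEp] at h1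
    have h2 : (h : G) • chart U u = chart U 0 := MulAction.injective g₂ h1
    have h3 := had.norm_eq hG huρ (by simpa using had.pos) h2
    rw [norm_zero, norm_eq_zero] at h3
    exact hu0 h3
  rw [circVal_eq_sum_localVal hG hza b hs0 (insert e (Finset.univ.image E)),
    Finset.sum_insert heE, Finset.sum_image hEinj.injOn]
  · simp only [localVal_eq hG b _ hza hz]
    rfl
  · intro e' he'
    rw [Finset.mem_insert, Finset.mem_image] at he'
    rcases he' with rfl | ⟨h, -, rfl⟩
    · exact ⟨0, by rw [chart_smulMatrix_mul, he], by simpa using hs0⟩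
    · obtain ⟨ζ, hζ, hrot⟩ := had.exists_rotation hG h.2
      refine ⟨ζ * u, by rw [chart_smulMatrix_mul, hEp, hrot], ?_⟩
      rwa [sub_zero, norm_mul, hζ, one_mul]
  · intro e' he' w hw
    by_contra! hle
    rw [sub_zero] at hle
    rw [chart_smulMatrix_mul] at hw
    refine he' ?_
    rcases had.eq_zero_or_of_eq_puncture hab (hle.trans_lt hs) hw with rfl | ⟨h, rfl, hh⟩
    · rw [← he (g₁ • chart U u)] at hw
      rw [puncture_injective hza b hw.symm]
      exact Finset.mem_insert_self _ _
    · rw [smul_smul_eq_iff_inv_mul_mul] at hh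
      refine Finset.mem_insert_of_mem (Finset.mem_image.mpr
        ⟨⟨_, had.smul_center _ _ _ huρ (hle.trans_lt hs) hh⟩, Finset.mem_univ _, ?_⟩)
      simp [hE, mul_assoc]

/-- On a torus, the diagonal is the sum of the two sides. -/
theorem PathCocycle.val_diagonal {V : Type*} [TopologicalSpace V] {X : Set V}
    (c : PathCocycle X A) {T : ℝ × ℝ → V} (hT : Continuous T) (hm : ∀ x, T x ∈ X)
    (h1 : ∀ s, T (0, s) = T (1, s)) :
    c.val (fun t => T (t, t)) = c.val (fun t => T (t, 0)) + c.val (fun t => T (0, t)) := by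
  set d := c.comap (X' := univ) T hT.continuousOn fun x _ => hm x
  have hseg : ∀ {a b : ℝ × ℝ} {f : ℝ → V}, (∀ t ∈ Icc (0 : ℝ) 1,
      T (AffineMap.lineMap a b t) = f t) → d.seg a b = c.val f := fun h => c.congr h
  rw [← hseg (a := (0, 0)) (b := (1, 1)) (f := fun t => T (t, t)) fun t _ => by
      simp [AffineMap.lineMap_apply],
    ← hseg (a := (0, 0)) (b := (1, 0)) (f := fun t => T (t, 0)) fun t _ => by
      simp [AffineMap.lineMap_apply],
    ← hseg (a := (1, 0)) (b := (1, 1)) (f := fun t => T (0, t)) fun t _ => by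
      simp [AffineMap.lineMap_apply, h1]]
  exact (seg_add (d := d) convex_univ subset_rfl (mem_univ _) (mem_univ _) (mem_univ _)).symm

end Additive

section Lie

variable {A : Type*} [LieRing A] {c : PathCocycle (orbitConfig G n) A} {z : Fin n → OnePoint ℂ}

/-- Local classes of different points around different orbits commute. -/
theorem lie_localVal_of_disjoint (hc : TorusCommutes c) (hG : G ≤ PSU2)
    (hz : z ∈ orbitConfig G n) {a b : Fin n} (hab : a ≠ b) {e : PunctureIdx G a}
    {e' : PunctureIdx G b} (he : ∀ y, puncture a (Function.update z b y) e = puncture a z e)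
    (he' : ∀ y, puncture b (Function.update z a y) e' = puncture b z e')
    (hdis : ∀ g : G, g • puncture a z e ≠ puncture b z e') :
    ⁅localVal c hG a z e, localVal c hG b z e'⁆ = 0 := by
  obtain ⟨U, ρ₁, hU, hadU⟩ := exists_isAdapted hG z (puncture a z e)
  obtain ⟨W, ρ₂, hW, hadW⟩ := exists_isAdapted hG z (puncture b z e')
  obtain ⟨ρ₃, hρ₃, hdisj⟩ := exists_radius_smul hG U W
  rw [hU, hW] at hdisj
  have h1 := hadU.pos
  have h2 := hadW.pos
  obtain ⟨r, hr0, hr⟩ := exists_between (lt_min (lt_min h1 h2) hρ₃)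
  rw [lt_min_iff, lt_min_iff] at hr
  have hne : ∀ (g : G) (u v : ℂ), ‖u‖ ≤ r → ‖v‖ ≤ r → g • chart U u ≠ chart W v :=
    fun g u v hu hv h => hdis g (hdisj g u v (hu.trans_lt hr.2) (hv.trans_lt hr.2) h)
  have hn0 : ∀ u : ℂ, ‖u‖ = r → u ≠ 0 := fun u hu => norm_pos_iff.mp (hu ▸ hr0)
  have hrn : ‖(r : ℂ)‖ = r := by rw [norm_real, Real.norm_of_nonneg hr0.le]
  have hUr : chart U r ∉ avoided G z := hadU.notMem _ (hn0 _ hrn) (hrn.trans_lt hr.1.1)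
  have hWr : chart W r ∉ avoided G z := hadW.notMem _ (hn0 _ hrn) (hrn.trans_lt hr.1.2)
  have hzb := update_mem_of_notMem_avoided hz hWr b
  have hza := update_mem_of_notMem_avoided hz hUr a
  have key := lie_circVal_circVal hc (z := z) hab (M := U) (N := W) (x := 0) (y := 0) hr0.le hr0.le
    (fun u v hu hv => by
      rw [sub_zero] at hu hv
      exact update_update_mem hz (hadU.notMem u (hn0 u hu) (hu.trans_lt hr.1.1))
        (hadW.notMem v (hn0 v hv) (hv.trans_lt hr.1.2)) (fun g => hne g u v hu.le hv.le) a b)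
  rw [zero_add] at key
  rw [circVal_eq_sum_localVal hG hzb a hr0 {e}, circVal_eq_sum_localVal hG hza b hr0 {e'},
    Finset.sum_singleton, Finset.sum_singleton, localVal_eq hG a e hzb hz,
    localVal_eq hG b e' hza hz] at key
  · exact key
  · intro e₁ he₁
    rw [Finset.mem_singleton] at he₁
    subst he₁
    exact ⟨0, by rw [hW, he'], by simpa using hr0⟩
  · intro e₁ he₁ w hw
    by_contra! hle
    rw [sub_zero] at hle
    rw [← one_smul G (chart W w)] at hw
    rcases hadW.eq_zero_or_of_eq_puncture hab (hle.trans_lt hr.1.2) hw with rfl | ⟨h, rfl, hh⟩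
    · rw [one_smul, hW, ← he' (chart U r)] at hw
      exact he₁ (Finset.mem_singleton.mpr (puncture_injective hza b hw.symm))
    · rw [one_smul] at hh
      exact hne h r w hrn.le hle hh
  · intro e₁ he₁
    rw [Finset.mem_singleton] at he₁
    subst he₁
    exact ⟨0, by rw [hU, he], by simpa using hr0⟩
  · intro e₁ he₁ w hw
    by_contra! hle
    rw [sub_zero] at hle
    rw [← one_smul G (chart U w)] at hw
    rcases hadU.eq_zero_or_of_eq_puncture hab.symm (hle.trans_lt hr.1.1) hw with
      rfl | ⟨h, rfl, hh⟩
    · rw [one_smul, hU, ← he (chart W r)] at hw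
      exact he₁ (Finset.mem_singleton.mpr (puncture_injective hzb a hw.symm))
    · rw [one_smul] at hh
      exact hne h⁻¹ w r hle hrn.le (by rw [← hh, inv_smul_smul])

/-- The local class of a point around `p` commutes with the sum of those of another point around
`p` and around the images of the first point by the stabilizer of `p`. -/
theorem lie_localVal_nested (hc : TorusCommutes c) (hG : G ≤ PSU2)
    (hz : z ∈ orbitConfig G n) {a b : Fin n} (hab : a ≠ b) (p : OnePoint ℂ) (g₁ g₂ : G)
    {e : PunctureIdx G a} {e' : PunctureIdx G b}
    (he : ∀ y, puncture a (Function.update z b y) e = g₁ • p)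
    (he' : ∀ y, puncture b (Function.update z a y) e' = g₂ • p) :
    ⁅localVal c hG a z e, localVal c hG b z e' + ∑ᶠ h : MulAction.stabilizer G p,
        localVal c hG b z (Sum.inr (⟨a, hab⟩, g₂ * h * g₁⁻¹))⁆ = 0 := by
  obtain ⟨U, ρ, rfl, had⟩ := exists_isAdapted hG z p
  have hρ := had.pos
  -- two concentric circles with a ratio above `4`, in the disc of radius `ρ`
  set r := ρ / 6 with hr
  have hr0 : 0 < r := by rw [hr]; linarith
  set s := 5 * r with hs
  have hs0 : 0 < s := by rw [hs]; linarith
  have hrn : ‖(r : ℂ)‖ = r := by rw [norm_real, Real.norm_of_nonneg hr0.le]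
  have hsn : ‖(s : ℂ)‖ = s := by rw [norm_real, Real.norm_of_nonneg hs0.le]
  have key := lie_circVal_circVal hc (z := z) hab (M := smulMatrix hG g₁ * U)
    (N := smulMatrix hG g₂ * U) (x := 0) (y := 0) hr0.le hs0.le
    (fun u v hu hv => by
      rw [sub_zero] at hu hv
      rw [chart_smulMatrix_mul, chart_smulMatrix_mul]
      exact had.update_update_mem hG hz (norm_pos_iff.mp (hu ▸ hr0)) (norm_pos_iff.mp (hv ▸ hs0))
        (by linarith) (by linarith) (by linarith) g₁ g₂ a b)
  rwa [zero_add, zero_add, chart_smulMatrix_mul, chart_smulMatrix_mul,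
    had.circVal_inner hG hz hab g₁ g₂ he hr0 (by rw [hsn]; linarith) (by rw [hsn]; linarith),
    had.circVal_outer hG hz hab g₁ g₂ he' (norm_pos_iff.mp (hrn.symm ▸ hr0))
      (by rw [hrn]; linarith) (by linarith)] at key

/-- The local class of two points turning around each other commutes with the class of both points
turning together around `p`. -/
theorem lie_localVal_pair (hc : TorusCommutes c) (hG : G ≤ PSU2)
    (hz : z ∈ orbitConfig G n) {i j : Fin n} (hij : i ≠ j) (g : G) (p : exceptional G) :
    ⁅localVal c hG i z (Sum.inr (⟨j, hij.symm⟩, g)),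
      localVal c hG j z (Sum.inl p) + localVal c hG i z (Sum.inl (smulExc g p)) +
        ∑ᶠ h : MulAction.stabilizer G (p : OnePoint ℂ),
          localVal c hG i z (Sum.inr (⟨j, hij.symm⟩, g * h))⁆ = 0 := by
  obtain ⟨U, ρ, hp, had⟩ := exists_isAdapted hG z p.1
  have hρ := had.pos
  -- the point `z_j` will be at distance `r` of `p`, and `z_i` at distance up to `5 * r`
  set r := ρ / 6 with hr
  have hr0 : 0 < r := by rw [hr]; linarith
  have hrn : ‖(r : ℂ)‖ = r := by rw [norm_real, Real.norm_of_nonneg hr0.le]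
  have hrne : (r : ℂ) ≠ 0 := norm_pos_iff.mp (hrn.symm ▸ hr0)
  have hrρ : ‖(r : ℂ)‖ < ρ := by rw [hrn]; linarith
  have hzj : Function.update z j (chart U r) ∈ orbitConfig G n :=
    update_mem_of_notMem_avoided hz (had.notMem _ hrne hrρ) j
  set M := smulMatrix hG g * U with hM
  have hMc : ∀ w, chart M w = g • chart U w := chart_smulMatrix_mul hG g U
  have hUcont := continuous_chart U
  have hMcont := continuous_chart M
  set e : PunctureIdx G i := Sum.inr (⟨j, hij.symm⟩, g) with he
  have hMe : chart M r = puncture i (Function.update z j (chart U r)) e := by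
    simp [he, puncture, hMc]
  obtain ⟨δ, hδ, hδP⟩ := exists_radius hG i (Function.update z j (chart U r)) M r
  have ev1 := circVal_eventually_eq (c := c) hG hzj i e hMe
  have ev2 : ∀ᶠ ε in 𝓝[>] (0 : ℝ), ε ∈ Ioo 0 (min δ r) := Ioo_mem_nhdsGT (lt_min hδ hr0)
  obtain ⟨ε, hcirc, hε0, hε⟩ := (Filter.Eventually.and ev1 ev2).exists
  rw [lt_min_iff] at hε
  rw [localVal_eq hG i e hzj hz] at hcirc
  have hunit : ∀ t : ℝ, ‖circleMap 0 1 t‖ = 1 := fun t => by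
    simp
  -- both points turn by `θ` around `p`, with arbitrary positions that are permitted at `θ = 0`
  have hrot : ∀ (x : ℂ) (lam : ℂ), ‖x‖ = 1 → lam ≠ 0 → ‖lam‖ < ρ →
      (∀ h : G, h • chart U r ≠ g • chart U lam) →
      Function.update (Function.update z j (chart U (x * r))) i (chart M (x * lam)) ∈
        orbitConfig G n := by
    intro x lam hx hlam hlamρ hne
    have hx0 : x ≠ 0 := norm_pos_iff.mp (by rw [hx]; exact one_pos)
    have n1 : ‖x * r‖ < ρ := by rwa [norm_mul, hx, one_mul]
    have n2 : ‖x * lam‖ < ρ := by rwa [norm_mul, hx, one_mul]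
    rw [hMc]
    refine update_update_mem hz (had.notMem _ (mul_ne_zero hx0 hrne) n1)
      (had.smul_notMem g (mul_ne_zero hx0 hlam) n2) ?_ j i
    intro h hh
    have h1 : (g⁻¹ * h) • chart U (x * r) = chart U (x * lam) := by
      rw [mul_smul, hh, inv_smul_smul]
    obtain ⟨ζ, hζ, hζr⟩ := had.exists_rotation hG (had.smul_center _ _ _ n1 n2 h1)
    rw [hζr] at h1
    have h2 : ζ * r = lam := mul_left_cancel₀ hx0 (by rw [← chart_injective U h1]; ring)
    refine hne h ?_
    rw [← h2, ← hζr, mul_smul, smul_inv_smul]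
  have hclose : ∀ v : ℂ, ‖v - r‖ = ε → v ≠ 0 ∧ ‖v‖ < ρ ∧
      ∀ h : G, h • chart U r ≠ g • chart U v := by
    intro v hv
    refine ⟨?_, ?_, fun h hh => ?_⟩
    · rintro rfl
      rw [zero_sub, norm_neg, hrn] at hv
      linarith
    · have := norm_add_le (v - r) (r : ℂ)
      rw [sub_add_cancel] at this
      linarith
    · refine hδP v ?_ (hv.trans_lt hε.1) (mem_punctureCoords.mpr
        ⟨Sum.inr (⟨j, hij.symm⟩, h), by simp [puncture, hMc, hh]⟩)
      rintro rfl
      rw [sub_self, norm_zero] at hv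
      linarith
  have hc1 := fun t => hclose (circleMap r ε t) (norm_circleMap_sub hε0.le t)
  have hcT := hc (fun x => Function.update (Function.update z j
      (chart U (circleMap 0 1 (2 * Real.pi * x.2) * r))) i
      (chart M (circleMap 0 1 (2 * Real.pi * x.2) * circleMap r ε (2 * Real.pi * x.1))))
    (by fun_prop)
    (fun x => hrot _ _ (hunit _) (hc1 _).1 (hc1 _).2.1 (hc1 _).2.2)
    (fun s => by simp only [circleMap_two_pi_zero, circleMap_two_pi_one])
    (fun s => by simp only [circleMap_two_pi_zero, circleMap_two_pi_one])
  simp only [circleMap_two_pi_zero, zero_add, ofReal_one, one_mul] at hcT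
  rw [circVal] at hcirc
  rw [hcirc] at hcT
  -- the loop that turns both points around `p` does not change when they are moved apart
  have hfar := PathCocycle.val_eq_of_free_homotopy (c := c)
    (fun x => Function.update (Function.update z j
      (chart U (circleMap 0 1 (2 * Real.pi * x.2) * r))) i
      (chart M (circleMap 0 1 (2 * Real.pi * x.2) * ((r + ε) + x.1 * (5 * r - (r + ε)) : ℝ))))
    (Continuous.continuousOn (by fun_prop)) (by
      rintro ⟨s, t⟩ ⟨hs, -⟩
      replace hs : 0 ≤ s ∧ s ≤ 1 := hs
      have b1 : r < (r + ε) + s * (5 * r - (r + ε)) := by nlinarith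
      have b2 : (r + ε) + s * (5 * r - (r + ε)) ≤ 5 * r := by nlinarith
      have b3 : ‖(((r + ε) + s * (5 * r - (r + ε)) : ℝ) : ℂ)‖ =
        (r + ε) + s * (5 * r - (r + ε)) := by rw [norm_real, Real.norm_of_nonneg (by linarith)]
      refine hrot _ _ (hunit _) (norm_pos_iff.mp (by rw [b3]; linarith)) (by rw [b3]; linarith) ?_
      intro h hh
      have := had.norm_eq hG (g := g⁻¹ * h) hrρ (by rw [b3]; linarith) (by
        rw [mul_smul, hh, inv_smul_smul])
      rw [b3, hrn] at this
      linarith)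
    (fun s _ => by simp only [circleMap_two_pi_zero, circleMap_two_pi_one])
  simp only [zero_mul, add_zero, one_mul, add_sub_cancel, ofReal_add] at hfar
  rw [hfar] at hcT
  have hn5 : ‖((5 * r : ℝ) : ℂ)‖ = 5 * r := by
    rw [norm_real, Real.norm_of_nonneg (by linarith)]
  -- far apart, the two points can turn one after the other
  have hdiag := PathCocycle.val_diagonal c (T := fun x => Function.update (Function.update z j
      (chart U (circleMap 0 1 (2 * Real.pi * x.1) * r))) i
      (chart M (circleMap 0 1 (2 * Real.pi * x.2) * (5 * r : ℝ)))) (by fun_prop) (by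
      intro x
      have n1 : ‖circleMap 0 1 (2 * Real.pi * x.1) * r‖ = r := by
        rw [norm_mul, hunit, one_mul, hrn]
      have n2 : ‖circleMap 0 1 (2 * Real.pi * x.2) * (5 * r : ℝ)‖ = 5 * r := by
        rw [norm_mul, hunit, one_mul, hn5]
      have := had.update_update_mem hG hz (norm_pos_iff.mp (n1.symm ▸ hr0))
        (norm_pos_iff.mp (by rw [n2]; linarith)) (by linarith) (by linarith)
        (by rw [n1, n2]; linarith) (1 : G) g j i
      rw [hMc]
      rwa [one_smul] at this)
    (fun s => by simp only [circleMap_two_pi_zero, circleMap_two_pi_one])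
  simp only [circleMap_two_pi_zero, zero_add, ofReal_one, one_mul] at hdiag
  have hcm : ∀ (s t : ℝ), circleMap 0 1 t * s = circleMap 0 s t := fun s t => by
    simp only [circleMap]
    push_cast
    ring
  simp only [hcm] at hdiag
  have hin := had.circVal_inner (c := c) hG hz hij.symm 1 g (e := Sum.inl p)
    (fun y => by rw [one_smul, hp]; rfl) hr0 (v := (5 * r : ℝ)) (by rw [hn5]; linarith)
    (by rw [hn5]; linarith)
  have hout := had.circVal_outer (c := c) hG hz hij.symm 1 g (e := Sum.inl (smulExc g p))
    (fun y => by rw [hp]; rfl) hrne (s := 5 * r) (by rw [hrn]; linarith) (by linarith)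
  rw [circVal] at hin hout
  rw [hp] at hout
  simp only [chart_smulMatrix_mul, one_smul, inv_one, mul_one] at hin hout
  simp only [hcm] at hcT
  rw [hdiag] at hcT
  simp only [Function.update_comm hij.symm] at hcT hout
  simp only [hMc] at hcT
  rw [hin, hout, ← add_assoc] at hcT
  exact hcT

end Lie

end Relations

/-! ### The morphism -/

section Assembly

open Set OnePoint

variable {K : Type*} [Field K] {n : ℕ} {G : Subgroup (Equiv.Perm (OnePoint ℂ))}

theorem exists_quotient_paths [Finite G] (hG : G ≤ PSU2) (q : orbitConfig G n) :
    Nonempty (∀ x : orbitConfig G n, Path.Homotopic.Quotient q x) :=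
  ⟨fun x => Path.Homotopic.Quotient.mk (joinedIn_orbitConfig hG q.2 x.2).joined_subtype.somePath⟩

/-- A torus of configurations gives two commuting elements of the fundamental group. -/
theorem torusCommutes_fundamentalCocycle {A : Type*} [LieRing A] {q : orbitConfig G n}
    (b : ∀ x : orbitConfig G n, Path.Homotopic.Quotient q x)
    (l : FundamentalGroup (orbitConfig G n) q → A) (hl : ∀ γ δ, l (γ * δ) = l γ + l δ)
    (hcomm : ∀ γ δ, Commute γ δ → ⁅l γ, l δ⁆ = 0) :
    TorusCommutes (fundamentalCocycle b l hl) := by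
  intro T hT hm h1 h2
  obtain ⟨γ, δ, hγδ, hγ, hδ⟩ := exists_commute_of_torus b l hl hT hm h1 h2
  rw [hγ, hδ, hcomm γ δ hγδ]

/-- The images of the generators: the sign accounts for the orientation of the loops. -/
def genImage {A : Type*} [AddCommGroup A] [Finite G] (c : PathCocycle (orbitConfig G n) A)
    (hG : G ≤ PSU2) (z : Fin n → OnePoint ℂ) : Gen G n → A
  | .pair i j hij g => -localVal c hG i z (Sum.inr (⟨j, hij.symm⟩, g))
  | .point i p => -localVal c hG i z (Sum.inl p)

/-- The relations of `𝔭_n(G)` hold: those of degree one by the symmetry and the sum formula for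
local values, those of degree two by means of tori. -/
theorem lift_genImage_eq_zero {A : Type*} [LieRing A] [LieAlgebra K A] [Finite G]
    {c : PathCocycle (orbitConfig G n) A} (hc : TorusCommutes c) (hG : G ≤ PSU2)
    {z : Fin n → OnePoint ℂ} (hz : z ∈ orbitConfig G n) {x : FreeLieAlgebra K (Gen G n)}
    (hx : Rel K G n x) : FreeLieAlgebra.lift K (genImage c hG z) x = 0 := by
  have hX : ∀ {i j : Fin n} (hij : i ≠ j) (g : G), FreeLieAlgebra.lift K (genImage c hG z)
      (X K hij g) = -localVal c hG i z (Sum.inr (⟨j, hij.symm⟩, g)) := fun hij g =>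
    FreeLieAlgebra.lift_of_apply _ _
  have hY : ∀ (i : Fin n) (p : exceptional G), FreeLieAlgebra.lift K (genImage c hG z)
      (Y K i p) = -localVal c hG i z (Sum.inl p) := fun i p =>
    FreeLieAlgebra.lift_of_apply _ _
  have hindep : ∀ {i j : Fin n} (hij : i ≠ j) (k : Fin n) (hki : k ≠ i) (hjk : j ≠ k) (g : G)
      (y : OnePoint ℂ), puncture (G := G) i (Function.update z j y) (Sum.inr (⟨k, hki⟩, g)) =
        g • z k := fun _ k _ hjk g y => by
    simp [puncture, Function.update_of_ne hjk.symm]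
  have := (finite_exceptional hG).to_subtype
  have := Fintype.ofFinite (exceptional G)
  have := Fintype.ofFinite G
  cases hx with
  | symm hij g =>
    rw [map_sub, hX, hX, localVal_symm c hG hz hij, sub_self]
  | sum i =>
    have h := sum_localVal_eq_zero c hG hz i
    rw [Fintype.sum_sum_type, Fintype.sum_prod_type] at h
    simp only [finsum_eq_sum_of_fintype, map_add, map_sum, hX, hY, Finset.sum_neg_distrib]
    rw [← neg_add, h, neg_zero]
  | four hij hik hil hjk hjl hkl g g' =>
    rw [LieHom.map_lie, hX, hX, neg_lie, lie_neg, neg_neg]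
    refine lie_localVal_of_disjoint hc hG hz hik (fun y => ?_) (fun y => ?_) fun h hh => ?_
    · rw [hindep hik _ _ hjk.symm]; rfl
    · rw [hindep hik.symm _ _ hil]; rfl
    · refine hz.2 _ _ hjl ((h * g)⁻¹ * g') ?_
      rw [mul_smul, eq_inv_smul_iff, mul_smul]
      exact hh
  | @three i j k hij hik hjk g g' =>
    rw [LieHom.map_lie, map_add, hX, hX, hX, ← neg_add, neg_lie, lie_neg, neg_neg]
    have h := lie_localVal_nested hc hG hz hik (z j) g (g' * g) (e := Sum.inr (⟨j, hij.symm⟩, g))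
      (e' := Sum.inr (⟨j, hjk⟩, g' * g)) (hindep hik _ _ hjk.symm g)
      (hindep hik.symm _ _ hij (g' * g))
    have hst : MulAction.stabilizer G (z j) = ⊥ := not_not.mp (hz.1 j)
    have hun : Unique (MulAction.stabilizer G (z j)) := by
      rw [hst]
      infer_instance
    rw [finsum_unique] at h
    have h1 : ((default : MulAction.stabilizer G (z j)) : G) = 1 := by
      rw [Subsingleton.elim default (1 : MulAction.stabilizer G (z j))]
      rfl
    rwa [h1, mul_one, mul_inv_cancel_right] at h
  | @threePoint i j k hij hik hjk p g' =>
    rw [LieHom.map_lie, hX, hY, neg_lie, lie_neg, neg_neg]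
    refine lie_localVal_of_disjoint hc hG hz hij (fun y => rfl) (fun y => ?_) fun h hh => ?_
    · rw [hindep hij.symm _ _ hik]; rfl
    · refine hz.1 k ((smul_mem_exceptional_iff g').mp ?_)
      change h • (p : OnePoint ℂ) = g' • z k at hh
      rw [← hh]
      exact smul_mem_exceptional h p.2
  | twoPoint hij p q hpq =>
    rw [LieHom.map_lie, hY, hY, neg_lie, lie_neg, neg_neg]
    exact lie_localVal_of_disjoint hc hG hz hij (fun y => rfl) (fun y => rfl)
      fun h hh => hpq ⟨h, hh⟩
  | stab hij g p =>
    have := Fintype.ofFinite (MulAction.stabilizer G (p : OnePoint ℂ))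
    have h := lie_localVal_pair hc hG hz hij g p
    rw [finsum_eq_sum_of_fintype] at h
    simp only [LieHom.map_lie, finsum_eq_sum_of_fintype, map_add, map_sum, hX, hY,
      Finset.sum_neg_distrib]
    rwa [← neg_add, ← neg_add, neg_lie, lie_neg, neg_neg]
  | @stabPoint i j hij g p =>
    have := Fintype.ofFinite (MulAction.stabilizer G (p : OnePoint ℂ))
    have h := lie_localVal_nested hc hG hz hij.symm p 1 g (e := Sum.inl p)
      (e' := Sum.inl (smulExc g p)) (fun y => (one_smul _ _).symm) (fun y => rfl)
    simp only [inv_one, mul_one, finsum_eq_sum_of_fintype] at h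
    simp only [LieHom.map_lie, finsum_eq_sum_of_fintype, map_add, map_sum, hX, hY,
      Finset.sum_neg_distrib]
    rwa [← neg_add, neg_lie, lie_neg, neg_neg]

/-- Local values of the cocycle defined by `l` are values of `l`. -/
theorem exists_localVal_fundamentalCocycle_eq {A : Type*} [AddCommGroup A] [Finite G]
    (hG : G ≤ PSU2) {q : orbitConfig G n}
    (b : ∀ x : orbitConfig G n, Path.Homotopic.Quotient q x)
    (l : FundamentalGroup (orbitConfig G n) q → A) (hl : ∀ γ δ, l (γ * δ) = l γ + l δ)
    (i : Fin n) (e : PunctureIdx G i) :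
    ∃ γ, localVal (fundamentalCocycle b l hl) hG i q.1 e = l γ := by
  obtain ⟨f, hf⟩ := exists_val_eq_localVal (c := fundamentalCocycle b l hl) hG q.2 i e
  obtain ⟨γ, hγ⟩ := exists_fundamentalCocycle_eq b l hl f
  exact ⟨γ, hf.symm.trans hγ⟩

theorem apply_eq_neg_localVal_of_isClassAround {A : Type*} [AddCommGroup A] [Finite G]
    (hG : G ≤ PSU2) {q : orbitConfig G n}
    (b : ∀ x : orbitConfig G n, Path.Homotopic.Quotient q x)
    (l : FundamentalGroup (orbitConfig G n) q → A) (hl : ∀ γ δ, l (γ * δ) = l γ + l δ)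
    {i : Fin n} (e : PunctureIdx G i) {x : FundamentalGroup (orbitConfig G n) q}
    (hx : IsClassAround q i (puncture i q.1 e) x) :
    l x = -localVal (fundamentalCocycle b l hl) hG i q.1 e := by
  obtain ⟨γ, hγ, rfl⟩ := hx
  obtain ⟨f, hf, hv⟩ := val_of_isLoopAround (c := fundamentalCocycle b l hl) hG q i e hγ
  rw [← hv]
  exact (fundamentalCocycle_loop b l hl γ hf).symm

/-- Any additive map of degree one on the fundamental group for which commuting elements have
commuting images defines a morphism on the completion of `𝔭_n(G)`. -/
theorem existsUnique_filtered_hom_of_additive [Finite G] (hG : G ≤ PSU2) {L : Type*} [LieRing L]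
    [LieAlgebra K L] (𝓕 : LieFiltration K L) {q : orbitConfig G n}
    (l : FundamentalGroup (orbitConfig G n) q → 𝓕.GrHat) (hl : ∀ γ δ, l (γ * δ) = l γ + l δ)
    (hdeg : ∀ γ, ∀ m ≠ 1, l γ m = 0) (hcomm : ∀ γ δ, Commute γ δ → ⁅l γ, l δ⁆ = 0)
    {x : Fin n → Fin n → G → FundamentalGroup (orbitConfig G n) q}
    {y : Fin n → exceptional G → FundamentalGroup (orbitConfig G n) q}
    (hx : ∀ i j : Fin n, i < j → ∀ g : G, IsClassAround q i (g • q.1 j) (x i j g))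
    (hy : ∀ (k : Fin n) (p : exceptional G), IsClassAround q k p (y k p)) :
    ∃! φ : OrbitLieHat K G n →ₗ⁅K⁆ 𝓕.GrHat,
      (∀ m : ℕ, ∀ a ∈ degreeFiltration K (orbitLieGen K G n) m, φ a ∈ 𝓕.grHatFiltration m) ∧
      (∀ (i j : Fin n) (hij : i < j) (g : G), φ (hatX K hij.ne g) = l (x i j g)) ∧
      (∀ (k : Fin n) (p : exceptional G), φ (hatY K k p) = l (y k p)) := by
  obtain ⟨b⟩ := exists_quotient_paths hG q
  have hx' : ∀ (i j : Fin n) (hij : i < j) (g : G), l (x i j g) =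
      genImage (fundamentalCocycle b l hl) hG q.1 (.pair i j hij.ne g) := fun i j hij g =>
    apply_eq_neg_localVal_of_isClassAround hG b l hl (Sum.inr (⟨j, hij.ne'⟩, g)) (hx i j hij g)
  have hy' : ∀ (k : Fin n) (p : exceptional G), l (y k p) =
      genImage (fundamentalCocycle b l hl) hG q.1 (.point k p) := fun k p =>
    apply_eq_neg_localVal_of_isClassAround hG b l hl (Sum.inl p) (hy k p)
  have hT := torusCommutes_fundamentalCocycle b l hl hcomm
  have hloc : ∀ i e m, m ≠ 1 →
      (-localVal (fundamentalCocycle b l hl) hG i q.1 e) m = 0 := by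
    intro i e m hm
    obtain ⟨γ, hγ⟩ := exists_localVal_fundamentalCocycle_eq hG b l hl i e
    rw [hγ]
    exact neg_eq_zero.mpr (hdeg γ m hm)
  have hgen : ∀ (a : Gen G n), ∀ m ≠ 1, genImage (fundamentalCocycle b l hl) hG q.1 a m = 0 := by
    intro a m hm
    cases a with
    | pair i j hij g => exact hloc i _ m hm
    | point i p => exact hloc i _ m hm
  have h := existsUnique_filtered_hom 𝓕 _ hgen
    (fun _ hr => lift_genImage_eq_zero (K := K) hT hG q.2 hr)
  refine (existsUnique_congr fun φ => ?_).mpr h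
  refine and_congr Iff.rfl (and_congr (forall₄_congr fun i j hij g => ?_)
    (forall₂_congr fun k p => ?_))
  · rw [hx' i j hij g]
  · rw [hy' k p]

end Assembly

end

end OrbitConf

theorem mainTheorem6 {K : Type*} [Field K] [CharZero K] {n : ℕ} (hn : 0 < n)
    (G : Subgroup (Equiv.Perm (OnePoint ℂ))) [Finite G] (hG : G ≤ OrbitConf.PSU2)
    (q : OrbitConf.orbitConfig G n)
    (x : Fin n → Fin n → G → FundamentalGroup (OrbitConf.orbitConfig G n) q)
    (y : Fin n → OrbitConf.exceptional G → FundamentalGroup (OrbitConf.orbitConfig G n) q)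
    (hx : ∀ i j : Fin n, i < j → ∀ g : G, OrbitConf.IsClassAround q i (g • q.1 j) (x i j g))
    (hy : ∀ (k : Fin n) (p : OrbitConf.exceptional G), OrbitConf.IsClassAround q k p (y k p)) :
    ∃! φ : OrbitConf.OrbitLieHat K G n →ₗ⁅K⁆
        (OrbitConf.malcevFiltration K (FundamentalGroup (OrbitConf.orbitConfig G n) q)).GrHat,
      (∀ m : ℕ, ∀ a ∈ OrbitConf.degreeFiltration K (OrbitConf.orbitLieGen K G n) m,
        φ a ∈ (OrbitConf.malcevFiltration K (FundamentalGroup (OrbitConf.orbitConfig G n) q)).grHatFiltration m) ∧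
      (∀ (i j : Fin n) (hij : i < j) (g : G), φ (OrbitConf.hatX K hij.ne g) = OrbitConf.logClass K (x i j g)) ∧
      (∀ (k : Fin n) (p : OrbitConf.exceptional G), φ (OrbitConf.hatY K k p) = OrbitConf.logClass K (y k p)) := by
  exact OrbitConf.existsUnique_filtered_hom_of_additive hG _ (OrbitConf.logClass K)
    (OrbitConf.logClass_mul K) (fun γ _ hm => OrbitConf.logClass_apply_of_ne K γ hm)
    (fun _ _ h => OrbitConf.logClass_lie_of_commute K h) hx hy
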